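/- **Model.** Terrestrial base stations (TBSs) at altitude $H_{\mathrm b}>0$ and UAVs at altitude $H_{\mathrm u}>0$ have horizontal positions given by two independent homogeneous Poisson point processes $\Phi_{\mathrm b},\Phi_{\mathrm u}$ on $\mathbb R^2$ with densities $\lambda_{\mathrm b},\lambda_{\mathrm u}>0$; the typical user is at the origin of the ground plane. The link from a UAV at distance $r$ is in line of sight (condition $\mathrm L$), independently of everything else, with probability $p_{\mathrm L}(r)=\big(1+\mu_a\exp\{-\mu_b[\tfrac{180}{\pi}\arcsin(H_{\mathrm u}/r)-\mu_a]\}\big)^{-1}$ ($\mu_a,\mu_b>0$), and otherwise has condition $\mathrm N$, with $p_{\mathrm N}=1-p_{\mathrm L}$; links from TBSs have condition $\mathrm b$. Let $\mathcal K=\{\mathrm b,\mathrm L,\mathrm N\}$ and let $\Phi_k$ be the set of transmitters with link condition $k$. For $k\in\{\mathrm L,\mathrm N\}$ put $P_k=P_{\mathrm u}$, $G_{\mathrm M,k}=G_{\mathrm M,\mathrm u}$, $H_k=H_{\mathrm u}$. Links of condition $k$ have path loss $\kappa_k r^{-\alpha_k}$ and independent fading gains $\mathsf H\sim\mathrm{Gamma}(\mathsf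 M_k,1/\mathsf M_k)$ (shape, scale) with integers $\mathsf M_k\ge1$; transmit powers $P_k$, maximum gains $G_{\mathrm M,k}$, intercepts $\kappa_k$ and exponents $\alpha_k$ are positive, and the noise power is $N_0\ge0$. The antenna gain of a TBS or UAV is a function $G_j(\theta)$, $\theta\in[0,\pi]$, $j\in\{\mathrm b,\mathrm u\}$, of the angle off its boresight, with $G_j(0)=G_{\mathrm M,j}$. TBS antennas point vertically downward; UAV antennas either point vertically downward (scenario $\mathrm{VA}$) or are steered exactly towards the UAV's own ground user (scenario $\mathrm{SA}$). In scenario $\varsigma$, $l_k^{(\varsigma)}(r)$ is the average power received from a serving transmitter of condition $k$ at distance $r$; the typical user is served by the transmitter $X^\star$ with the largest average received power, all other transmitters interfere, and $\mathrm{SINR}=l_k^{(\varsigma)}(\|X^\star\|)\mathsf H_{X^\star}/(N_0+I)$ if $X^\star\in\Phi_k$, where $I$ is the total interference. For $\gamma>0$ and $b\in\mathbb N$ let $\mathcal P_{\mathrm s}(\gamma)=\mathbb P(\mathrm{SINR}>\gamma\mid\text{positions and link conditions})$ be the conditional success probability and $M_b^{(\varsigma)}(\gamma)=\mathbb E[\mathcal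 P_{\mathrm s}(\gamma)^b]$. **Notation.** $\bar\lambda_{\mathrm b}(r)=2\pi\lambda_{\mathrm b}r$ for $r\ge H_{\mathrm b}$; $\bar\lambda_k(r)=2\pi\lambda_{\mathrm u}r\,p_k(r)$ for $r\ge H_{\mathrm u}$, $k\in\{\mathrm L,\mathrm N\}$; zero otherwise; $\bar\Lambda_k([0,r])=\int_0^r\bar\lambda_k(x)\,\mathrm dx$; $\phi_k=\mathsf M_k(\mathsf M_k!)^{-1/\mathsf M_k}$; and $\exp(-\infty)=0$. **Statement.** Suppose that the antennas are isotropic: $G_j(\theta)=G_{\mathrm M,j}$ for all $\theta\in[0,\pi]$ and $j\in\{\mathrm b,\mathrm u\}$. Then, for both $\varsigma\in\{\mathrm{SA},\mathrm{VA}\}$, $l_k^{(\varsigma)}(r)=P_kG_{\mathrm M,k}\kappa_kr^{-\alpha_k}$, the function $\chi_{k,\ell}=(l_\ell^{(\varsigma)})^{-1}\circ l_k^{(\varsigma)}$ is $$\chi_{k,\ell}(y)=\eta_{k,\ell}^{1/\alpha_\ell}\,y^{\alpha_k/\alpha_\ell},\qquad \eta_{k,\ell}=\frac{P_\ell G_{\mathrm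 M,\ell}\kappa_\ell}{P_kG_{\mathrm M,k}\kappa_k},$$ $M_b^{(\mathrm{SA})}(\gamma)=M_b^{(\mathrm{VA})}(\gamma)=:M_b(\gamma)$, and $M_b(\gamma)$ is approximated by $$F_b(\gamma)=\sum_{k\in\mathcal K}\sum_{n=0}^{b}\sum_{m=0}^{\mathsf M_kn}\binom bn\binom{\mathsf M_kn}{m}(-1)^{n+m}\int_0^\infty\bar\lambda_k(y)\exp\Bigg\{-\frac{m\gamma\phi_kN_0}{P_kG_{\mathrm M,k}\kappa_ky^{-\alpha_k}}-\sum_{\ell\in\mathcal K}\Bigg[\bar\Lambda_\ell([0,\chi_{k,\ell}(y)])+\int_{\chi_{k,\ell}(y)}^\infty\Big[1-\Big(1+\frac{m\gamma\phi_k\eta_{k,\ell}}{\mathsf M_\ell r^{\alpha_\ell}y^{-\alpha_k}}\Big)^{-\mathsf M_\ell}\Big]\bar\lambda_\ell(r)\,\mathrm dr\Bigg]\Bigg\}\,\mathrm dy$$ in the following sense. Let $$S=1-\Big(1-\exp\Big\{-\frac{\gamma\phi_k(N_0+I)}{l_k^{(\varsigma)}(\|X^\star\|)}\Big\}\Big)^{\mathsf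 M_k}\quad\text{on }\{X^\star\in\Phi_k\},$$ and let $\tilde M_b(\gamma)=\mathbb E\big[\mathbb E[S\mid\text{positions and link conditions}]^b\big]$. Then $M_b(\gamma)\le\tilde M_b(\gamma)\le F_b(\gamma)=\mathbb E[S^b]$; the first inequality is an equality if $\mathsf M_k=1$ for all $k$, and the second is an equality if $b\le1$. -/

import Mathlib

open MeasureTheory ProbabilityTheory
open scoped ENNReal NNReal

noncomputable section

/-! ### Poisson point processes -/

/-- The random points `X 0, X 1, …` form a Poisson point process with intensity measure `Λ`:
the numbers of points in finitely many pairwise disjoint measurable sets of finite intensity are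
independent Poisson random variables with means `Λ (A 0), Λ (A 1), …`. -/
structure IsPoissonPointProcess {Ω E : Type*} [MeasurableSpace Ω] [MeasurableSpace E]
    (P : Measure Ω) (Λ : Measure E) (X : ℕ → Ω → E) : Prop where
  measurable : ∀ i, Measurable (X i)
  counts : ∀ (m : ℕ) (A : Fin m → Set E) (n : Fin m → ℕ),
    (∀ j, MeasurableSet (A j)) → (∀ j, Λ (A j) ≠ ∞) →
    Pairwise (fun j j' => Disjoint (A j) (A j')) →
    P {ω | ∀ j, {i | X i ω ∈ A j}.encard = n j} =
      ∏ j, poissonMeasure (Λ (A j)).toNNReal {n j}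

/-! ### Parameters of the network -/

/-- The two kinds of transmitters: terrestrial base stations `b` and UAVs `u`. -/
inductive Station
  | b
  | u
  deriving DecidableEq

/-- The three link conditions: ground-to-ground `b`, air-to-ground line of sight `L`,
air-to-ground non line of sight `N`. -/
inductive Tier
  | b
  | L
  | N
  deriving DecidableEq

instance : Fintype Tier := ⟨{.b, .L, .N}, fun k => by cases k <;> simp⟩

instance : MeasurableSpace Tier := ⊤

/-- The kind of transmitter that serves a link of a given condition. -/
def Tier.station : Tier → Station
  | .b => .b
  | .L => .u
  | .N => .u

/-- Steerable antennas and vertical antennas at the UAVs. -/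
inductive Scenario
  | SA
  | VA
  deriving DecidableEq

/-- The parameters of a UAV-assisted cellular network. -/
structure Network where
  /-- altitude -/
  H : Station → ℝ
  /-- density of the point process -/
  dens : Station → ℝ
  /-- transmit power -/
  Pow : Station → ℝ
  /-- maximum antenna gain -/
  GM : Station → ℝ
  /-- antenna gain as a function of the angle off the boresight, in `[0, π]` -/
  gain : Station → ℝ → ℝ
  /-- path-loss exponent -/
  α : Tier → ℝ
  /-- path-loss intercept -/
  κ : Tier → ℝ
  /-- fading parameter -/
  M : Tier → ℕ
  /-- noise power -/
  N₀ : ℝ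
  /-- first environment parameter of the line-of-sight probability -/
  μa : ℝ
  /-- second environment parameter of the line-of-sight probability -/
  μb : ℝ
  H_pos : ∀ j, 0 < H j
  dens_pos : ∀ j, 0 < dens j
  Pow_pos : ∀ j, 0 < Pow j
  GM_pos : ∀ j, 0 < GM j
  gain_zero : ∀ j, gain j 0 = GM j
  α_pos : ∀ k, 0 < α k
  κ_pos : ∀ k, 0 < κ k
  M_pos : ∀ k, 0 < M k
  N₀_nonneg : 0 ≤ N₀
  μa_pos : 0 < μa
  μb_pos : 0 < μb

/-- `exp (-x)` for `x ∈ [0, ∞]`, with `exp (-∞) = 0`. -/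
def expNeg (x : ℝ≥0∞) : ℝ := if x = ∞ then 0 else Real.exp (-x.toReal)

namespace Network

variable (N : Network)

/-- All antennas radiate with the same gain in all directions. -/
def IsIsotropic : Prop := ∀ j, ∀ θ ∈ Set.Icc 0 Real.pi, N.gain j θ = N.GM j

/-- Line-of-sight probability of an air-to-ground link of length `r`. -/
def pL (r : ℝ) : ℝ :=
  1 / (1 + N.μa * Real.exp (-(N.μb * (180 / Real.pi * Real.arcsin (N.H .u / r) - N.μa))))

/-- Angle off the boresight of a serving transmitter at link distance `r`: a steerable UAV antenna
points at its user, all other antennas point vertically to the ground. -/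
def servingAngle (s : Scenario) (k : Tier) (r : ℝ) : ℝ :=
  match s, k.station with
  | .SA, .u => 0
  | .VA, .u => Real.arccos (N.H .u / r)
  | _, .b => Real.arccos (N.H .b / r)

/-- Average power received from a serving transmitter over a link of condition `k` and
length `r`. -/
def l (s : Scenario) (k : Tier) (r : ℝ) : ℝ :=
  N.Pow k.station * N.gain k.station (N.servingAngle s k r) * N.κ k * r ^ (-N.α k)

/-- Intensity of the point process of the link distances of condition `k`. -/
def lamBar (k : Tier) (r : ℝ) : ℝ :=
  if N.H k.station ≤ r then
    match k with
    | .b => 2 * Real.pi * N.dens .b * r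
    | .L => 2 * Real.pi * N.dens .u * r * N.pL r
    | .N => 2 * Real.pi * N.dens .u * r * (1 - N.pL r)
  else 0

/-- Intensity measure of `[0, r]` for the point process of the link distances of
condition `k`. -/
def LamBar (k : Tier) (r : ℝ) : ℝ :=
  if N.H k.station ≤ r then
    match k with
    | .b => Real.pi * N.dens .b * (r ^ 2 - N.H .b ^ 2)
    | .L => 2 * Real.pi * N.dens .u * ∫ x in N.H .u..r, N.pL x * x
    | .N => 2 * Real.pi * N.dens .u * ∫ x in N.H .u..r, (1 - N.pL x) * x
  else 0

/-- `φ k = M k * (M k)! ^ (-1 / M k)`. -/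
def φ (k : Tier) : ℝ := N.M k * ((N.M k).factorial : ℝ) ^ (-1 / (N.M k : ℝ))

/-- Ratio of power, gain and intercept of two link conditions. -/
def η (k ℓ : Tier) : ℝ :=
  (N.Pow ℓ.station * N.GM ℓ.station * N.κ ℓ) / (N.Pow k.station * N.GM k.station * N.κ k)

/-- `χ k ℓ y = η k ℓ ^ (1 / α ℓ) * y ^ (α k / α ℓ)`. -/
def χ (k ℓ : Tier) (y : ℝ) : ℝ := N.η k ℓ ^ (1 / N.α ℓ) * y ^ (N.α k / N.α ℓ)

/-- The exponent in the moment formula, in `[0, ∞]` (the interference integral diverges if a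
path-loss exponent is at most two). -/
def exponent (k : Tier) (m : ℕ) (γ y : ℝ) : ℝ≥0∞ :=
  ENNReal.ofReal
      (m * γ * N.φ k * N.N₀ / (N.Pow k.station * N.GM k.station * N.κ k * y ^ (-N.α k))) +
    ∑ ℓ : Tier,
      (ENNReal.ofReal (N.LamBar ℓ (N.χ k ℓ y)) +
        ∫⁻ r in Set.Ioi (N.χ k ℓ y),
          ENNReal.ofReal
            ((1 - ((1 + m * γ * N.φ k * N.η k ℓ /
                (N.M ℓ * (r ^ N.α ℓ * y ^ (-N.α k)))) ^ N.M ℓ)⁻¹) * N.lamBar ℓ r))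

/-- The expression for the `b`-th moment of the conditional success probability under isotropic
antennas. -/
def momentFormula (b : ℕ) (γ : ℝ) : ℝ :=
  ∑ k : Tier, ∑ n ∈ Finset.range (b + 1), ∑ m ∈ Finset.range (N.M k * n + 1),
    (b.choose n : ℝ) * ((N.M k * n).choose m : ℝ) * (-1) ^ (n + m) *
      ∫ y in Set.Ioi (0 : ℝ), N.lamBar k y * expNeg (N.exponent k m γ y)

end Network

/-! ### The random network -/

/-- The ground plane, with the typical user at the origin. -/
abbrev Plane := EuclideanSpace ℝ (Fin 2)

/-- The point above `x` at altitude `h`. -/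
def atAltitude (x : Plane) (h : ℝ) : EuclideanSpace ℝ (Fin 3) := !₂[x 0, x 1, h]

/-- Labels of the independent sources of randomness. -/
inductive Source
  | points (j : Station)
  | mark (i : ℕ)
  | fading (k : Tier) (i : ℕ)

/-- The sigma-algebra generated by one source of randomness. -/
@[reducible] def sourceSigma {Ω : Type*} (X : Station → ℕ → Ω → Plane) (U : ℕ → Ω → ℝ)
    (h : Tier → ℕ → Ω → ℝ) : Source → MeasurableSpace Ω
  | .points j => ⨆ i, MeasurableSpace.comap (X j i) inferInstance
  | .mark i => MeasurableSpace.comap (U i) inferInstance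
  | .fading k i => MeasurableSpace.comap (h k i) inferInstance

/-- A random network with parameters `N` on the probability space `(Ω, P)`. -/
structure Realization (N : Network) {Ω : Type*} [MeasurableSpace Ω] (P : Measure Ω) where
  /-- horizontal positions of the transmitters -/
  X : Station → ℕ → Ω → Plane
  /-- uniform marks that decide independently which air-to-ground links are in line of sight -/
  U : ℕ → Ω → ℝ
  /-- `fade k i` is the fading gain of the `i`-th transmitter if its link has condition `k` -/
  fade : Tier → ℕ → Ω → ℝ
  /-- ground position of the user towards which the `i`-th UAV steers its antenna when it does not
  serve the typical user; no assumption on its law is made -/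
  target : ℕ → Ω → Plane
  poisson : ∀ j, IsPoissonPointProcess P (ENNReal.ofReal (N.dens j) • volume) (X j)
  mark_measurable : ∀ i, Measurable (U i)
  mark_law : ∀ i, P.map (U i) = volume.restrict (Set.Icc (0 : ℝ) 1)
  fade_measurable : ∀ k i, Measurable (fade k i)
  fade_law : ∀ k i, P.map (fade k i) = gammaMeasure (N.M k) (N.M k)
  target_measurable : ∀ i, Measurable (target i)
  independent : iIndep (sourceSigma X U fade) P

/-- A transmitter: its kind and its number. -/
abbrev Transmitter := Station × ℕ

namespace Realization

variable {N : Network} {Ω : Type*} [MeasurableSpace Ω] {P : Measure Ω} (W : Realization N P)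

/-- Length of the link from a transmitter to the typical user. -/
def linkDist (x : Transmitter) (ω : Ω) : ℝ := Real.sqrt (‖W.X x.1 x.2 ω‖ ^ 2 + N.H x.1 ^ 2)

open Classical in
/-- Condition of the link from a transmitter to the typical user; given the positions, an
air-to-ground link of length `r` is in line of sight with probability `pL r`. -/
def tier (x : Transmitter) (ω : Ω) : Tier :=
  match x.1 with
  | .b => .b
  | .u => if W.U x.2 ω ≤ N.pL (W.linkDist x ω) then .L else .N

/-- Angle off the boresight of an interfering transmitter, seen from the typical user. -/
def interfererAngle (s : Scenario) (x : Transmitter) (ω : Ω) : ℝ :=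
  match s, x.1 with
  | .SA, .u => EuclideanGeometry.angle (0 : EuclideanSpace ℝ (Fin 3))
      (atAltitude (W.X .u x.2 ω) (N.H .u)) (atAltitude (W.target x.2 ω) 0)
  | .VA, .u => Real.arccos (N.H .u / W.linkDist x ω)
  | _, .b => Real.arccos (N.H .b / W.linkDist x ω)

/-- Average power that the typical user would receive from a transmitter that serves it. -/
def avgPower (s : Scenario) (x : Transmitter) (ω : Ω) : ℝ := N.l s (W.tier x ω) (W.linkDist x ω)

/-- The serving transmitter: the one with the strongest average received power (almost surely
there is exactly one such transmitter). -/
def serving (s : Scenario) (ω : Ω) : Transmitter :=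
  Classical.epsilon (h := ⟨(Station.b, 0)⟩) fun x => ∀ x', W.avgPower s x' ω ≤ W.avgPower s x ω

/-- Fading gain of the link from a transmitter to the typical user. -/
def fadingGain (x : Transmitter) (ω : Ω) : ℝ := W.fade (W.tier x ω) x.2 ω

open Classical in
/-- Interference from the transmitters with link condition `ℓ`. -/
def interference (s : Scenario) (ℓ : Tier) (ω : Ω) : ℝ≥0∞ :=
  ∑' x : Transmitter,
    if x ≠ W.serving s ω ∧ W.tier x ω = ℓ then
      ENNReal.ofReal (N.Pow x.1 * N.gain x.1 (W.interfererAngle s x ω) * W.fadingGain x ω *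
        N.κ ℓ * W.linkDist x ω ^ (-N.α ℓ))
    else 0

/-- Noise plus interference. -/
def noiseInterference (s : Scenario) (ω : Ω) : ℝ≥0∞ :=
  ENNReal.ofReal N.N₀ + ∑ ℓ : Tier, W.interference s ℓ ω

/-- The signal-to-interference-plus-noise ratio at the typical user. -/
def SINR (s : Scenario) (ω : Ω) : ℝ≥0∞ :=
  ENNReal.ofReal (W.avgPower s (W.serving s ω) ω * W.fadingGain (W.serving s ω) ω) /
    W.noiseInterference s ω

/-- The sigma-algebra of the network geometry: all positions and all link conditions. -/
@[reducible] def geometry : MeasurableSpace Ω :=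
  (⨆ x : Transmitter, MeasurableSpace.comap (W.X x.1 x.2) inferInstance) ⊔
    ⨆ x : Transmitter, MeasurableSpace.comap (W.tier x) inferInstance

/-- The conditional success probability given the network geometry. -/
def condSuccess (s : Scenario) (γ : ℝ) : Ω → ℝ :=
  P⟦{ω | ENNReal.ofReal γ < W.SINR s ω} | W.geometry⟧

/-- The `b`-th moment of the conditional success probability. -/
def moment (s : Scenario) (b : ℕ) (γ : ℝ) : ℝ := ∫ ω, W.condSuccess s γ ω ^ b ∂P

/-- `1 - (1 - exp (-γ φ (N₀ + I) / l)) ^ M` with `φ`, `l`, `M` those of the serving link and `I`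
the total interference: the closed-form bound for the probability that the fading gain of the
serving link is large enough. -/
def surrogate (s : Scenario) (γ : ℝ) (ω : Ω) : ℝ :=
  1 - (1 - expNeg
    (ENNReal.ofReal (γ * N.φ (W.tier (W.serving s ω) ω) / W.avgPower s (W.serving s ω) ω) *
      W.noiseInterference s ω)) ^ N.M (W.tier (W.serving s ω) ω)

/-- The `b`-th moment of the conditional expectation of the surrogate given the geometry. -/
def surrogateMoment (s : Scenario) (b : ℕ) (γ : ℝ) : ℝ :=
  ∫ ω, (P[W.surrogate s γ | W.geometry]) ω ^ b ∂P

end Realization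

end

/-! With isotropic antennas no angle matters: the mean power received from a transmitter is a
function of its link condition and distance alone (`rxPower`). Hence the serving transmitter, the
interference and the SINR agree in both scenarios. The statements about moments rest on two separate
arguments.

Upper bounds. Fix everything except the fading gain of the serving link. Success means that a gamma
variable of integer shape exceeds a level proportional to noise plus interference, and Alzer's
inequality (`erlangTail_le`) bounds this probability by the surrogate, with equality for shape one.
The serving gain is independent of all other sources, and the event that a given transmitter serves
belongs to the geometry. So the gain can be integrated out over each event of the geometry
(`lintegral_successOf_tier`), which orders the two conditional expectations (`condSuccess_le`) and
then their powers. The second bound is conditional Jensen, which is trivial for exponents zero and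
one.

Exact moments of the surrogate. Two binomial expansions reduce them to Laplace transforms of noise
plus interference, divided by the serving power, on the event that the serving link has a given
condition (`laplaceTerm`). Sum over all candidates for the serving transmitter. The requirement that
no other transmitter is stronger is absorbed into the exponent: a stronger transmitter gets weight
`∞`, and `exp (-∞) = 0`. A single functional `exp (-∑ w)` therefore yields both the void probability
and the transform of the interference. Given the distances, conditions and fading gains are
independent across transmitters, so each transmitter contributes a factor depending on distances
only (`lintegral_marked`). The distances, labelled by the kind of transmitter, form a Poisson
process. The Mecke equation turns the sum over candidates into an integral over the intensity, the
Laplace functional evaluates what remains (`PoissonProcess.tsum_lintegral_eexpNeg`), and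
`Network.exponent_eq` recognises the exponent of the formula.

Both Poisson facts are derived from counts in disjoint cells. The Mecke equation is the Chen-Stein
identity on cells, extended by a π-system argument (`PoissonProcess.mecke`). The Laplace functional
is a product of generating functions for step functions, extended by monotone approximation
(`PoissonProcess.lintegral_eexpNeg_tsum`). Working with values in `[0, ∞]` throughout makes
divergent interference harmless. -/

/-! ### The function `exp (-x)` on `[0, ∞]` -/

/-- `exp (-x)` for `x ∈ [0, ∞]`, with values in `[0, ∞]`. -/
noncomputable def eexpNeg (x : ℝ≥0∞) : ℝ≥0∞ := EReal.exp (-(x : EReal))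

theorem eexpNeg_eq_inv (x : ℝ≥0∞) : eexpNeg x = (EReal.exp x)⁻¹ := EReal.exp_neg _

@[simp] theorem eexpNeg_zero : eexpNeg 0 = 1 := by simp [eexpNeg]

@[simp] theorem eexpNeg_top : eexpNeg ∞ = 0 := by simp [eexpNeg]

theorem eexpNeg_ofReal {x : ℝ} (hx : 0 ≤ x) :
    eexpNeg (ENNReal.ofReal x) = ENNReal.ofReal (Real.exp (-x)) := by
  rw [eexpNeg, EReal.coe_ennreal_ofReal, max_eq_left hx, ← EReal.coe_neg, EReal.exp_coe]

theorem ofReal_expNeg (x : ℝ≥0∞) : ENNReal.ofReal (expNeg x) = eexpNeg x := by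
  rcases eq_or_ne x ∞ with rfl | hx
  · simp [expNeg]
  · rw [expNeg, if_neg hx, ← eexpNeg_ofReal ENNReal.toReal_nonneg, ENNReal.ofReal_toReal hx]

theorem expNeg_nonneg (x : ℝ≥0∞) : 0 ≤ expNeg x := by
  unfold expNeg; split_ifs <;> positivity

theorem toReal_eexpNeg (x : ℝ≥0∞) : (eexpNeg x).toReal = expNeg x := by
  rw [← ofReal_expNeg, ENNReal.toReal_ofReal (expNeg_nonneg x)]

theorem continuous_eexpNeg : Continuous eexpNeg :=
  ENNReal.continuous_exp.comp
    (continuous_neg.comp continuous_coe_ennreal_ereal)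

@[fun_prop]
theorem measurable_eexpNeg : Measurable eexpNeg := continuous_eexpNeg.measurable

@[fun_prop]
theorem measurable_expNeg : Measurable expNeg := by
  have : expNeg = fun x => (eexpNeg x).toReal := funext fun x => (toReal_eexpNeg x).symm
  rw [this]; fun_prop

theorem eexpNeg_antitone : Antitone eexpNeg := fun x y h => by
  simpa [eexpNeg] using h

theorem eexpNeg_le_one (x : ℝ≥0∞) : eexpNeg x ≤ 1 := by
  simpa using eexpNeg_antitone (zero_le (a := x))

theorem expNeg_le_one (x : ℝ≥0∞) : expNeg x ≤ 1 := by
  have := eexpNeg_le_one x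
  rwa [← ofReal_expNeg, ENNReal.ofReal_le_one] at this

theorem eexpNeg_add (x y : ℝ≥0∞) : eexpNeg (x + y) = eexpNeg x * eexpNeg y := by
  simp only [eexpNeg_eq_inv, EReal.coe_ennreal_add, EReal.exp_add]
  rw [ENNReal.mul_inv]
  · left; simp
  · right; simp

theorem eexpNeg_sum {ι : Type*} (s : Finset ι) (f : ι → ℝ≥0∞) :
    eexpNeg (∑ i ∈ s, f i) = ∏ i ∈ s, eexpNeg (f i) := by
  classical
  induction s using Finset.induction_on with
  | empty => simp
  | insert a s ha ih => rw [Finset.sum_insert ha, Finset.prod_insert ha, eexpNeg_add, ih]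

theorem eexpNeg_nat_mul (n : ℕ) (x : ℝ≥0∞) : eexpNeg (n * x) = eexpNeg x ^ n := by
  simpa using eexpNeg_sum (Finset.range n) fun _ => x

theorem expNeg_nat_mul (n : ℕ) (x : ℝ≥0∞) : expNeg (n * x) = expNeg x ^ n := by
  rw [← toReal_eexpNeg, eexpNeg_nat_mul, ENNReal.toReal_pow, toReal_eexpNeg]

/-- Because `eexpNeg` is continuous also at `∞`, the products converge whether or not the sum is
finite. -/
theorem tendsto_eexpNeg_tsum {ι : Type*} (f : ι → ℝ≥0∞) :
    Filter.Tendsto (fun s : Finset ι => ∏ i ∈ s, eexpNeg (f i)) Filter.atTop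
      (nhds (eexpNeg (∑' i, f i))) := by
  simp_rw [← eexpNeg_sum]
  exact (continuous_eexpNeg.tendsto _).comp ENNReal.summable.hasSum

/-- The inverse of `eexpNeg` on `[0, 1]`. -/
noncomputable def negLog (p : ℝ≥0∞) : ℝ≥0∞ := (-(ENNReal.log p)).toENNReal

theorem eexpNeg_negLog {p : ℝ≥0∞} (hp : p ≤ 1) : eexpNeg (negLog p) = p := by
  rw [eexpNeg, negLog, EReal.coe_toENNReal, neg_neg, ENNReal.exp_log]
  simpa using hp

@[fun_prop]
theorem measurable_negLog : Measurable negLog :=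
  (measurable_ereal_toENNReal).comp (continuous_neg.measurable.comp ENNReal.measurable_log)

/-- If finite products of the variables `exp (-z i)` have product expectations, so has the
infinite product. -/
theorem lintegral_eexpNeg_tsum {Ω ι : Type*} [MeasurableSpace Ω] [Countable ι] {P : Measure Ω}
    [IsProbabilityMeasure P] {z : ι → Ω → ℝ≥0∞} (hz : ∀ i, Measurable (z i))
    (h : ∀ s : Finset ι, ∫⁻ ω, ∏ i ∈ s, eexpNeg (z i ω) ∂P = ∏ i ∈ s, ∫⁻ ω, eexpNeg (z i ω) ∂P) :
    ∫⁻ ω, eexpNeg (∑' i, z i ω) ∂P =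
      eexpNeg (∑' i, negLog (∫⁻ ω, eexpNeg (z i ω) ∂P)) := by
  have hle : ∀ i, ∫⁻ ω, eexpNeg (z i ω) ∂P ≤ 1 := fun i =>
    (lintegral_mono fun ω => eexpNeg_le_one _).trans (by simp)
  have h1 : Filter.Tendsto (fun s : Finset ι => ∫⁻ ω, ∏ i ∈ s, eexpNeg (z i ω) ∂P) Filter.atTop
      (nhds (∫⁻ ω, eexpNeg (∑' i, z i ω) ∂P)) := by
    -- For countable `ι` the filter of finite subsets is countably generated, so dominated
    -- convergence applies along it.
    refine tendsto_lintegral_filter_of_dominated_convergence (fun _ => 1) ?_ ?_ (by simp) ?_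
    · exact Filter.Eventually.of_forall fun s => by fun_prop
    · exact Filter.Eventually.of_forall fun s => ae_of_all _ fun ω =>
        Finset.prod_le_one' fun i _ => eexpNeg_le_one _
    · exact ae_of_all _ fun ω => tendsto_eexpNeg_tsum _
  have h2 := tendsto_eexpNeg_tsum fun i => negLog (∫⁻ ω, eexpNeg (z i ω) ∂P)
  simp_rw [eexpNeg_negLog (hle _), ← h] at h2
  exact tendsto_nhds_unique h1 h2

/-! ### Point configurations as counting measures -/

section Poisson

variable {Ω E I : Type*} [MeasurableSpace Ω] [MeasurableSpace E]

/-- The counting measure of a family of points. -/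
noncomputable def conf (Y : I → E) : Measure E := Measure.sum fun i => Measure.dirac (Y i)

open Classical in
/-- The counting measure of a family of points without the point number `i`. -/
noncomputable def confErase (Y : I → E) (i : I) : Measure E :=
  Measure.sum fun j => if j = i then 0 else Measure.dirac (Y j)

theorem conf_apply (Y : I → E) {A : Set E} (hA : MeasurableSet A) :
    conf Y A = ∑' i, A.indicator 1 (Y i) := by
  simp [conf, Measure.sum_apply _ hA, Measure.dirac_apply' _ hA]

open Classical in
theorem confErase_apply (Y : I → E) (i : I) {A : Set E} (hA : MeasurableSet A) :
    confErase Y i A = ∑' j, if j = i then 0 else A.indicator 1 (Y j) := by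
  rw [confErase, Measure.sum_apply _ hA]
  refine tsum_congr fun j => ?_
  split_ifs <;> simp [Measure.dirac_apply' _ hA]

theorem conf_apply_eq_add (Y : I → E) (i : I) {A : Set E} (hA : MeasurableSet A) :
    conf Y A = A.indicator 1 (Y i) + confErase Y i A := by
  classical
  rw [conf_apply Y hA, confErase_apply Y i hA, ENNReal.tsum_eq_add_tsum_ite i]

theorem lintegral_conf (Y : I → E) {f : E → ℝ≥0∞} (hf : Measurable f) :
    ∫⁻ y, f y ∂(conf Y) = ∑' i, f (Y i) := by
  simp [conf, lintegral_sum_measure, lintegral_dirac' _ hf]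

open Classical in
theorem lintegral_confErase (Y : I → E) (i : I) {f : E → ℝ≥0∞} (hf : Measurable f) :
    ∫⁻ y, f y ∂(confErase Y i) = ∑' j, if j = i then 0 else f (Y j) := by
  rw [confErase, lintegral_sum_measure]
  refine tsum_congr fun j => ?_
  split_ifs <;> simp [lintegral_dirac' _ hf]

theorem confErase_le_conf (Y : I → E) (i : I) : confErase Y i ≤ conf Y :=
  Measure.le_iff.2 fun A hA => by rw [conf_apply_eq_add Y i hA]; exact le_add_self

theorem measurable_conf [Countable I] {Y : I → Ω → E} (hY : ∀ i, Measurable (Y i)) :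
    Measurable fun ω => conf fun i => Y i ω := by
  refine Measure.measurable_of_measurable_coe _ fun A hA => ?_
  simp_rw [conf_apply _ hA]
  exact Measurable.tsum fun i => (measurable_one.indicator hA).comp (hY i)

theorem measurable_confErase [Countable I] {Y : I → Ω → E} (hY : ∀ i, Measurable (Y i)) (i : I) :
    Measurable fun ω => confErase (fun j => Y j ω) i := by
  classical
  refine Measure.measurable_of_measurable_coe _ fun A hA => ?_
  simp_rw [confErase_apply _ i hA]
  refine Measurable.tsum fun j => ?_
  split_ifs
  · exact measurable_const
  · exact (measurable_one.indicator hA).comp (hY j)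

/-! ### Poisson counts -/

open Classical in
/-- The Chen-Stein identity for a vector of independent Poisson variables. -/
theorem lintegral_pi_poissonMeasure_mul {κ : Type*} [Fintype κ] (r : κ → ℝ≥0) (c₀ : κ)
    (ψ : (κ → ℕ) → ℝ≥0∞) :
    ∫⁻ n, n c₀ * ψ (Function.update n c₀ (n c₀ - 1)) ∂(Measure.pi fun c => poissonMeasure (r c)) =
      r c₀ * ∫⁻ n, ψ n ∂(Measure.pi fun c => poissonMeasure (r c)) := by
  rw [lintegral_countable', lintegral_countable', ← ENNReal.tsum_mul_left]
  -- Shift the summation index by one in coordinate `c₀`. The terms outside the range of the shift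
  -- have `n c₀ = 0` and vanish; on the range, `(n + 1) p(n + 1) = r p(n)` for the Poisson weights.
  set g : (κ → ℕ) → (κ → ℕ) := fun n => Function.update n c₀ (n c₀ + 1) with hg
  have hinj : Function.Injective g := by
    intro a b h
    funext c
    have := congrFun h c
    by_cases hc : c = c₀
    · subst hc; simpa [hg] using this
    · simpa [hg, hc] using this
  rw [← hinj.tsum_eq]
  · refine tsum_congr fun n => ?_
    have hback : Function.update (g n) c₀ (g n c₀ - 1) = n := by simp [hg]
    rw [hback]
    simp only [Measure.pi_singleton]
    rw [← Finset.mul_prod_erase _ _ (Finset.mem_univ c₀),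
      ← Finset.mul_prod_erase (Finset.univ) (fun c => (poissonMeasure (r c)) {n c})
        (Finset.mem_univ c₀)]
    have hrest : ∏ x ∈ Finset.univ.erase c₀, (poissonMeasure (r x)) {g n x} =
        ∏ x ∈ Finset.univ.erase c₀, (poissonMeasure (r x)) {n x} :=
      Finset.prod_congr rfl fun x hx => by simp [hg, Finset.ne_of_mem_erase hx]
    have hp : (((g n c₀ : ℕ)) : ℝ≥0∞) * (poissonMeasure (r c₀)) {g n c₀} =
        r c₀ * (poissonMeasure (r c₀)) {n c₀} := by
      have h1 : g n c₀ = n c₀ + 1 := by simp [hg]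
      rw [h1, poissonMeasure_singleton, poissonMeasure_singleton,
        ← ENNReal.ofReal_coe_nnreal, ← ENNReal.ofReal_natCast,
        ← ENNReal.ofReal_mul (by positivity), ← ENNReal.ofReal_mul (by positivity)]
      congr 1
      rw [Nat.factorial_succ]
      push_cast
      field_simp
      ring
    rw [hrest]
    calc _ = (((g n c₀ : ℕ) : ℝ≥0∞) * (poissonMeasure (r c₀)) {g n c₀}) * (ψ n *
          ∏ x ∈ Finset.univ.erase c₀, (poissonMeasure (r x)) {n x}) := by ring
      _ = _ := by rw [hp]; ring
  · intro n hn
    have h0 : n c₀ ≠ 0 := by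
      rintro h0
      simp [h0] at hn
    refine ⟨Function.update n c₀ (n c₀ - 1), ?_⟩
    simp [hg, Nat.sub_add_cancel (Nat.one_le_iff_ne_zero.2 h0)]

/-- The numbers of points in the disjoint sets `C c` are independent Poisson variables. -/
structure HasPoissonCounts (P : Measure Ω) (ν : Measure E) (Y : I → Ω → E) {κ : Type*} [Fintype κ]
    (C : κ → Set E) : Prop where
  measurableSet : ∀ c, MeasurableSet (C c)
  ne_top : ∀ c, ν (C c) ≠ ∞
  disjoint : Pairwise fun c c' => Disjoint (C c) (C c')
  law : P.map (fun ω c => conf (fun i => Y i ω) (C c)) =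
    (Measure.pi fun c => poissonMeasure (ν (C c)).toNNReal).map fun n c => ((n c : ℕ) : ℝ≥0∞)

/-- A countable family of random points is a Poisson process with intensity measure `ν`, if each
finite family of sets of finite intensity has a common refinement with independent Poisson
counts. -/
structure PoissonProcess (P : Measure Ω) (ν : Measure E) (Y : I → Ω → E) : Prop where
  measurable : ∀ i, Measurable (Y i)
  refinement : ∀ {ι : Type} [Fintype ι] (B : ι → Set E), (∀ i, MeasurableSet (B i)) →
    (∀ i, ν (B i) ≠ ∞) → ∃ (κ : Type) (_ : Fintype κ) (C : κ → Set E),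
      HasPoissonCounts P ν Y C ∧ ∀ i, ∃ K : Finset κ, B i = ⋃ c ∈ K, C c

variable {P : Measure Ω} {ν : Measure E} {Y : I → Ω → E}

theorem measurable_conf_apply [Countable I] (hY : ∀ i, Measurable (Y i)) {A : Set E}
    (hA : MeasurableSet A) : Measurable fun ω => conf (fun i => Y i ω) A :=
  (Measure.measurable_coe hA).comp (measurable_conf hY)

theorem HasPoissonCounts.lintegral_eq [Countable I] {κ : Type*} [Fintype κ] {C : κ → Set E}
    (h : HasPoissonCounts P ν Y C) (hY : ∀ i, Measurable (Y i)) {Ψ : (κ → ℝ≥0∞) → ℝ≥0∞}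
    (hΨ : Measurable Ψ) :
    ∫⁻ ω, Ψ (fun c => conf (fun i => Y i ω) (C c)) ∂P =
      ∫⁻ n, Ψ (fun c => ((n c : ℕ) : ℝ≥0∞)) ∂(Measure.pi fun c =>
        poissonMeasure (ν (C c)).toNNReal) := by
  have hm : Measurable fun ω c => conf (fun i => Y i ω) (C c) :=
    measurable_pi_iff.2 fun c => measurable_conf_apply hY (h.measurableSet c)
  rw [← lintegral_map (f := Ψ) hΨ hm, h.law, lintegral_map hΨ]
  exact measurable_pi_iff.2 fun c => (measurable_of_countable _).comp (measurable_pi_apply c)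

/-- This is the Mecke equation for a finite partition into cells. Removing a point of the cell `c₀`
lowers the count of that cell by one and, by disjointness, no other count. The sum over the points
is thus the count of `c₀` times `Ψ` at the lowered counts, and the Chen-Stein identity applies. -/
theorem HasPoissonCounts.tsum_lintegral [Countable I] {κ : Type*} [Fintype κ] {C : κ → Set E}
    (h : HasPoissonCounts P ν Y C) (hY : ∀ i, Measurable (Y i)) (c₀ : κ)
    {Ψ : (κ → ℝ≥0∞) → ℝ≥0∞} (hΨ : Measurable Ψ) :
    ∑' i, ∫⁻ ω, (C c₀).indicator 1 (Y i ω) *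
        Ψ (fun c => confErase (fun j => Y j ω) i (C c)) ∂P =
      ν (C c₀) * ∫⁻ ω, Ψ (fun c => conf (fun i => Y i ω) (C c)) ∂P := by
  classical
  have hmE : ∀ i, Measurable fun ω => Ψ fun c => confErase (fun j => Y j ω) i (C c) := fun i =>
    hΨ.comp (measurable_pi_iff.2 fun c =>
      (Measure.measurable_coe (h.measurableSet c)).comp (measurable_confErase hY i))
  have hterm : ∀ i, AEMeasurable (fun ω => (C c₀).indicator 1 (Y i ω) *
      Ψ (fun c => confErase (fun j => Y j ω) i (C c))) P := fun i =>
    (((measurable_one.indicator (h.measurableSet c₀)).comp (hY i)).mul (hmE i)).aemeasurable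
  rw [← lintegral_tsum hterm]
  set dec : (κ → ℝ≥0∞) → (κ → ℝ≥0∞) := fun v => Function.update v c₀ (v c₀ - 1) with hdec
  have hdecm : Measurable dec := by
    refine measurable_pi_iff.2 fun c => ?_
    by_cases hc : c = c₀
    · subst hc; simp only [hdec, Function.update_self]; fun_prop
    · simp only [hdec, Function.update_of_ne hc]; fun_prop
  have hpt : ∀ ω, ∑' i, (C c₀).indicator 1 (Y i ω) *
      Ψ (fun c => confErase (fun j => Y j ω) i (C c)) =
      (fun v : κ → ℝ≥0∞ => v c₀ * Ψ (dec v)) fun c => conf (fun i => Y i ω) (C c) := by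
    intro ω
    simp only
    rw [conf_apply _ (h.measurableSet c₀), ← ENNReal.tsum_mul_right]
    refine tsum_congr fun i => ?_
    by_cases hi : Y i ω ∈ C c₀
    · congr 2
      funext c
      have hadd := conf_apply_eq_add (fun j => Y j ω) i (h.measurableSet c)
      by_cases hc : c = c₀
      · subst hc
        simp only [Set.indicator_of_mem hi, Pi.one_apply] at hadd
        simp only [hdec, Function.update_self, hadd]
        -- Only the removed unit has to be finite for the cancellation; the count itself may be `∞`
        -- on an exceptional set.
        rw [ENNReal.add_sub_cancel_left ENNReal.one_ne_top]
      · have hn : Y i ω ∉ C c := Set.disjoint_left.1 (h.disjoint (Ne.symm hc)) hi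
        simp only [Set.indicator_of_notMem hn, zero_add] at hadd
        simp only [hdec, Function.update_of_ne hc, hadd]
    · simp [hi]
  simp_rw [hpt]
  rw [h.lintegral_eq hY hΨ]
  refine (h.lintegral_eq hY (Ψ := fun v => v c₀ * Ψ (dec v)) (by fun_prop)).trans ?_
  have := lintegral_pi_poissonMeasure_mul (fun c => (ν (C c)).toNNReal) c₀
    fun n => Ψ fun c => ((n c : ℕ) : ℝ≥0∞)
  rw [ENNReal.coe_toNNReal (h.ne_top c₀)] at this
  rw [← this]
  refine lintegral_congr fun n => ?_
  congr 2
  funext c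
  by_cases hc : c = c₀
  · subst hc; simp [hdec]
  · simp [hdec, hc]

theorem indicator_biUnion_finset {E κ : Type*} {C : κ → Set E}
    (hC : Pairwise fun c c' => Disjoint (C c) (C c')) (K : Finset κ) (y : E) :
    (⋃ c ∈ K, C c).indicator (1 : E → ℝ≥0∞) y = ∑ c ∈ K, (C c).indicator 1 y := by
  rw [Finset.indicator_biUnion_apply]
  intro a _ b _ hab
  exact hC hab

theorem measure_biUnion_refinement {κ : Type*} {C : κ → Set E} (μ : Measure E)
    (hC : Pairwise fun c c' => Disjoint (C c) (C c')) (hm : ∀ c, MeasurableSet (C c))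
    (K : Finset κ) : μ (⋃ c ∈ K, C c) = ∑ c ∈ K, μ (C c) :=
  measure_biUnion_finset (fun _ _ _ _ hab => hC hab) fun c _ => hm c

end Poisson

/-! ### The Mecke equation -/

section Mecke

variable {Ω E I : Type*} [MeasurableSpace Ω] [MeasurableSpace E]

theorem generateFrom_measurableSet_ne_top (ν : Measure E) [SigmaFinite ν] :
    MeasurableSpace.generateFrom {A | MeasurableSet A ∧ ν A ≠ ∞} = ‹MeasurableSpace E› := by
  refine le_antisymm (MeasurableSpace.generateFrom_le fun A hA => hA.1) fun A hA => ?_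
  have : A = ⋃ n, A ∩ spanningSets ν n := by
    rw [← Set.inter_iUnion, iUnion_spanningSets, Set.inter_univ]
  rw [this]
  refine MeasurableSet.iUnion fun n => MeasurableSpace.measurableSet_generateFrom ⟨?_, ?_⟩
  · exact hA.inter (measurableSet_spanningSets ν n)
  · exact ((measure_mono Set.inter_subset_right).trans_lt (measure_spanningSets_lt_top ν n)).ne

/-- Events about the values of a measure on finitely many sets of finite `ν`-measure. -/
def cylinderSets (ν : Measure E) : Set (Set (Measure E)) :=
  {t | ∃ (ι : Type) (_ : Fintype ι) (B : ι → Set E) (T : ι → Set ℝ≥0∞),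
    (∀ i, MeasurableSet (B i)) ∧ (∀ i, ν (B i) ≠ ∞) ∧ (∀ i, MeasurableSet (T i)) ∧
      t = {N | ∀ i, N (B i) ∈ T i}}

theorem isPiSystem_cylinderSets (ν : Measure E) : IsPiSystem (cylinderSets ν) := by
  rintro _ ⟨ι, _, B, T, hB, hB', hT, rfl⟩ _ ⟨ι', _, B', T', h1, h2, h3, rfl⟩ _
  refine ⟨ι ⊕ ι', inferInstance, Sum.elim B B', Sum.elim T T', ?_, ?_, ?_, ?_⟩
  · rintro (i | i) <;> simp [*]
  · rintro (i | i) <;> simp [*]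
  · rintro (i | i) <;> simp [*]
  · ext N; simp [Sum.forall]

/-- By σ-finiteness the mass of any measurable set is the supremum of the masses of its traces on
`spanningSets ν`, so evaluations at sets of finite intensity generate all evaluations. -/
theorem generateFrom_cylinderSets (ν : Measure E) [SigmaFinite ν] :
    MeasurableSpace.generateFrom (cylinderSets ν) =
      (inferInstance : MeasurableSpace (Measure E)) := by
  refine le_antisymm (MeasurableSpace.generateFrom_le ?_) ?_
  · rintro _ ⟨ι, _, B, T, hB, hB', hT, rfl⟩
    rw [Set.ofPred_forall]
    exact MeasurableSet.iInter fun i => Measure.measurable_coe (hB i) (hT i)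
  · set m := MeasurableSpace.generateFrom (cylinderSets ν)
    have hfin : ∀ B : Set E, MeasurableSet B → ν B ≠ ∞ →
        Measurable[m] fun N : Measure E => N B := by
      intro B hB hB' T hT
      refine MeasurableSpace.measurableSet_generateFrom
        ⟨Unit, inferInstance, fun _ => B, fun _ => T, fun _ => hB, fun _ => hB', fun _ => hT, ?_⟩
      ext N; simp
    refine iSup₂_le fun B hB => ?_
    rw [← measurable_iff_comap_le]
    have hsum : (fun N : Measure E => N B) =
        fun N => ⨆ n, N (B ∩ spanningSets ν n) := by
      funext N
      rw [← Monotone.measure_iUnion, ← Set.inter_iUnion, iUnion_spanningSets, Set.inter_univ]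
      exact fun a b hab => Set.inter_subset_inter_right _ (monotone_spanningSets ν hab)
    rw [hsum]
    refine Measurable.iSup fun n => hfin _ (hB.inter (measurableSet_spanningSets ν n)) ?_
    exact ((measure_mono Set.inter_subset_right).trans_lt (measure_spanningSets_lt_top ν n)).ne

variable {P : Measure Ω} {ν : Measure E} {Y : I → Ω → E}

/-- The reduced Mecke equation: the reduced Palm measure of a Poisson process is the product of
its intensity measure and its law. -/
theorem PoissonProcess.mecke [Countable I] [SigmaFinite ν] [IsProbabilityMeasure P]
    (h : PoissonProcess P ν Y) :
    ν.prod (P.map fun ω => conf fun i => Y i ω) =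
      Measure.sum fun i => P.map fun ω => (Y i ω, confErase (fun j => Y j ω) i) := by
  have hconf := measurable_conf h.measurable
  have : IsProbabilityMeasure (P.map fun ω => conf fun i => Y i ω) :=
    Measure.isProbabilityMeasure_map hconf.aemeasurable
  have hpair : ∀ i, Measurable fun ω => (Y i ω, confErase (fun j => Y j ω) i) := fun i =>
    (h.measurable i).prodMk (measurable_confErase h.measurable i)
  -- A product of σ-finite measures is determined by rectangles over generating π-systems, here sets
  -- of finite intensity times cylinder events.
  refine Measure.prod_eq_generateFrom (generateFrom_measurableSet_ne_top ν)
    (generateFrom_cylinderSets ν) ?_ (isPiSystem_cylinderSets ν)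
    ⟨spanningSets ν, fun n => ⟨measurableSet_spanningSets ν n,
      (measure_spanningSets_lt_top ν n).ne⟩, measure_spanningSets_lt_top ν,
      iUnion_spanningSets ν⟩
    ⟨fun _ => Set.univ, fun n => ⟨Empty, inferInstance, Empty.elim, Empty.elim, fun i => i.elim,
      fun i => i.elim, fun i => i.elim,
      (Set.eq_univ_of_forall fun N i => i.elim).symm⟩, fun _ => measure_lt_top _ _,
      Set.iUnion_const _⟩ ?_
  · rintro A ⟨hA, hA'⟩ B ⟨hB, hB'⟩ -
    exact ⟨hA.inter hB, ((measure_mono Set.inter_subset_left).trans_lt hA'.lt_top).ne⟩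
  rintro A ⟨hA, hA'⟩ _ ⟨ι, _, B, T, hB, hB', hT, rfl⟩
  -- One refinement has to resolve `A` together with the sets of the cylinder event, so `A` joins
  -- the family under the index `none`.
  obtain ⟨κ, _, C, hC, hK⟩ := h.refinement (fun o : Option ι => o.elim A B)
    (by rintro (_ | i) <;> simp [*]) (by rintro (_ | i) <;> simp [*])
  choose K hK using hK
  have hKA : A = ⋃ c ∈ K none, C c := hK none
  have hKB : ∀ i, B i = ⋃ c ∈ K (some i), C c := fun i => hK (some i)
  set S : Set (κ → ℝ≥0∞) := {v | ∀ i, ∑ c ∈ K (some i), v c ∈ T i}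
  have hS : MeasurableSet S := by
    simp only [S, Set.ofPred_forall]
    exact MeasurableSet.iInter fun i =>
      (Finset.measurable_fun_sum _ fun c _ => measurable_pi_apply c) (hT i)
  have hcyl : ∀ N : Measure E, (∀ i, N (B i) ∈ T i) ↔ (fun c => N (C c)) ∈ S := by
    intro N
    simp only [S, Set.mem_ofPred_eq]
    refine forall_congr' fun i => ?_
    rw [hKB i, measure_biUnion_refinement N hC.disjoint hC.measurableSet]
  have hcylm : MeasurableSet {N : Measure E | ∀ i, N (B i) ∈ T i} := by
    rw [Set.ofPred_forall]
    exact MeasurableSet.iInter fun i => Measure.measurable_coe (hB i) (hT i)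
  rw [Measure.sum_apply _ (hA.prod hcylm), Measure.map_apply hconf hcylm]
  have hterm : ∀ i, (P.map fun ω => (Y i ω, confErase (fun j => Y j ω) i))
      (A ×ˢ {N : Measure E | ∀ i, N (B i) ∈ T i}) = ∑ c ∈ K none,
      ∫⁻ ω, (C c).indicator 1 (Y i ω) *
        S.indicator 1 (fun c => confErase (fun j => Y j ω) i (C c)) ∂P := by
    intro i
    rw [← lintegral_finsetSum', Measure.map_apply (hpair i) (hA.prod hcylm),
      ← lintegral_indicator_one (hpair i (hA.prod hcylm))]
    · refine lintegral_congr fun ω => ?_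
      rw [← Finset.sum_mul, ← indicator_biUnion_finset hC.disjoint, ← hKA]
      by_cases h1 : Y i ω ∈ A <;>
      by_cases h2 : (fun c => confErase (fun j => Y j ω) i (C c)) ∈ S <;>
      simp [Set.indicator, h1, h2, hcyl]
    · intro c _
      refine Measurable.aemeasurable (Measurable.mul
        ((measurable_one.indicator (hC.measurableSet c)).comp (h.measurable i)) ?_)
      exact (measurable_one.indicator hS).comp (measurable_pi_iff.2 fun c =>
        (Measure.measurable_coe (hC.measurableSet c)).comp (measurable_confErase h.measurable i))
  simp_rw [hterm]
  rw [Summable.tsum_finsetSum fun _ _ => ENNReal.summable]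
  -- Apply the cell version to each cell of `A`; the intensities of these cells add up to `ν A`.
  simp_rw [hC.tsum_lintegral h.measurable _ (measurable_one.indicator hS)]
  rw [← Finset.sum_mul, ← measure_biUnion_refinement ν hC.disjoint hC.measurableSet, ← hKA]
  congr 1
  rw [← lintegral_indicator_one (hconf hcylm)]
  refine lintegral_congr fun ω => ?_
  by_cases h2 : (fun c => conf (fun j => Y j ω) (C c)) ∈ S <;>
      simp [Set.indicator, h2, hcyl]

/-- The reduced Mecke equation for functions. -/
theorem PoissonProcess.tsum_lintegral [Countable I] [SigmaFinite ν] [IsProbabilityMeasure P]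
    (h : PoissonProcess P ν Y) {F : E → Measure E → ℝ≥0∞} (hF : Measurable (Function.uncurry F)) :
    ∑' i, ∫⁻ ω, F (Y i ω) (confErase (fun j => Y j ω) i) ∂P =
      ∫⁻ y, ∫⁻ ω, F y (conf fun i => Y i ω) ∂P ∂ν := by
  have hconf := measurable_conf h.measurable
  have : IsProbabilityMeasure (P.map fun ω => conf fun i => Y i ω) :=
    Measure.isProbabilityMeasure_map hconf.aemeasurable
  have key := congrArg (fun μ => ∫⁻ z, Function.uncurry F z ∂μ) h.mecke
  beta_reduce at key
  rw [lintegral_prod _ hF.aemeasurable, lintegral_sum_measure] at key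
  have h1 : ∀ y, ∫⁻ N, Function.uncurry F (y, N) ∂(P.map fun ω => conf fun i => Y i ω) =
      ∫⁻ ω, F y (conf fun i => Y i ω) ∂P := fun y =>
    lintegral_map (hF.comp measurable_prodMk_left) hconf
  have h2 : ∀ i, ∫⁻ z, Function.uncurry F z
      ∂(P.map fun ω => (Y i ω, confErase (fun j => Y j ω) i)) =
      ∫⁻ ω, F (Y i ω) (confErase (fun j => Y j ω) i) ∂P := fun i =>
    lintegral_map hF ((h.measurable i).prodMk (measurable_confErase h.measurable i))
  simp_rw [h1, h2] at key
  exact key.symm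

/-- Campbell's formula. -/
theorem PoissonProcess.campbell [Countable I] [SigmaFinite ν] [IsProbabilityMeasure P]
    (h : PoissonProcess P ν Y) {f : E → ℝ≥0∞} (hf : Measurable f) :
    ∑' i, ∫⁻ ω, f (Y i ω) ∂P = ∫⁻ y, f y ∂ν := by
  have := h.tsum_lintegral (F := fun y _ => f y) (hf.comp measurable_fst)
  simpa using this

/-- Almost surely, a Poisson process has finitely many points in each set of finite intensity. -/
theorem PoissonProcess.ae_finite [Countable I] [SigmaFinite ν] [IsProbabilityMeasure P]
    (h : PoissonProcess P ν Y) {A : Set E} (hA : MeasurableSet A) (hA' : ν A ≠ ∞) :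
    ∀ᵐ ω ∂P, {i | Y i ω ∈ A}.Finite ∧ conf (fun i => Y i ω) A < ∞ := by
  have hm : ∀ i, Measurable fun ω => A.indicator (1 : E → ℝ≥0∞) (Y i ω) := fun i =>
    (measurable_one.indicator hA).comp (h.measurable i)
  have h1 := h.campbell (measurable_one.indicator hA)
  rw [lintegral_indicator_one hA, ← lintegral_tsum fun i => (hm i).aemeasurable] at h1
  have h2 := ae_lt_top (Measurable.tsum hm) (h1 ▸ hA')
  filter_upwards [h2] with ω hω
  refine ⟨?_, by rwa [conf_apply _ hA]⟩
  have h3 := ENNReal.finite_const_le_of_tsum_ne_top hω.ne one_ne_zero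
  refine h3.subset fun i hi => ?_
  have hi' : Y i ω ∈ A := hi
  simp [hi']

end Mecke

/-! ### The Laplace functional -/

section Laplace

variable {Ω E I : Type*} [MeasurableSpace Ω] [MeasurableSpace E]

/-- The probability generating function of a Poisson variable. -/
theorem lintegral_pow_poissonMeasure (r : ℝ≥0) {q : ℝ≥0∞} (hq : q ≤ 1) :
    ∫⁻ n, q ^ n ∂(poissonMeasure r) = eexpNeg (r * (1 - q)) := by
  have hq' : q ≠ ∞ := (hq.trans_lt ENNReal.one_lt_top).ne
  lift q to ℝ≥0 using hq'
  have hq1 : (q : ℝ) ≤ 1 := by exact_mod_cast hq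
  rw [lintegral_countable']
  simp_rw [poissonMeasure_singleton]
  have hs : HasSum (fun n : ℕ => Real.exp (-r) * ((r * q : ℝ) ^ n / n.factorial))
      (Real.exp (-r) * Real.exp (r * q)) := by
    refine HasSum.mul_left _ ?_
    rw [Real.exp_eq_exp_ℝ]
    exact NormedSpace.expSeries_div_hasSum_exp (r * q : ℝ)
  have h1 : ∀ n : ℕ, (q : ℝ≥0∞) ^ n * ENNReal.ofReal (Real.exp (-r) * r ^ n / n.factorial) =
      ENNReal.ofReal (Real.exp (-r) * ((r * q : ℝ) ^ n / n.factorial)) := by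
    intro n
    rw [← ENNReal.ofReal_coe_nnreal, ← ENNReal.ofReal_pow (by positivity),
      ← ENNReal.ofReal_mul (by positivity)]
    congr 1
    rw [mul_pow]; ring
  simp_rw [h1]
  rw [← ENNReal.ofReal_tsum_of_nonneg (fun n => by positivity) hs.summable, hs.tsum_eq,
    ← Real.exp_add]
  have h2 : (r : ℝ≥0∞) * (1 - q) = ENNReal.ofReal (r * (1 - q)) := by
    rw [ENNReal.ofReal_mul (by positivity), ENNReal.ofReal_sub _ (by positivity)]
    simp
  have h3 : (0 : ℝ) ≤ r * (1 - q) := mul_nonneg r.2 (by linarith)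
  rw [h2, eexpNeg_ofReal h3]
  congr 2; ring

theorem lintegral_pi_prod {κ : Type*} [Fintype κ] {X : κ → Type*} [∀ c, MeasurableSpace (X c)]
    (μ : ∀ c, Measure (X c)) [∀ c, IsProbabilityMeasure (μ c)] {f : ∀ c, X c → ℝ≥0∞}
    (hf : ∀ c, Measurable (f c)) :
    ∫⁻ n, ∏ c, f c (n c) ∂(Measure.pi μ) = ∏ c, ∫⁻ x, f c x ∂(μ c) := by
  refine (lintegral_prod_eq_prod_lintegral_of_indepFun Finset.univ
    (fun c (n : ∀ c, X c) => f c (n c)) (iIndepFun_pi fun c => (hf c).aemeasurable)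
    fun c => (hf c).comp (measurable_pi_apply c)).trans ?_
  exact Finset.prod_congr rfl fun c _ => (measurePreserving_eval μ c).lintegral_comp (hf c)

variable {P : Measure Ω} {ν : Measure E} {Y : I → Ω → E}

/-- The sets `B i` may overlap. On the cells of a refinement the exponent becomes a linear
combination of independent Poisson counts, where the weight of a cell is the sum of the `a i` over
the sets built from it. The expectation is then a product of generating functions at `exp (-w c)`.
-/
theorem PoissonProcess.lintegral_eexpNeg_sum [Countable I]
    (h : PoissonProcess P ν Y) {ι : Type} [Fintype ι] {B : ι → Set E} (a : ι → ℝ≥0∞)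
    (hB : ∀ i, MeasurableSet (B i)) (hB' : ∀ i, ν (B i) ≠ ∞) :
    ∫⁻ ω, eexpNeg (∑ i, a i * conf (fun i => Y i ω) (B i)) ∂P =
      eexpNeg (∫⁻ y, 1 - eexpNeg (∑ i, a i * (B i).indicator 1 y) ∂ν) := by
  classical
  obtain ⟨κ, _, C, hC, hK⟩ := h.refinement B hB hB'
  choose K hK using hK
  set w : κ → ℝ≥0∞ := fun c => ∑ i, if c ∈ K i then a i else 0 with hw
  have hswap : ∀ g : κ → ℝ≥0∞, ∑ i, a i * ∑ c ∈ K i, g c = ∑ c, w c * g c := by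
    intro g
    simp_rw [hw, Finset.sum_mul]
    rw [Finset.sum_comm]
    refine Finset.sum_congr rfl fun i _ => ?_
    rw [Finset.mul_sum]
    simp [ite_mul, Finset.sum_ite_mem]
  have h1 : ∀ ω, ∑ i, a i * conf (fun i => Y i ω) (B i) =
      ∑ c, w c * conf (fun i => Y i ω) (C c) := by
    intro ω
    rw [← hswap]
    refine Finset.sum_congr rfl fun i _ => ?_
    rw [hK i, measure_biUnion_refinement _ hC.disjoint hC.measurableSet]
  have h2 : ∀ y, ∑ i, a i * (B i).indicator 1 y = ∑ c, w c * (C c).indicator 1 y := by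
    intro y
    rw [← hswap]
    refine Finset.sum_congr rfl fun i _ => ?_
    rw [hK i, indicator_biUnion_finset hC.disjoint]
  -- A point lies in at most one cell, so `1 - exp (-·)` may be taken cell by cell.
  have h3 : ∀ y, 1 - eexpNeg (∑ c, w c * (C c).indicator 1 y) =
      ∑ c, (1 - eexpNeg (w c)) * (C c).indicator 1 y := by
    intro y
    by_cases hy : ∃ c, y ∈ C c
    · obtain ⟨c, hc⟩ := hy
      have hne : ∀ c', c' ≠ c → y ∉ C c' := fun c' hc' =>
        Set.disjoint_left.1 (hC.disjoint hc'.symm) hc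
      rw [Finset.sum_eq_single c, Finset.sum_eq_single c] <;> simp +contextual [hc, hne]
    · push Not at hy
      simp [hy]
  simp_rw [h1, h2, h3]
  rw [hC.lintegral_eq h.measurable (Ψ := fun v => eexpNeg (∑ c, w c * v c)) (by fun_prop)]
  simp_rw [eexpNeg_sum]
  rw [lintegral_pi_prod (f := fun c n => eexpNeg (w c * (n : ℕ))) _
    fun c => measurable_of_countable _, lintegral_finsetSum]
  · rw [eexpNeg_sum]
    refine Finset.prod_congr rfl fun c _ => ?_
    simp_rw [mul_comm (w c), eexpNeg_nat_mul]
    rw [lintegral_pow_poissonMeasure _ (eexpNeg_le_one _), lintegral_const_mul _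
      (measurable_one.indicator (hC.measurableSet c)),
      lintegral_indicator_one (hC.measurableSet c), ENNReal.coe_toNNReal (hC.ne_top c), mul_comm]
  · exact fun c _ => (measurable_one.indicator (hC.measurableSet c)).const_mul _

/-- The Laplace functional of a Poisson process. -/
theorem PoissonProcess.lintegral_eexpNeg_tsum [Countable I] [SigmaFinite ν]
    [IsProbabilityMeasure P] (h : PoissonProcess P ν Y) {v : E → ℝ≥0∞} (hv : Measurable v) :
    ∫⁻ ω, eexpNeg (∑' i, v (Y i ω)) ∂P = eexpNeg (∫⁻ y, 1 - eexpNeg (v y) ∂ν) := by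
  -- The simple approximations are cut off to `spanningSets ν n` so that their level sets have
  -- finite intensity, as the formula for step functions requires.
  set f : ℕ → E → ℝ≥0∞ := fun n => (spanningSets ν n).indicator (SimpleFunc.eapprox v n) with hf
  have hfm : ∀ n, Measurable (f n) := fun n =>
    (SimpleFunc.eapprox v n).measurable.indicator (measurableSet_spanningSets ν n)
  have hmono : Monotone f := by
    intro m n hmn y
    refine (Set.indicator_le_indicator_of_subset (monotone_spanningSets ν hmn)
      (fun _ => bot_le) y).trans ?_
    exact Set.indicator_le_indicator (SimpleFunc.monotone_eapprox v hmn y)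
  have hsup : ∀ y, ⨆ n, f n y = v y := by
    intro y
    refine le_antisymm (iSup_le fun n => ?_) ?_
    · refine (Set.indicator_le_self' (fun _ _ => bot_le) y).trans ?_
      rw [← SimpleFunc.iSup_eapprox_apply hv]
      exact le_iSup (fun n => SimpleFunc.eapprox v n y) n
    · rw [← SimpleFunc.iSup_eapprox_apply hv]
      refine iSup_le fun n => ?_
      have hy : y ∈ ⋃ n, spanningSets ν n := by simp [iUnion_spanningSets]
      obtain ⟨m, hm⟩ := Set.mem_iUnion.1 hy
      refine le_trans ?_ (le_iSup _ (max m n))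
      rw [hf]
      simp only
      rw [Set.indicator_of_mem (monotone_spanningSets ν (le_max_left m n) hm)]
      exact SimpleFunc.monotone_eapprox v (le_max_right m n) y
  have hfin : ∀ n, ∫⁻ ω, eexpNeg (∑' i, f n (Y i ω)) ∂P =
      eexpNeg (∫⁻ y, 1 - eexpNeg (f n y) ∂ν) := by
    intro n
    set G := SimpleFunc.eapprox v n
    set B : G.range → Set E := fun a => G ⁻¹' {(a : ℝ≥0∞)} ∩ spanningSets ν n with hBdef
    have hB : ∀ a, MeasurableSet (B a) := fun a =>
      (G.measurableSet_fiber _).inter (measurableSet_spanningSets ν n)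
    have hB' : ∀ a, ν (B a) ≠ ∞ := fun a =>
      ((measure_mono Set.inter_subset_right).trans_lt (measure_spanningSets_lt_top ν n)).ne
    have hsum : ∀ y, f n y = ∑ a : G.range, (a : ℝ≥0∞) * (B a).indicator 1 y := by
      intro y
      by_cases hy : y ∈ spanningSets ν n
      · rw [Finset.sum_eq_single ⟨G y, G.mem_range_self y⟩]
        · simp [hf, hy, hBdef, G]
        · intro a _ ha
          have : y ∉ B a := fun hya => ha (Subtype.ext hya.1.symm)
          simp [this]
        · simp
      · have : ∀ a, y ∉ B a := fun a hya => hy hya.2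
        simp [hf, hy, this]
    have hsum' : ∀ ω, ∑' i, f n (Y i ω) =
        ∑ a : G.range, (a : ℝ≥0∞) * conf (fun i => Y i ω) (B a) := by
      intro ω
      simp_rw [hsum]
      rw [Summable.tsum_finsetSum fun _ _ => ENNReal.summable]
      refine Finset.sum_congr rfl fun a _ => ?_
      rw [ENNReal.tsum_mul_left, conf_apply _ (hB a)]
    simp_rw [hsum', hsum]
    exact h.lintegral_eexpNeg_sum (fun a : G.range => (a : ℝ≥0∞)) hB hB'
  have hlim : ∀ y, Filter.Tendsto (fun n => f n y) Filter.atTop (nhds (v y)) := fun y => by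
    rw [← hsup y]
    exact tendsto_atTop_iSup fun m n hmn => hmono hmn y
  -- Inside the expectation the sums converge by monotone convergence for the counting measure, and
  -- the outer limit is dominated by one. On the other side monotone convergence in `ν` suffices,
  -- since `1 - exp (-·)` is increasing.
  have hL : Filter.Tendsto (fun n => ∫⁻ ω, eexpNeg (∑' i, f n (Y i ω)) ∂P) Filter.atTop
      (nhds (∫⁻ ω, eexpNeg (∑' i, v (Y i ω)) ∂P)) := by
    refine tendsto_lintegral_of_dominated_convergence (fun _ => 1) (fun n => ?_) (fun n => ?_)
      (by simp) ?_
    · exact measurable_eexpNeg.comp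
        (Measurable.tsum fun i => (hfm n).comp (h.measurable i))
    · exact ae_of_all _ fun ω => eexpNeg_le_one _
    · refine ae_of_all _ fun ω => (continuous_eexpNeg.tendsto _).comp ?_
      simp_rw [← lintegral_conf _ (hfm _), ← lintegral_conf (fun i => Y i ω) hv]
      exact lintegral_tendsto_of_tendsto_of_monotone (fun n => (hfm n).aemeasurable)
        (ae_of_all _ fun y m n hmn => hmono hmn y) (ae_of_all _ hlim)
  have hR : Filter.Tendsto (fun n => eexpNeg (∫⁻ y, 1 - eexpNeg (f n y) ∂ν)) Filter.atTop
      (nhds (eexpNeg (∫⁻ y, 1 - eexpNeg (v y) ∂ν))) := by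
    refine (continuous_eexpNeg.tendsto _).comp ?_
    refine lintegral_tendsto_of_tendsto_of_monotone (fun n => ?_) ?_ ?_
    · exact (measurable_const.sub (measurable_eexpNeg.comp (hfm n))).aemeasurable
    · exact ae_of_all _ fun y m n hmn =>
        tsub_le_tsub_left (eexpNeg_antitone (hmono hmn y)) _
    · exact ae_of_all _ fun y => ENNReal.Tendsto.sub tendsto_const_nhds
        ((continuous_eexpNeg.tendsto _).comp (hlim y)) (Or.inl ENNReal.one_ne_top)
  simp_rw [hfin] at hL
  exact tendsto_nhds_unique hL hR

end Laplace

/-! ### Functionals of a Poisson process seen from one of its points -/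

section Palm

variable {Ω E I : Type*} [MeasurableSpace Ω] [MeasurableSpace E]

/-- The measures that give mass in `[p.2, p.2 + 1)` to the set number `p.1` of an exhausting
sequence of disjoint sets. -/
def massWindow (ν : Measure E) [SigmaFinite ν] (p : ℕ × ℕ) : Set (Measure E) :=
  (fun N => N (disjointed (spanningSets ν) p.1)) ⁻¹' Set.Ico (p.2 : ℝ≥0∞) (p.2 + 1)

theorem measurableSet_massWindow (ν : Measure E) [SigmaFinite ν] (p : ℕ × ℕ) :
    MeasurableSet (massWindow ν p) :=
  Measure.measurable_coe (MeasurableSet.disjointed (measurableSet_spanningSets ν) p.1)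
    measurableSet_Ico

/-- The restriction of measures to the set number `p.1` of an exhausting sequence of disjoint sets,
truncated to the measures that give it mass in `[p.2, p.2 + 1)`. -/
noncomputable def truncPiece (ν : Measure E) [SigmaFinite ν] (p : ℕ × ℕ) :
    Kernel (Measure E) E :=
  ⟨(massWindow ν p).indicator fun N => N.restrict (disjointed (spanningSets ν) p.1),
    Measurable.indicator (Measure.measurable_of_measurable_coe _ fun A hA => by
      simp_rw [Measure.restrict_apply hA]
      exact Measure.measurable_coe (hA.inter (MeasurableSet.disjointed
        (measurableSet_spanningSets ν) p.1))) (measurableSet_massWindow ν p)⟩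

theorem truncPiece_apply (ν : Measure E) [SigmaFinite ν] (p : ℕ × ℕ) (N : Measure E) :
    truncPiece ν p N =
      (massWindow ν p).indicator (fun N => N.restrict (disjointed (spanningSets ν) p.1)) N := rfl

instance (ν : Measure E) [SigmaFinite ν] (p : ℕ × ℕ) : IsFiniteKernel (truncPiece ν p) := by
  refine ⟨⟨p.2 + 1, by finiteness, fun N => ?_⟩⟩
  rw [truncPiece_apply]
  by_cases h : N ∈ massWindow ν p
  · rw [Set.indicator_of_mem h]
    simpa using h.2.le
  · simp [h]

/-- The identity kernel from measures on `E` to `E`, truncated so as to be s-finite: it fixes the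
measures that are finite on the sets of an exhausting sequence. -/
noncomputable def truncKernel (ν : Measure E) [SigmaFinite ν] : Kernel (Measure E) E :=
  Kernel.sum (truncPiece ν)

instance (ν : Measure E) [SigmaFinite ν] : IsSFiniteKernel (truncKernel ν) :=
  inferInstanceAs (IsSFiniteKernel (Kernel.sum (truncPiece ν)))

/-- On each set of the disjointed exhaustion a finite mass lies in exactly one window `[k, k + 1)`,
namely for `k` its integer part, so exactly one truncated piece survives there. The kernel serves to
make integrals against a random measure jointly measurable, which needs s-finiteness. -/
theorem truncKernel_apply (ν : Measure E) [SigmaFinite ν] {N : Measure E}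
    (hN : ∀ n, N (spanningSets ν n) < ∞) : truncKernel ν N = N := by
  classical
  have hm := MeasurableSet.disjointed (measurableSet_spanningSets ν)
  ext A hA
  rw [truncKernel, Kernel.sum_apply' _ _ hA, ENNReal.tsum_prod']
  have h1 : ∀ n : ℕ, ∑' k : ℕ, (if N (disjointed (spanningSets ν) n) ∈
      Set.Ico (k : ℝ≥0∞) (k + 1) then N (A ∩ disjointed (spanningSets ν) n) else 0) =
      N (A ∩ disjointed (spanningSets ν) n) := by
    intro n
    have hlt : N (disjointed (spanningSets ν) n) < ∞ :=
      (measure_mono (disjointed_subset _ _)).trans_lt (hN n)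
    generalize N (disjointed (spanningSets ν) n) = x at hlt
    lift x to ℝ≥0 using hlt.ne
    have hk : ∀ k : ℕ, (x : ℝ≥0∞) ∈ Set.Ico (k : ℝ≥0∞) (k + 1) ↔ k = ⌊x⌋₊ := by
      intro k
      have : (x : ℝ≥0∞) ∈ Set.Ico (k : ℝ≥0∞) (k + 1) ↔ (k : ℝ≥0) ≤ x ∧ x < k + 1 := by
        rw [Set.mem_Ico]
        norm_cast
      rw [this, eq_comm, Nat.floor_eq_iff zero_le]
    simp_rw [hk]
    rw [tsum_ite_eq]
  calc _ = ∑' n : ℕ, ∑' k : ℕ, (if N (disjointed (spanningSets ν) n) ∈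
      Set.Ico (k : ℝ≥0∞) (k + 1) then N (A ∩ disjointed (spanningSets ν) n) else 0) := by
        refine tsum_congr fun n => tsum_congr fun k => ?_
        rw [truncPiece_apply]
        by_cases h : N (disjointed (spanningSets ν) n) ∈ Set.Ico (k : ℝ≥0∞) (k + 1)
        · rw [if_pos h, Set.indicator_of_mem (by exact h), Measure.restrict_apply hA]
        · rw [if_neg h, Set.indicator_of_notMem (by exact h)]; rfl
    _ = N A := by
        simp_rw [h1]
        rw [← measure_iUnion _ fun n => hA.inter (hm n), ← Set.inter_iUnion, iUnion_disjointed,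
          iUnion_spanningSets, Set.inter_univ]
        exact fun a b hab => (disjoint_disjointed _ hab).mono Set.inter_subset_right
          Set.inter_subset_right

variable {P : Measure Ω} {ν : Measure E} {Y : I → Ω → E}

theorem PoissonProcess.ae_truncKernel [Countable I] [SigmaFinite ν] [IsProbabilityMeasure P]
    (h : PoissonProcess P ν Y) :
    ∀ᵐ ω ∂P, truncKernel ν (conf fun i => Y i ω) = conf (fun i => Y i ω) ∧
      ∀ i, truncKernel ν (confErase (fun j => Y j ω) i) = confErase (fun j => Y j ω) i := by
  have h1 : ∀ᵐ ω ∂P, ∀ n, conf (fun i => Y i ω) (spanningSets ν n) < ∞ := by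
    rw [ae_all_iff]
    intro n
    filter_upwards [h.ae_finite (measurableSet_spanningSets ν n)
      (measure_spanningSets_lt_top ν n).ne] with ω hω using hω.2
  filter_upwards [h1] with ω hω
  exact ⟨truncKernel_apply ν hω, fun i => truncKernel_apply ν fun n =>
    (confErase_le_conf _ i _).trans_lt (hω n)⟩

open Classical in
/-- The Mecke equation for functions of the sum of `v y` over the other points. -/
theorem PoissonProcess.tsum_lintegral_shotNoise [Countable I] [SigmaFinite ν]
    [IsProbabilityMeasure P] (h : PoissonProcess P ν Y) {f : E → ℝ≥0∞ → ℝ≥0∞}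
    {v : E → E → ℝ≥0∞} (hf : Measurable (Function.uncurry f))
    (hv : Measurable (Function.uncurry v)) :
    ∑' i, ∫⁻ ω, f (Y i ω) (∑' j, if j = i then 0 else v (Y i ω) (Y j ω)) ∂P =
      ∫⁻ y, ∫⁻ ω, f y (∑' j, v y (Y j ω)) ∂P ∂ν := by
  have hvy : ∀ y, Measurable (v y) := fun y => hv.comp measurable_prodMk_left
  -- Joint measurability of `∫ v y dN` in `(y, N)` is obtained through the s-finite kernel
  -- `truncKernel ν`; almost surely it returns the configuration itself, also after erasing a point.
  have key := h.tsum_lintegral (F := fun y N => f y (∫⁻ y', v y y' ∂(truncKernel ν N))) (by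
    refine hf.comp (measurable_fst.prodMk ?_)
    have : Measurable fun p : E × Measure E => ∫⁻ y', v p.1 y' ∂(Kernel.prodMkLeft E
        (truncKernel ν) p) :=
      Measurable.lintegral_kernel_prod_right (by
        exact hv.comp ((measurable_fst.comp measurable_fst).prodMk measurable_snd))
    exact this)
  refine Eq.trans (tsum_congr fun i => lintegral_congr_ae ?_) (key.trans
    (lintegral_congr fun y => lintegral_congr_ae ?_))
  · filter_upwards [h.ae_truncKernel] with ω hω
    rw [hω.2, lintegral_confErase _ _ (hvy _)]
  · filter_upwards [h.ae_truncKernel] with ω hω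
    rw [hω.1, lintegral_conf _ (hvy _)]

-- The Mecke equation replaces the distinguished point by an integration variable `y`. The remaining
-- points are then an unconditioned Poisson process, to which the Laplace functional applies with
-- `y` fixed.
open Classical in
theorem PoissonProcess.tsum_lintegral_eexpNeg [Countable I] [SigmaFinite ν]
    [IsProbabilityMeasure P] (h : PoissonProcess P ν Y) {f : E → ℝ≥0∞}
    {v : E → E → ℝ≥0∞} (hf : Measurable f) (hv : Measurable (Function.uncurry v)) :
    ∑' i, ∫⁻ ω, f (Y i ω) * eexpNeg (∑' j, if j = i then 0 else v (Y i ω) (Y j ω)) ∂P =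
      ∫⁻ y, f y * eexpNeg (∫⁻ y', 1 - eexpNeg (v y y') ∂ν) ∂ν := by
  refine (h.tsum_lintegral_shotNoise (f := fun y x => f y * eexpNeg x) (by fun_prop) hv).trans
    (lintegral_congr fun y => ?_)
  have hvy : Measurable (v y) := hv.comp measurable_prodMk_left
  rw [lintegral_const_mul, h.lintegral_eexpNeg_tsum hvy]
  exact measurable_eexpNeg.comp (Measurable.tsum fun j => hvy.comp (h.measurable j))

/-- Almost surely, no two points are in a relation that is satisfied, for each `y`, by almost no
`y'`. -/
theorem PoissonProcess.ae_forall_ne [Countable I] [SigmaFinite ν]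
    [IsProbabilityMeasure P] (h : PoissonProcess P ν Y) {R : Set (E × E)} (hR : MeasurableSet R)
    (hR0 : ∀ y, ν {y' | (y, y') ∈ R} = 0) :
    ∀ᵐ ω ∂P, ∀ i j, j ≠ i → (Y i ω, Y j ω) ∉ R := by
  classical
  have hv : Measurable (Function.uncurry fun y y' => R.indicator (1 : E × E → ℝ≥0∞) (y, y')) :=
    measurable_one.indicator hR
  -- Both sides are the expected number of ordered pairs of distinct points in `R`; by Campbell's
  -- formula the inner expectation vanishes for every `y`.
  have key := h.tsum_lintegral_shotNoise (f := fun _ x => x) measurable_snd hv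
  have hz : ∀ y, ∫⁻ ω, ∑' j, R.indicator (1 : E × E → ℝ≥0∞) (y, Y j ω) ∂P = 0 := by
    intro y
    have hm : Measurable fun y' => R.indicator (1 : E × E → ℝ≥0∞) (y, y') :=
      hv.comp measurable_prodMk_left
    have hmj : ∀ j, AEMeasurable (fun ω => R.indicator (1 : E × E → ℝ≥0∞) (y, Y j ω)) P :=
      fun j => (hm.comp (h.measurable j)).aemeasurable
    rw [lintegral_tsum hmj, h.campbell hm]
    have : (fun y' => R.indicator (1 : E × E → ℝ≥0∞) (y, y')) =
        {y' | (y, y') ∈ R}.indicator 1 := by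
      funext y'; simp [Set.indicator]
    have hRy : MeasurableSet {y' | (y, y') ∈ R} := measurable_prodMk_left hR
    exact (congrArg (lintegral ν) this).trans ((lintegral_indicator_one hRy).trans (hR0 y))
  simp_rw [hz, lintegral_zero, ENNReal.tsum_eq_zero] at key
  rw [ae_all_iff]
  intro i
  have hm : Measurable fun ω => ∑' j, if j = i then 0 else
      R.indicator (1 : E × E → ℝ≥0∞) (Y i ω, Y j ω) := by
    refine Measurable.tsum fun j => ?_
    split_ifs
    · exact measurable_const
    · exact hv.comp ((h.measurable i).prodMk (h.measurable j))
  filter_upwards [(lintegral_eq_zero_iff hm).1 (key i)] with ω hω j hj hmem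
  have := ENNReal.tsum_eq_zero.1 hω j
  simp [hj, hmem] at this

end Palm

/-! ### Gamma variables -/

section Gamma

/-- Exponential tilting: the factor `exp (-c h)` changes the rate from `M` to `M + c`, and the ratio
of the normalising constants is the Laplace transform. -/
theorem gammaPDF_natCast_mul_eexpNeg {M : ℕ} (hM : 0 < M) {c : ℝ} (hc : 0 ≤ c) (h : ℝ) :
    gammaPDF M M h * eexpNeg (ENNReal.ofReal (c * h)) =
      ENNReal.ofReal (((1 + c / M) ^ M)⁻¹) * gammaPDF M (M + c) h := by
  have hM' : (0 : ℝ) < M := by exact_mod_cast hM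
  rcases lt_or_ge h 0 with hh | hh
  · simp [gammaPDF_of_neg hh]
  · rw [eexpNeg_ofReal (by positivity), gammaPDF_of_nonneg hh, gammaPDF_of_nonneg hh,
      ← ENNReal.ofReal_mul (by positivity), ← ENNReal.ofReal_mul (by positivity)]
    congr 1
    have h1 : (1 + c / M) ^ M = (M + c) ^ M / (M : ℝ) ^ M := by
      rw [← div_pow]; congr 1; field_simp
    have h2 : Real.exp (-((M + c) * h)) = Real.exp (-(M * h)) * Real.exp (-(c * h)) := by
      rw [← Real.exp_add]; ring_nf
    rw [h1, h2, Real.rpow_natCast, Real.rpow_natCast]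
    have : (0 : ℝ) < (M + c) ^ M := by positivity
    field_simp

/-- The Laplace transform of a gamma variable with mean one and integer shape. -/
theorem lintegral_eexpNeg_gammaMeasure {M : ℕ} (hM : 0 < M) {c : ℝ} (hc : 0 ≤ c) :
    ∫⁻ h, eexpNeg (ENNReal.ofReal (c * h)) ∂(gammaMeasure M M) =
      ENNReal.ofReal (((1 + c / M) ^ M)⁻¹) := by
  have hM' : (0 : ℝ) < M := by exact_mod_cast hM
  have hm : ∀ a r, Measurable (gammaPDF a r) := fun a r =>
    (measurable_gammaPDFReal a r).ennreal_ofReal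
  rw [gammaMeasure, lintegral_withDensity_eq_lintegral_mul _ (hm _ _) (by fun_prop)]
  simp only [Pi.mul_apply, gammaPDF_natCast_mul_eexpNeg hM hc]
  rw [lintegral_const_mul _ (hm _ _), lintegral_gammaPDF_eq_one hM' (by positivity), mul_one]

/-- The tail of the gamma distribution with shape `n + 1` and rate one. -/
noncomputable def erlangTail (n : ℕ) (s : ℝ) : ℝ :=
  Real.exp (-s) * ∑ j ∈ Finset.range (n + 1), s ^ j / j.factorial

/-- The derivative of the sum telescopes against that of the exponential and leaves only the last
term, minus the Erlang density. -/
theorem hasDerivAt_erlangTail (n : ℕ) (s : ℝ) :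
    HasDerivAt (erlangTail n) (-(Real.exp (-s) * (s ^ n / n.factorial))) s := by
  induction n with
  | zero =>
    have : HasDerivAt (fun s : ℝ => Real.exp (-s)) (Real.exp (-s) * (-1)) s :=
      (hasDerivAt_neg s).exp
    have h2 : erlangTail 0 = fun s : ℝ => Real.exp (-s) := by funext s; simp [erlangTail]
    rw [h2]; simpa using this
  | succ n ih =>
    have h2 : erlangTail (n + 1) =
        fun s : ℝ => erlangTail n s + Real.exp (-s) * (s ^ (n + 1) / (n + 1).factorial) := by
      funext s; simp only [erlangTail]; rw [Finset.sum_range_succ _ (n + 1), mul_add]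
    rw [h2]
    have h3 : HasDerivAt (fun s : ℝ => Real.exp (-s)) (Real.exp (-s) * (-1)) s :=
      (hasDerivAt_neg s).exp
    have h4 : HasDerivAt (fun s : ℝ => s ^ (n + 1) / ((n + 1).factorial : ℝ))
        (((n + 1 : ℕ) : ℝ) * s ^ n / (n + 1).factorial) s := by
      simpa using (hasDerivAt_pow (n + 1) s).div_const ((n + 1).factorial : ℝ)
    refine (ih.add (h3.mul h4)).congr_deriv ?_
    rw [Nat.factorial_succ]
    push_cast
    field_simp
    ring

theorem tendsto_erlangTail (n : ℕ) : Filter.Tendsto (erlangTail n) Filter.atTop (nhds 0) := by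
  have h : erlangTail n = fun s => ∑ j ∈ Finset.range (n + 1),
      (s ^ j * Real.exp (-s)) / j.factorial := by
    funext s
    rw [erlangTail, Finset.mul_sum]
    exact Finset.sum_congr rfl fun j _ => by ring
  rw [h]
  have : (0 : ℝ) = ∑ j ∈ Finset.range (n + 1), (0 : ℝ) / j.factorial := by simp
  rw [this]
  exact tendsto_finsetSum _ fun j _ =>
    (Real.tendsto_pow_mul_exp_neg_atTop_nhds_zero j).div_const _

/-- By `hasDerivAt_erlangTail`, `x ↦ -erlangTail n (M x)` is an antiderivative of the density on
`[0, ∞)`, and it vanishes at infinity. -/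
theorem gammaMeasure_Ioi (n : ℕ) {t : ℝ} (ht : 0 ≤ t) :
    gammaMeasure ((n + 1 : ℕ) : ℝ) ((n + 1 : ℕ) : ℝ) (Set.Ioi t) =
      ENNReal.ofReal (erlangTail n ((n + 1 : ℕ) * t)) := by
  have hM : (0 : ℝ) < ((n + 1 : ℕ) : ℝ) := by positivity
  set M : ℝ := ((n + 1 : ℕ) : ℝ) with hMdef
  have hMn : M - 1 = n := by simp [hMdef]
  have hprob : IsProbabilityMeasure (gammaMeasure M M) :=
    isProbabilityMeasure_gammaMeasure hM hM
  have hpdf : ∀ x ∈ Set.Ioi t, gammaPDFReal M M x =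
      M * (Real.exp (-(M * x)) * ((M * x) ^ n / n.factorial)) := by
    intro x hx
    have hx0 : 0 ≤ x := ht.trans (le_of_lt hx)
    rw [gammaPDFReal, if_pos hx0, hMn, Real.rpow_natCast, hMdef, Real.rpow_natCast, ← hMdef]
    have : Real.Gamma M = n.factorial := by
      rw [hMdef]; push_cast; exact Real.Gamma_nat_eq_factorial n
    rw [this, mul_pow, pow_succ]
    ring
  have hint : Integrable (gammaPDFReal M M) := by
    refine ⟨(stronglyMeasurable_gammaPDFReal M M).aestronglyMeasurable, ?_⟩
    rw [hasFiniteIntegral_iff_ofReal (ae_of_all _ (gammaPDFReal_nonneg hM hM))]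
    have := lintegral_gammaPDF_eq_one hM hM
    simp only [gammaPDF] at this
    rw [this]; exact ENNReal.one_lt_top
  have hder : ∀ x ∈ Set.Ici t, HasDerivAt (fun x => -erlangTail n (M * x))
      (M * (Real.exp (-(M * x)) * ((M * x) ^ n / n.factorial))) x := by
    intro x _
    have h1 : HasDerivAt (fun x : ℝ => M * x) M x := by
      simpa using (hasDerivAt_id x).const_mul M
    exact ((hasDerivAt_erlangTail n (M * x)).comp x h1).neg.congr_deriv (by ring)
  have hlim : Filter.Tendsto (fun x => -erlangTail n (M * x)) Filter.atTop (nhds 0) := by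
    simpa using ((tendsto_erlangTail n).comp (Filter.tendsto_id.const_mul_atTop hM)).neg
  have key := integral_Ioi_of_hasDerivAt_of_tendsto' hder
    (hint.integrableOn.congr_fun hpdf measurableSet_Ioi) hlim
  rw [gammaMeasure, withDensity_apply _ measurableSet_Ioi]
  simp only [gammaPDF]
  rw [← ofReal_integral_eq_lintegral_ofReal hint.integrableOn
    (ae_of_all _ (gammaPDFReal_nonneg hM hM)), setIntegral_congr_fun measurableSet_Ioi hpdf, key]
  simp

/-! ### Alzer's inequality -/

/-- The second derivative is `exp (-u) / (1 - exp (-u))² - 1 / u²`. It is nonpositive because `u exp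
(-u/2) ≤ 1 - exp (-u)`, which is `u/2 ≤ sinh (u/2)`. -/
theorem concaveOn_log_div_one_sub_exp :
    ConcaveOn ℝ (Set.Ioi 0) fun u : ℝ => Real.log u - Real.log (1 - Real.exp (-u)) := by
  have hpos : ∀ u ∈ Set.Ioi (0 : ℝ), 0 < 1 - Real.exp (-u) := fun u hu => by
    have : Real.exp (-u) < 1 := Real.exp_lt_one_iff.2 (neg_lt_zero.2 hu)
    linarith
  have he : ∀ u : ℝ, HasDerivAt (fun u : ℝ => Real.exp (-u)) (-Real.exp (-u)) u := fun u => by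
    simpa using (hasDerivAt_neg u).exp
  have h1 : ∀ u ∈ Set.Ioi (0 : ℝ), HasDerivAt
      (fun u : ℝ => Real.log u - Real.log (1 - Real.exp (-u)))
      (u⁻¹ - Real.exp (-u) / (1 - Real.exp (-u))) u := by
    intro u hu
    have hu' : u ≠ 0 := ne_of_gt hu
    refine ((Real.hasDerivAt_log hu').sub
      (((he u).const_sub 1).log (hpos u hu).ne')).congr_deriv ?_
    ring
  have h2 : ∀ u ∈ Set.Ioi (0 : ℝ), HasDerivAt
      (fun u : ℝ => u⁻¹ - Real.exp (-u) / (1 - Real.exp (-u)))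
      (-(u ^ 2)⁻¹ + Real.exp (-u) / (1 - Real.exp (-u)) ^ 2) u := by
    intro u hu
    have hu' : u ≠ 0 := ne_of_gt hu
    have hd := (hpos u hu).ne'
    refine ((hasDerivAt_inv hu').sub
      ((he u).div ((he u).const_sub 1) hd)).congr_deriv ?_
    field_simp
    ring
  refine concaveOn_of_hasDerivWithinAt2_nonpos (convex_Ioi 0)
    (f' := fun u : ℝ => u⁻¹ - Real.exp (-u) / (1 - Real.exp (-u)))
    (f'' := fun u : ℝ => -(u ^ 2)⁻¹ + Real.exp (-u) / (1 - Real.exp (-u)) ^ 2)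
    (fun u hu => (h1 u hu).continuousAt.continuousWithinAt) ?_ ?_ ?_
  · rw [interior_Ioi]; exact fun u hu => (h1 u hu).hasDerivWithinAt
  · rw [interior_Ioi]; exact fun u hu => (h2 u hu).hasDerivWithinAt
  · rw [interior_Ioi]
    intro u hu
    have hu0 : 0 < u := hu
    have hsinh : u / 2 ≤ Real.sinh (u / 2) := Real.self_le_sinh_iff.2 (by positivity)
    rw [Real.sinh_eq] at hsinh
    have hx : Real.exp (-u) = Real.exp (-(u / 2)) ^ 2 := by
      rw [← Real.exp_nat_mul]; congr 1; push_cast; ring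
    have hxy : Real.exp (u / 2) * Real.exp (-(u / 2)) = 1 := by
      rw [← Real.exp_add]; simp
    have hx0 := Real.exp_pos (-(u / 2))
    have hd := hpos u hu
    have h3 : u * Real.exp (-(u / 2)) ≤ 1 - Real.exp (-u) := by
      rw [hx]
      nlinarith
    have h4 : u ^ 2 * Real.exp (-u) ≤ (1 - Real.exp (-u)) ^ 2 := by
      calc u ^ 2 * Real.exp (-u) = (u * Real.exp (-(u / 2))) ^ 2 := by rw [hx]; ring
        _ ≤ _ := pow_le_pow_left₀ (by positivity) h3 2
    have h5 : Real.exp (-u) / (1 - Real.exp (-u)) ^ 2 ≤ (u ^ 2)⁻¹ := by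
      rw [inv_eq_one_div, div_le_div_iff₀ (by positivity) (by positivity)]
      linarith
    linarith

/-- For a nonnegative concave function `ψ` on `(0, ∞)` the quotient `ψ(u)/u` is nonincreasing. The
origin is outside the domain, so concavity is used on `[ε, v]`, the nonnegative term with `ψ ε` is
dropped, and `ε` tends to zero. -/
theorem log_div_one_sub_exp_mul_le {u v : ℝ} (hu : 0 < u) (huv : u < v) :
    (Real.log v - Real.log (1 - Real.exp (-v))) * u ≤
      (Real.log u - Real.log (1 - Real.exp (-u))) * v := by
  set ψ : ℝ → ℝ := fun u => Real.log u - Real.log (1 - Real.exp (-u)) with hψ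
  have hnonneg : ∀ x : ℝ, 0 < x → 0 ≤ ψ x := by
    intro x hx
    have h1 : 0 < 1 - Real.exp (-x) := by
      have : Real.exp (-x) < 1 := Real.exp_lt_one_iff.2 (neg_lt_zero.2 hx)
      linarith
    have h2 : 1 - Real.exp (-x) ≤ x := by
      have := Real.add_one_le_exp (-x); linarith
    have := Real.log_le_log h1 h2
    simp only [hψ]; linarith
  have hε : ∀ ε ∈ Set.Ioo 0 u, ψ v * (u - ε) ≤ ψ u * (v - ε) := by
    rintro ε ⟨h0, h1⟩
    have hd : 0 < v - ε := by linarith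
    have := concaveOn_log_div_one_sub_exp.2 (show ε ∈ Set.Ioi (0 : ℝ) from h0)
      (show v ∈ Set.Ioi (0 : ℝ) from hu.trans huv)
      (show 0 ≤ (v - u) / (v - ε) from div_nonneg (by linarith) hd.le)
      (show 0 ≤ (u - ε) / (v - ε) from div_nonneg (by linarith) hd.le) (by field_simp; ring)
    have hcomb : ((v - u) / (v - ε)) • ε + ((u - ε) / (v - ε)) • v = u := by
      simp only [smul_eq_mul]; field_simp; ring
    rw [hcomb] at this
    change ((v - u) / (v - ε)) • ψ ε + ((u - ε) / (v - ε)) • ψ v ≤ ψ u at this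
    simp only [smul_eq_mul] at this
    have h3 : 0 ≤ (v - u) / (v - ε) * ψ ε :=
      mul_nonneg (div_nonneg (by linarith) hd.le) (hnonneg ε h0)
    have h4 : (u - ε) / (v - ε) * ψ v ≤ ψ u := by linarith
    rw [div_mul_eq_mul_div, div_le_iff₀ hd] at h4
    linarith
  have hc1 : Filter.Tendsto (fun ε => ψ v * (u - ε)) (nhdsWithin 0 (Set.Ioi 0))
      (nhds (ψ v * (u - 0))) :=
    Filter.Tendsto.mono_left (Continuous.tendsto (by fun_prop) 0) nhdsWithin_le_nhds
  have hc2 : Filter.Tendsto (fun ε => ψ u * (v - ε)) (nhdsWithin 0 (Set.Ioi 0))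
      (nhds (ψ u * (v - 0))) :=
    Filter.Tendsto.mono_left (Continuous.tendsto (by fun_prop) 0) nhdsWithin_le_nhds
  have := le_of_tendsto_of_tendsto hc1 hc2
    (Filter.eventually_of_mem (Ioo_mem_nhdsGT hu) hε)
  simpa using this

/-- Alzer's inequality for integer shape. -/
theorem erlangTail_le (n : ℕ) {β : ℝ} (hβ : 0 < β) (hβn : β ^ (n + 1) * (n + 1).factorial = 1)
    {s : ℝ} (hs : 0 ≤ s) :
    erlangTail n s ≤ 1 - (1 - Real.exp (-(β * s))) ^ (n + 1) := by
  -- The difference of the two sides vanishes at zero and at infinity. If it were negative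
  -- somewhere, its derivative would be negative at some point and positive at a later one; the sign
  -- of the derivative excludes this order.
  set D : ℝ → ℝ := fun s => 1 - (1 - Real.exp (-(β * s))) ^ (n + 1) - erlangTail n s with hD
  set D' : ℝ → ℝ := fun s => Real.exp (-s) * (s ^ n / n.factorial) -
    (n + 1) * β * Real.exp (-(β * s)) * (1 - Real.exp (-(β * s))) ^ n with hD'
  have hder : ∀ s, HasDerivAt D (D' s) s := by
    intro s
    have h1 : HasDerivAt (fun s : ℝ => β * s) β s := by
      simpa using (hasDerivAt_id s).const_mul β
    have h2 := ((h1.neg.exp.const_sub 1).pow (n + 1)).const_sub 1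
    refine (h2.sub (hasDerivAt_erlangTail n s)).congr_deriv ?_
    simp only [hD']
    push_cast
    simp
    ring
  have hcont : Continuous D := continuous_iff_continuousAt.2 fun s => (hder s).continuousAt
  have hD0 : D 0 = 0 := by
    simp [hD, erlangTail, Finset.sum_range_succ']
  have hDlim : Filter.Tendsto D Filter.atTop (nhds 0) := by
    have h1 : Filter.Tendsto (fun s : ℝ => Real.exp (-(β * s))) Filter.atTop (nhds 0) :=
      Real.tendsto_exp_neg_atTop_nhds_zero.comp (Filter.tendsto_id.const_mul_atTop hβ)
    have h2 := (((h1.const_sub 1).pow (n + 1)).const_sub 1).sub (tendsto_erlangTail n)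
    simpa using h2
  -- The derivative is a positive factor times `exp x - 1`, where `x` is the logarithm of the ratio
  -- of the two densities. Its sign is therefore that of `n ψ(β s) - (1 - β) s` with `ψ(u) = log u -
  -- log (1 - exp (-u))`.
  have hsign : ∀ s, 0 < s → 0 < 1 - Real.exp (-(β * s)) ∧ ∀ x : ℝ,
      x = n * (Real.log (β * s) - Real.log (1 - Real.exp (-(β * s)))) - (1 - β) * s →
      (0 < D' s → 0 < x) ∧ (D' s < 0 → x < 0) := by
    intro s hs
    have he : 0 < 1 - Real.exp (-(β * s)) := by
      have : Real.exp (-(β * s)) < 1 := Real.exp_lt_one_iff.2 (neg_lt_zero.2 (by positivity))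
      linarith
    refine ⟨he, fun x hx => ?_⟩
    set q := 1 - Real.exp (-(β * s)) with hq
    have hexp : Real.exp x = (β * s / q) ^ n * Real.exp (β * s) * Real.exp (-s) := by
      rw [hx, ← Real.log_div (by positivity) he.ne', ← Real.log_pow,
        show Real.log ((β * s / q) ^ n) - (1 - β) * s =
          Real.log ((β * s / q) ^ n) + β * s + -s by ring, Real.exp_add, Real.exp_add,
        Real.exp_log (by positivity)]
    have hfac : D' s = (n + 1) * β * Real.exp (-(β * s)) * q ^ n * (Real.exp x - 1) := by
      have hee : Real.exp (-(β * s)) * Real.exp (β * s) = 1 := by rw [← Real.exp_add]; simp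
      rw [hexp, show D' s = Real.exp (-s) * (s ^ n / n.factorial) -
        (n + 1) * β * Real.exp (-(β * s)) * q ^ n from rfl]
      rw [Nat.factorial_succ] at hβn
      push_cast at hβn
      have hn : (0 : ℝ) < n.factorial := by positivity
      -- The normalisation of `β` is exactly what makes the constants in the two densities cancel.
      have hval : (1 : ℝ) / n.factorial = (n + 1) * β * β ^ n := by
        rw [div_eq_iff hn.ne']
        linear_combination (-1 : ℝ) * hβn
      have h1 : s ^ n / n.factorial = s ^ n * ((n + 1) * β * β ^ n) := by rw [← hval]; ring
      rw [h1, div_pow, mul_pow]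
      have hqn : q ^ n ≠ 0 := (pow_pos he n).ne'
      generalize q ^ n = Q at *
      generalize Real.exp (-(β * s)) = E₁ at *
      generalize Real.exp (β * s) = E₂ at *
      generalize Real.exp (-s) = e at *
      field_simp
      linear_combination (-(s ^ n * β ^ n * e)) * hee
    have hc : 0 < (n + 1) * β * Real.exp (-(β * s)) * q ^ n := by positivity
    rw [hfac]
    constructor
    · intro h
      have := pos_of_mul_pos_right h hc.le
      exact Real.one_lt_exp_iff.1 (by linarith)
    · intro h
      have := neg_of_mul_neg_right h hc.le
      exact Real.exp_lt_one_iff.1 (by linarith)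
  suffices h : 0 ≤ D s by simp only [hD] at h; linarith
  by_contra! hneg
  have hs0 : 0 < s := lt_of_le_of_ne hs fun h => by rw [← h, hD0] at hneg; exact lt_irrefl _ hneg
  obtain ⟨s₁, ⟨h1, h1'⟩, hd1⟩ := exists_hasDerivAt_eq_slope D D' hs0 hcont.continuousOn
    fun x _ => hder x
  obtain ⟨s₃, h3, h3'⟩ := ((hDlim.eventually (lt_mem_nhds hneg)).and
    (Filter.eventually_gt_atTop s)).exists
  obtain ⟨s₂, ⟨h2, h2'⟩, hd2⟩ := exists_hasDerivAt_eq_slope D D' h3' hcont.continuousOn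
    fun x _ => hder x
  have hn1 : D' s₁ < 0 := by
    rw [hd1, hD0]; exact div_neg_of_neg_of_pos (by linarith) (by linarith)
  have hp2 : 0 < D' s₂ := by
    rw [hd2]; exact div_pos (by linarith) (by linarith)
  have h12 : s₁ < s₂ := h1'.trans h2
  have e1 := ((hsign s₁ h1).2 _ rfl).2 hn1
  have e2 := ((hsign s₂ (h1.trans h12)).2 _ rfl).1 hp2
  have key := log_div_one_sub_exp_mul_le (mul_pos hβ h1) (mul_lt_mul_of_pos_left h12 hβ)
  set A := Real.log (β * s₁) - Real.log (1 - Real.exp (-(β * s₁)))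
  set B := Real.log (β * s₂) - Real.log (1 - Real.exp (-(β * s₂)))
  -- Divided by `s`, the sign expression is `n ψ(β s)/s - (1 - β)`, which is nonincreasing; it
  -- cannot be negative at `s₁` and positive at the later `s₂`. The sign of `1 - β` plays no role.
  have key' : B * s₁ ≤ A * s₂ := by nlinarith
  have hn0 : (0 : ℝ) ≤ n := Nat.cast_nonneg n
  have k1 : (n * A - (1 - β) * s₁) * s₂ < 0 := mul_neg_of_neg_of_pos e1 (h1.trans h12)
  have k2 : 0 < (n * B - (1 - β) * s₂) * s₁ := mul_pos e2 h1
  have k3 := mul_le_mul_of_nonneg_left key' hn0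
  linarith

theorem gammaMeasure_setOf_lt {M : ℕ} (hM : 0 < M) {p γ : ℝ} (hp : 0 < p) (hγ : 0 < γ)
    {J : ℝ≥0∞} (hJ : J ≠ ∞) :
    gammaMeasure M M {h | ENNReal.ofReal γ * J < ENNReal.ofReal (p * h)} =
      ENNReal.ofReal (erlangTail (M - 1) (M * (γ * J.toReal / p))) := by
  obtain ⟨n, rfl⟩ : ∃ n, M = n + 1 := ⟨M - 1, by omega⟩
  have ht : 0 ≤ γ * J.toReal / p := by positivity
  rw [Nat.add_sub_cancel, ← gammaMeasure_Ioi n ht]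
  congr 1
  ext h
  conv_lhs => rw [← ENNReal.ofReal_toReal hJ]
  rw [Set.mem_ofPred_eq, ← ENNReal.ofReal_mul hγ.le, ENNReal.ofReal_lt_ofReal_iff',
    Set.mem_Ioi, div_lt_iff₀ hp, mul_comm h p]
  constructor
  · exact fun h => h.1
  · intro h
    exact ⟨h, lt_of_le_of_lt (by positivity) h⟩

/-- A gamma variable exceeds a level with at most the probability given by Alzer's inequality. -/
theorem gammaMeasure_setOf_lt_le {M : ℕ} (hM : 0 < M) {p γ : ℝ} (hp : 0 < p) (hγ : 0 < γ)
    (J : ℝ≥0∞) :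
    gammaMeasure M M {h | ENNReal.ofReal γ * J < ENNReal.ofReal (p * h)} ≤
      ENNReal.ofReal (1 - (1 - expNeg (ENNReal.ofReal
        (γ * (M * (M.factorial : ℝ) ^ (-1 / (M : ℝ))) / p) * J)) ^ M) := by
  rcases eq_or_ne J ∞ with rfl | hJ
  · simp [ENNReal.mul_top, hγ]
  rw [gammaMeasure_setOf_lt hM hp hγ hJ]
  obtain ⟨n, rfl⟩ : ∃ n, M = n + 1 := ⟨M - 1, by omega⟩
  -- With this `β`, `φ = M β` and `β ^ M * M! = 1`; the level in the tail is `M` times the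
  -- threshold, which produces the factor `φ` in the exponent.
  set β : ℝ := ((n + 1).factorial : ℝ) ^ (-1 / ((n + 1 : ℕ) : ℝ)) with hβdef
  have hfac : (0 : ℝ) < (n + 1).factorial := by positivity
  have hβ : 0 < β := Real.rpow_pos_of_pos hfac _
  have hβn : β ^ (n + 1) * (n + 1).factorial = 1 := by
    rw [hβdef, ← Real.rpow_natCast, ← Real.rpow_mul hfac.le]
    have : -1 / ((n + 1 : ℕ) : ℝ) * ((n + 1 : ℕ) : ℝ) = -1 := by field_simp
    rw [this, Real.rpow_neg_one, inv_mul_cancel₀ hfac.ne']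
  refine ENNReal.ofReal_le_ofReal ?_
  rw [Nat.add_sub_cancel]
  have hs : 0 ≤ ((n + 1 : ℕ) : ℝ) * (γ * J.toReal / p) := by positivity
  refine (erlangTail_le n hβ hβn hs).trans (le_of_eq ?_)
  rw [expNeg, if_neg (ENNReal.mul_ne_top ENNReal.ofReal_ne_top hJ), ENNReal.toReal_mul,
    ENNReal.toReal_ofReal (by positivity)]
  congr 5
  ring

/-- For shape one the tail is a pure exponential, so nothing is lost in Alzer's bound. -/
theorem gammaMeasure_one_setOf_lt {p γ : ℝ} (hp : 0 < p) (hγ : 0 < γ) (J : ℝ≥0∞) :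
    gammaMeasure ((1 : ℕ) : ℝ) ((1 : ℕ) : ℝ)
        {h | ENNReal.ofReal γ * J < ENNReal.ofReal (p * h)} =
      ENNReal.ofReal (expNeg (ENNReal.ofReal (γ / p) * J)) := by
  rcases eq_or_ne J ∞ with rfl | hJ
  · have : 0 < γ / p := by positivity
    simp [ENNReal.mul_top, hγ, this, expNeg]
  rw [gammaMeasure_setOf_lt one_pos hp hγ hJ]
  rw [expNeg, if_neg (ENNReal.mul_ne_top ENNReal.ofReal_ne_top hJ), ENNReal.toReal_mul,
    ENNReal.toReal_ofReal (by positivity)]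
  simp only [erlangTail]
  congr 1
  simp
  ring

end Gamma

/-! ### Superposition of independent Poisson point processes -/

section Superposition

/-- The atoms at integer vectors already carry total mass one. It is enough to compare the laws from
below, atom by atom, and then use equality of the total masses; other values, `∞` included, need not
be excluded beforehand. -/
theorem map_eq_map_pi_of_singleton {Ω κ : Type*} [MeasurableSpace Ω] [Fintype κ] {P : Measure Ω}
    [IsProbabilityMeasure P] {V : Ω → κ → ℝ≥0∞} (hV : Measurable V) (μ : κ → Measure ℕ)
    [∀ c, IsProbabilityMeasure (μ c)]
    (h : ∀ n : κ → ℕ, P {ω | ∀ c, V ω c = n c} = ∏ c, μ c {n c}) :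
    P.map V = (Measure.pi μ).map fun n c => ((n c : ℕ) : ℝ≥0∞) := by
  have hc : Measurable fun (n : κ → ℕ) (c : κ) => ((n c : ℕ) : ℝ≥0∞) :=
    measurable_pi_iff.2 fun c => (measurable_of_countable _).comp (measurable_pi_apply c)
  have : IsProbabilityMeasure (P.map V) := Measure.isProbabilityMeasure_map hV.aemeasurable
  have : IsProbabilityMeasure ((Measure.pi μ).map fun n c => ((n c : ℕ) : ℝ≥0∞)) :=
    Measure.isProbabilityMeasure_map hc.aemeasurable
  refine (Measure.eq_of_le_of_measure_univ_eq (Measure.le_iff.2 fun T hT => ?_) (by simp)).symm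
  rw [Measure.map_apply hc hT, Measure.map_apply hV hT]
  set S : Set (κ → ℕ) := (fun (n : κ → ℕ) (c : κ) => ((n c : ℕ) : ℝ≥0∞)) ⁻¹' T with hS
  have hSm : MeasurableSet S := hc hT
  have hmeas : ∀ n : κ → ℕ, MeasurableSet {ω | ∀ c, V ω c = n c} := by
    intro n
    rw [Set.ofPred_forall]
    exact MeasurableSet.iInter fun c =>
      (measurable_pi_apply c).comp hV (measurableSet_singleton _)
  calc (Measure.pi μ) S = ∑' n : S, P {ω | ∀ c, V ω c = (n : κ → ℕ) c} := by
        rw [← Set.biUnion_of_singleton S, measure_biUnion (Set.to_countable _)]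
        · rw [Set.biUnion_of_singleton S]
          exact tsum_congr fun n => by rw [h, Measure.pi_singleton]
        · exact fun a _ b _ hab => Set.disjoint_singleton.2 hab
        · exact fun n _ => measurableSet_singleton n
    _ = P (⋃ n ∈ S, {ω | ∀ c, V ω c = n c}) := by
        rw [measure_biUnion (Set.to_countable _) _ fun n _ => hmeas n]
        intro a _ b _ hab
        refine Set.disjoint_left.2 fun ω ha hb => hab (funext fun c => ?_)
        have := (ha c).symm.trans (hb c)
        exact_mod_cast this
    _ ≤ P (V ⁻¹' T) := by
        refine measure_mono (Set.iUnion₂_subset fun n hn ω hω => ?_)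
        have : V ω = fun c => ((n c : ℕ) : ℝ≥0∞) := funext hω
        rw [Set.mem_preimage, this]
        exact hn

theorem tsum_indicator_one_eq_encard {I E : Type*} (D : Set E) (z : I → E) :
    ∑' i, D.indicator (1 : E → ℝ≥0∞) (z i) = ({i | z i ∈ D}.encard : ℝ≥0∞) := by
  rw [← ENNReal.tsum_set_one, tsum_subtype _ fun _ => (1 : ℝ≥0∞)]
  exact tsum_congr fun i => by simp [Set.indicator]

theorem IsPoissonPointProcess.map {Ω E F : Type*} [MeasurableSpace Ω] [MeasurableSpace E]
    [MeasurableSpace F] {P : Measure Ω} {Λ : Measure E} {X : ℕ → Ω → E}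
    (h : IsPoissonPointProcess P Λ X) {g : E → F} (hg : Measurable g) :
    IsPoissonPointProcess P (Λ.map g) fun i ω => g (X i ω) where
  measurable i := hg.comp (h.measurable i)
  counts m A n hA hA' hd := by
    simp_rw [Measure.map_apply hg (hA _)] at hA' ⊢
    exact h.counts m (fun j => g ⁻¹' A j) n (fun j => hg (hA j)) hA'
      fun i j hij => (hd hij).preimage g

variable {Ω J F : Type*} [MeasurableSpace Ω] [MeasurableSpace F] {P : Measure Ω}

theorem IsPoissonPointProcess.counts_fintype {Λ : Measure F} {Z : ℕ → Ω → F}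
    (h : IsPoissonPointProcess P Λ Z) {κ : Type*} [Fintype κ] (A : κ → Set F) (n : κ → ℕ)
    (hA : ∀ j, MeasurableSet (A j)) (hA' : ∀ j, Λ (A j) ≠ ∞)
    (hd : Pairwise fun j j' => Disjoint (A j) (A j')) :
    P {ω | ∀ j, {i | Z i ω ∈ A j}.encard = n j} =
      ∏ j, poissonMeasure (Λ (A j)).toNNReal {n j} := by
  let e := (Fintype.equivFin κ).symm
  have := h.counts _ (fun j => A (e j)) (fun j => n (e j)) (fun j => hA _) (fun j => hA' _)
    fun i j hij => hd (e.injective.ne hij)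
  rw [e.prod_comp (fun j => poissonMeasure (Λ (A j)).toNNReal {n j})] at this
  rw [← this]
  congr 1
  ext ω
  exact (e.forall_congr_right (q := fun j => {i | Z i ω ∈ A j}.encard = n j)).symm

variable {J : Type} [Fintype J] [MeasurableSpace J]

/-- The intensity measure of the superposition of marked point processes. -/
noncomputable def sumIntensity (Λ : J → Measure F) : Measure (J × F) :=
  Measure.sum fun j => (Measure.dirac j).prod (Λ j)

instance (Λ : J → Measure F) [∀ j, SigmaFinite (Λ j)] : SigmaFinite (sumIntensity Λ) := by
  unfold sumIntensity; infer_instance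

theorem lintegral_sumIntensity (Λ : J → Measure F) [∀ j, SFinite (Λ j)] {f : J × F → ℝ≥0∞}
    (hf : Measurable f) : ∫⁻ y, f y ∂(sumIntensity Λ) = ∑ j, ∫⁻ z, f (j, z) ∂(Λ j) := by
  rw [sumIntensity, lintegral_sum_measure, tsum_fintype]
  refine Finset.sum_congr rfl fun j _ => ?_
  rw [Measure.dirac_prod, lintegral_map hf measurable_prodMk_left]

theorem sumIntensity_apply (Λ : J → Measure F) [∀ j, SFinite (Λ j)] {A : Set (J × F)}
    (hA : MeasurableSet A) : sumIntensity Λ A = ∑ j, Λ j {z | (j, z) ∈ A} := by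
  rw [← lintegral_indicator_one hA, lintegral_sumIntensity _ (measurable_one.indicator hA)]
  refine Finset.sum_congr rfl fun j _ => ?_
  rw [← lintegral_indicator_one (show MeasurableSet {z | (j, z) ∈ A} from
    measurable_prodMk_left hA)]
  exact lintegral_congr fun z => by simp [Set.indicator]

/-- The superposition of independent Poisson point processes, marked by the number of the process,
is a Poisson process. -/
theorem PoissonProcess.of_iIndep [DiscreteMeasurableSpace J] [IsProbabilityMeasure P] {Λ : J → Measure F}
    [∀ j, SFinite (Λ j)]
    {Z : J → ℕ → Ω → F} (hZ : ∀ j, IsPoissonPointProcess P (Λ j) (Z j))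
    (hind : iIndep (fun j => ⨆ i, MeasurableSpace.comap (Z j i) inferInstance) P) :
    PoissonProcess P (sumIntensity Λ) fun (x : J × ℕ) ω => (x.1, Z x.1 x.2 ω) := by
  classical
  have hY : ∀ x : J × ℕ, Measurable fun ω => (x.1, Z x.1 x.2 ω) := fun x =>
    measurable_const.prodMk ((hZ x.1).measurable x.2)
  refine ⟨hY, fun {ι} _ B hB hB' => ?_⟩
  -- A cell consists of the points of one process with a given membership pattern in the sets `B i`.
  -- Points in no `B i` are left out, since their set may have infinite intensity.
  set C : J × (ι → Bool) → Set (J × F) := fun c =>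
    {e | e.1 = c.1 ∧ (∃ i, e ∈ B i) ∧ ∀ i, e ∈ B i ↔ c.2 i = true} with hCdef
  have hCm : ∀ c, MeasurableSet (C c) := by
    intro c
    refine MeasurableSet.inter ?_ (MeasurableSet.inter ?_ ?_)
    · exact measurable_fst (MeasurableSet.of_discrete (s := {c.1}))
    · have : {e | ∃ i, e ∈ B i} = ⋃ i, B i := by ext; simp
      change MeasurableSet {e | ∃ i, e ∈ B i}
      rw [this]
      exact MeasurableSet.iUnion hB
    · have : {e | ∀ i, e ∈ B i ↔ c.2 i = true} = ⋂ i, {e | e ∈ B i ↔ c.2 i = true} := by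
        ext; simp
      change MeasurableSet {e | ∀ i, e ∈ B i ↔ c.2 i = true}
      rw [this]
      refine MeasurableSet.iInter fun i => ?_
      by_cases hi : c.2 i = true
      · simpa [hi] using hB i
      · simp only [hi, iff_false, Bool.false_eq_true]
        exact (hB i).compl
  set D : J → (ι → Bool) → Set F := fun j σ => {z | (j, z) ∈ C (j, σ)} with hDdef
  have hDm : ∀ j σ, MeasurableSet (D j σ) := fun j σ => measurable_prodMk_left (hCm (j, σ))
  have hCD : ∀ j σ, sumIntensity Λ (C (j, σ)) = Λ j (D j σ) := by
    intro j σ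
    rw [sumIntensity_apply _ (hCm _), Finset.sum_eq_single j _ (by simp)]
    intro j' _ hj'
    have : {z | (j', z) ∈ C (j, σ)} = ∅ := by
      ext z; simp [hCdef, hj']
    rw [this, measure_empty]
  have hCfin : ∀ c, sumIntensity Λ (C c) ≠ ∞ := by
    intro c
    have hsub : C c ⊆ ⋃ i, B i := fun e he => Set.mem_iUnion.2 he.2.1
    refine ((measure_mono hsub).trans_lt ((measure_iUnion_fintype_le _ _).trans_lt ?_)).ne
    exact ENNReal.sum_lt_top.2 fun i _ => (hB' i).lt_top
  have hCdisj : Pairwise fun c c' => Disjoint (C c) (C c') := by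
    intro c c' hcc
    refine Set.disjoint_left.2 fun e he he' => hcc (Prod.ext (he.1.symm.trans he'.1) ?_)
    funext i
    exact Bool.eq_iff_iff.2 ((he.2.2 i).symm.trans (he'.2.2 i))
  refine ⟨J × (ι → Bool), inferInstance, C, ⟨hCm, hCfin, hCdisj, ?_⟩, fun i =>
    ⟨Finset.univ.filter fun c => c.2 i = true, ?_⟩⟩
  · have hconf : ∀ ω j σ, conf (fun x : J × ℕ => (x.1, Z x.1 x.2 ω)) (C (j, σ)) =
        ({i | Z j i ω ∈ D j σ}.encard : ℝ≥0∞) := by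
      intro ω j σ
      rw [conf_apply _ (hCm _), ENNReal.tsum_prod', tsum_eq_single j,
        ← tsum_indicator_one_eq_encard]
      · exact tsum_congr fun i => by simp [Set.indicator, hDdef]
      · intro j' hj'
        simp [hCdef, hj', Set.indicator]
    refine map_eq_map_pi_of_singleton (measurable_pi_iff.2 fun c =>
      measurable_conf_apply hY (hCm c)) _ fun n => ?_
    have hset : {ω | ∀ c, conf (fun x : J × ℕ => (x.1, Z x.1 x.2 ω)) (C c) = n c} =
        ⋂ j, {ω | ∀ σ, {i | Z j i ω ∈ D j σ}.encard = n (j, σ)} := by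
      ext ω
      simp only [Set.mem_ofPred_eq, Set.mem_iInter, Prod.forall, hconf]
      refine forall_congr' fun j => forall_congr' fun σ => ?_
      rw [← ENat.toENNReal_coe, ENat.toENNReal_inj]
    -- Independence of the processes splits the event by `j`; for each `j` the counts in the cells
    -- are independent Poisson by the hypothesis on that process.
    rw [hset, hind.meas_iInter]
    · rw [Fintype.prod_prod_type]
      refine Finset.prod_congr rfl fun j _ => ?_
      rw [(hZ j).counts_fintype (D j) (fun σ => n (j, σ)) (hDm j)
        (fun σ => hCD j σ ▸ hCfin (j, σ))]
      · simp_rw [hCD]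
      · intro σ σ' hσ
        exact (hCdisj (i := (j, σ)) (j := (j, σ')) (by simpa using hσ)).preimage (Prod.mk j)
    · intro j
      have hpre : {ω | ∀ σ, {i | Z j i ω ∈ D j σ}.encard = n (j, σ)} =
          (fun ω i => Z j i ω) ⁻¹' ⋂ σ, {z : ℕ → F |
            ∑' i, (D j σ).indicator (1 : F → ℝ≥0∞) (z i) = n (j, σ)} := by
        ext ω
        simp only [Set.mem_ofPred_eq, Set.mem_iInter, Set.mem_preimage,
          tsum_indicator_one_eq_encard]
        refine forall_congr' fun σ => ?_
        rw [← ENat.toENNReal_coe, ENat.toENNReal_inj]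
      rw [hpre]
      have hm : Measurable[⨆ i, MeasurableSpace.comap (Z j i) inferInstance]
          fun ω i => Z j i ω :=
        @measurable_pi_lambda _ _ _ (_) _ _ fun i => (comap_measurable (Z j i)).mono
          (le_iSup (fun i => MeasurableSpace.comap (Z j i) inferInstance) i) le_rfl
      refine hm (MeasurableSet.iInter fun σ => ?_)
      have : Measurable fun z : ℕ → F => ∑' i, (D j σ).indicator (1 : F → ℝ≥0∞) (z i) :=
        Measurable.tsum fun i => (measurable_one.indicator (hDm j σ)).comp (measurable_pi_apply i)
      exact this (measurableSet_singleton _)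
  · ext e
    simp only [Finset.mem_filter, Finset.mem_univ, true_and, Set.mem_iUnion, exists_prop]
    constructor
    · intro he
      refine ⟨(e.1, fun i => decide (e ∈ B i)), by simpa using he, rfl, ⟨i, he⟩, by simp⟩
    · rintro ⟨c, hc, he⟩
      exact (he.2.2 i).2 hc

end Superposition

/-! ### Link distances -/

instance : Fintype Station := ⟨{.b, .u}, fun j => by cases j <;> simp⟩

instance : MeasurableSpace Station := ⊤

instance : DiscreteMeasurableSpace Station := ⟨fun _ => trivial⟩

instance : DiscreteMeasurableSpace Tier := ⟨fun _ => trivial⟩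

theorem Tier.sum_eq {M : Type*} [AddCommMonoid M] (f : Tier → M) :
    ∑ k, f k = f .b + (f .L + f .N) := by
  have : (Finset.univ : Finset Tier) = {.b, .L, .N} := rfl
  rw [this, Finset.sum_insert (by decide), Finset.sum_insert (by decide), Finset.sum_singleton]

namespace Network

variable (N : Network)

/-- Length of the link from a transmitter of kind `j` above the point `x` to the typical user. -/
noncomputable def linkLen (j : Station) (x : Plane) : ℝ := Real.sqrt (‖x‖ ^ 2 + N.H j ^ 2)

/-- Intensity of the link distances of the transmitters of kind `j`. -/
noncomputable def radialDensity (j : Station) (r : ℝ) : ℝ :=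
  if N.H j ≤ r then 2 * Real.pi * N.dens j * r else 0

/-- Intensity measure of the link distances of the transmitters of kind `j`. -/
noncomputable def radialMeasure (j : Station) : Measure ℝ :=
  volume.withDensity fun r => ENNReal.ofReal (N.radialDensity j r)

theorem measurable_linkLen (j : Station) : Measurable (N.linkLen j) := by
  unfold linkLen; fun_prop

theorem H_le_linkLen (j : Station) (x : Plane) : N.H j ≤ N.linkLen j x :=
  Real.le_sqrt_of_sq_le (by nlinarith [sq_nonneg ‖x‖])

@[fun_prop]
theorem measurable_radialDensity (j : Station) : Measurable (N.radialDensity j) :=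
  Measurable.ite measurableSet_Ici (by fun_prop) measurable_const

theorem radialDensity_nonneg (j : Station) (r : ℝ) : 0 ≤ N.radialDensity j r := by
  unfold radialDensity
  split_ifs with h
  · have := (N.H_pos j).trans_le h
    have := N.dens_pos j
    positivity
  · rfl

instance (j : Station) : SigmaFinite (N.radialMeasure j) :=
  SigmaFinite.withDensity_ofReal _

theorem radialMeasure_Iic (j : Station) (r : ℝ) :
    N.radialMeasure j (Set.Iic r) = ENNReal.ofReal
      (if N.H j ≤ r then Real.pi * N.dens j * (r ^ 2 - N.H j ^ 2) else 0) := by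
  have hset : ∀ x ∈ Set.Iic r, ENNReal.ofReal (N.radialDensity j x) =
      (Set.Icc (N.H j) r).indicator
        (fun x => ENNReal.ofReal (2 * Real.pi * N.dens j * x)) x := by
    intro x hx
    by_cases h : N.H j ≤ x
    · rw [radialDensity, if_pos h, Set.indicator_of_mem (show x ∈ Set.Icc (N.H j) r from ⟨h, hx⟩)]
    · rw [radialDensity, if_neg h, Set.indicator_of_notMem (fun hh => h hh.1),
        ENNReal.ofReal_zero]
  rw [radialMeasure, withDensity_apply _ measurableSet_Iic,
    setLIntegral_congr_fun measurableSet_Iic hset, lintegral_indicator measurableSet_Icc,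
    Measure.restrict_restrict measurableSet_Icc]
  have hinter : Set.Icc (N.H j) r ∩ Set.Iic r = Set.Icc (N.H j) r :=
    Set.inter_eq_left.2 fun x hx => hx.2
  rw [hinter]
  split_ifs with h
  · have hc : Continuous fun x : ℝ => 2 * Real.pi * N.dens j * x := by fun_prop
    rw [← ofReal_integral_eq_lintegral_ofReal (hc.integrableOn_Icc), integral_Icc_eq_integral_Ioc,
      ← intervalIntegral.integral_of_le h]
    · congr 1
      rw [intervalIntegral.integral_const_mul, integral_id]
      ring
    · refine (ae_restrict_iff' measurableSet_Icc).2 (ae_of_all _ fun x hx => ?_)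
      have := (N.H_pos j).trans_le hx.1
      have := N.dens_pos j
      simp only [Pi.zero_apply]
      positivity
  · rw [Set.Icc_eq_empty h]; simp

/-- A link is no longer than `r ≥ H` exactly when the horizontal position lies in the disc of radius
`√(r² - H²)`, whose area is `π (r² - H²)`. Half-lines of finite mass determine the measure. -/
theorem map_linkLen (j : Station) :
    ((ENNReal.ofReal (N.dens j) • volume : Measure Plane).map (N.linkLen j)) =
      N.radialMeasure j := by
  have hIic : ∀ r, ((ENNReal.ofReal (N.dens j) • volume : Measure Plane).map (N.linkLen j))
      (Set.Iic r) = N.radialMeasure j (Set.Iic r) := by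
    intro r
    rw [radialMeasure_Iic, Measure.map_apply (N.measurable_linkLen j) measurableSet_Iic]
    have hH := N.H_pos j
    split_ifs with h
    · have hr : 0 ≤ r := hH.le.trans h
      have h1 : N.linkLen j ⁻¹' Set.Iic r =
          Metric.closedBall 0 (Real.sqrt (r ^ 2 - N.H j ^ 2)) := by
        ext x
        rw [Set.mem_preimage, Set.mem_Iic, linkLen, Real.sqrt_le_left hr, mem_closedBall_zero_iff,
          Real.le_sqrt (norm_nonneg x) (by nlinarith)]
        constructor <;> intro h <;> linarith
      have h2 : 0 ≤ r ^ 2 - N.H j ^ 2 := by nlinarith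
      rw [h1, Measure.smul_apply, EuclideanSpace.volume_closedBall_fin_two, smul_eq_mul,
        ← ENNReal.ofReal_pow (Real.sqrt_nonneg _), Real.sq_sqrt h2,
        ← ENNReal.ofReal_mul h2, ← ENNReal.ofReal_mul (N.dens_pos j).le]
      congr 1
      ring
    · have h1 : N.linkLen j ⁻¹' Set.Iic r = ∅ := by
        ext x
        simp only [Set.mem_preimage, Set.mem_Iic, Set.mem_empty_iff_false, iff_false, not_le]
        exact (not_le.1 h).trans_le (N.H_le_linkLen j x)
      simp [h1]
  refine Measure.FiniteSpanningSetsIn.ext (C := Set.range Set.Iic)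
    (borel_eq_generateFrom_Iic ℝ ▸ BorelSpace.measurable_eq) isPiSystem_Iic
    ⟨fun n => Set.Iic (n : ℝ), fun n => ⟨_, rfl⟩, fun n => ?_, ?_⟩ ?_
  · rw [hIic, radialMeasure_Iic]; exact ENNReal.ofReal_lt_top
  · exact Set.iUnion_eq_univ_iff.2 fun x => exists_nat_ge x
  · rintro _ ⟨r, rfl⟩
    exact hIic r

theorem pL_pos (r : ℝ) : 0 < N.pL r := by
  have := N.μa_pos
  unfold pL; positivity

theorem pL_le_one (r : ℝ) : N.pL r ≤ 1 := by
  have := N.μa_pos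
  unfold pL
  rw [div_le_one (by positivity)]
  have := Real.exp_pos (-(N.μb * (180 / Real.pi * Real.arcsin (N.H .u / r) - N.μa)))
  nlinarith

@[fun_prop]
theorem measurable_pL : Measurable N.pL := by
  have := Real.continuous_arcsin.measurable
  unfold pL; fun_prop

/-- Probability that the link from a transmitter of kind `j` at distance `r` has condition `k`. -/
noncomputable def tierProb (j : Station) (k : Tier) (r : ℝ) : ℝ :=
  match j, k with
  | .b, .b => 1
  | .u, .L => N.pL r
  | .u, .N => 1 - N.pL r
  | _, _ => 0

@[fun_prop]
theorem measurable_tierProb (j : Station) (k : Tier) : Measurable (N.tierProb j k) := by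
  cases j <;> cases k <;> unfold tierProb <;> fun_prop

theorem tierProb_nonneg (j : Station) (k : Tier) (r : ℝ) : 0 ≤ N.tierProb j k r := by
  have h1 := N.pL_pos r
  have h2 := N.pL_le_one r
  cases j <;> cases k <;> simp [tierProb] <;> linarith

theorem sum_tierProb (j : Station) (r : ℝ) : ∑ k, N.tierProb j k r = 1 := by
  cases j <;> simp [Tier.sum_eq, tierProb]

theorem lamBar_eq (k : Tier) (r : ℝ) :
    N.lamBar k r = N.radialDensity k.station r * N.tierProb k.station k r := by
  by_cases h : N.H k.station ≤ r <;> cases k <;> simp only [Tier.station] at h <;>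
    simp [lamBar, radialDensity, tierProb, Tier.station, h]

theorem tierProb_eq_zero {j : Station} {k : Tier} (h : j ≠ k.station) (r : ℝ) :
    N.tierProb j k r = 0 := by
  cases j <;> cases k <;> simp_all [tierProb, Tier.station]

theorem lamBar_nonneg (k : Tier) (r : ℝ) : 0 ≤ N.lamBar k r := by
  rw [lamBar_eq]
  exact mul_nonneg (N.radialDensity_nonneg _ _) (N.tierProb_nonneg _ _ _)

@[fun_prop]
theorem measurable_lamBar (k : Tier) : Measurable (N.lamBar k) := by
  have : N.lamBar k = fun r => N.radialDensity k.station r * N.tierProb k.station k r :=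
    funext fun r => N.lamBar_eq k r
  rw [this]; fun_prop

open Classical in
/-- Condition of the link from a transmitter of kind `j` at distance `r` with mark `u`. -/
noncomputable def tierOf (j : Station) (r u : ℝ) : Tier :=
  match j with
  | .b => .b
  | .u => if u ≤ N.pL r then .L else .N

theorem tierOf_station (j : Station) (r u : ℝ) : (N.tierOf j r u).station = j := by
  cases j
  · rfl
  · unfold tierOf; simp only; split_ifs <;> rfl

theorem measurable_tierOf (j : Station) : Measurable fun p : ℝ × ℝ => N.tierOf j p.1 p.2 := by
  cases j
  · exact measurable_const
  · unfold tierOf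
    exact Measurable.ite (measurableSet_le measurable_snd (N.measurable_pL.comp measurable_fst))
      measurable_const measurable_const

theorem lintegral_tierOf (j : Station) (k : Tier) (r : ℝ) :
    (volume.restrict (Set.Icc (0 : ℝ) 1)) {u | N.tierOf j r u = k} =
      ENNReal.ofReal (N.tierProb j k r) := by
  have h1 := N.pL_pos r
  have h2 := N.pL_le_one r
  have hm : MeasurableSet {u | N.tierOf j r u = k} :=
    ((N.measurable_tierOf j).comp measurable_prodMk_left) (MeasurableSet.of_discrete (s := {k}))
  rw [Measure.restrict_apply hm]
  cases j
  · cases k <;> simp [tierOf, tierProb]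
  · cases k
    · have : {u | N.tierOf .u r u = .b} = ∅ := by
        ext u; simp only [tierOf, Set.mem_ofPred_eq]; split_ifs <;> simp
      simp [this, tierProb]
    · have : {u | N.tierOf .u r u = .L} ∩ Set.Icc 0 1 = Set.Icc 0 (N.pL r) := by
        ext u
        simp only [tierOf, Set.mem_ofPred_eq, Set.mem_inter_iff, Set.mem_Icc]
        split_ifs with h
        · simp only [true_and]; constructor <;> rintro ⟨a, b⟩ <;> constructor <;> linarith
        · simp [h]
      rw [this]; simp [tierProb]
    · have : {u | N.tierOf .u r u = .N} ∩ Set.Icc 0 1 = Set.Ioc (N.pL r) 1 := by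
        ext u
        simp only [tierOf, Set.mem_ofPred_eq, Set.mem_inter_iff, Set.mem_Icc, Set.mem_Ioc]
        split_ifs with h
        · simp [h]
        · simp only [true_and]; constructor <;> rintro ⟨a, b⟩ <;> constructor <;> linarith
      rw [this]; simp [tierProb]

end Network

/-! ### Independence of marks -/

/-- Expectations of products of functions of disjoint groups of independent sources. -/
theorem ProbabilityTheory.iIndep.lintegral_prod {Ω ι κ : Type*} {mΩ : MeasurableSpace Ω}
    {P : Measure Ω} [IsProbabilityMeasure P]
    {m : ι → MeasurableSpace Ω} (hm : ∀ i, m i ≤ mΩ) (h : iIndep m P) {S : κ → Set ι}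
    (hS : Pairwise fun a b => Disjoint (S a) (S b)) {f : κ → Ω → ℝ≥0∞}
    (hf : ∀ k, Measurable[⨆ i ∈ S k, m i] (f k)) (s : Finset κ) :
    ∫⁻ ω, ∏ k ∈ s, f k ω ∂P = ∏ k ∈ s, ∫⁻ ω, f k ω ∂P := by
  classical
  induction s using Finset.induction_on with
  | empty => simp
  | insert a s ha ih =>
    simp_rw [Finset.prod_insert ha]
    rw [← ih]
    have hdisj : Disjoint (S a) (⋃ k ∈ s, S k) :=
      Set.disjoint_iUnion₂_right.2 fun k hk => hS fun hak => ha (hak ▸ hk)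
    refine lintegral_mul_eq_lintegral_mul_lintegral_of_independent_measurableSpace
      (iSup₂_le fun i _ => hm i) (iSup₂_le fun i _ => hm i)
      (indep_iSup_of_disjoint hm h hdisj) (hf a) ?_
    refine Finset.measurable_fun_prod s fun k hk => (hf k).mono ?_ le_rfl
    exact biSup_mono fun i hi => Set.mem_iUnion₂.2 ⟨k, hk, hi⟩

theorem ProbabilityTheory.IndepFun.lintegral_comp {Ω α β : Type*} [MeasurableSpace Ω]
    [MeasurableSpace α] [MeasurableSpace β] {P : Measure Ω} [IsProbabilityMeasure P] {R : Ω → α}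
    {V : Ω → β} (h : IndepFun R V P) (hR : Measurable R) (hV : Measurable V) {F : α → β → ℝ≥0∞}
    (hF : Measurable (Function.uncurry F)) :
    ∫⁻ ω, F (R ω) (V ω) ∂P = ∫⁻ ω, ∫⁻ ω', F (R ω) (V ω') ∂P ∂P := by
  have h1 := h.map_prod_eq_prod_map_map hR.aemeasurable hV.aemeasurable
  have : IsProbabilityMeasure (P.map V) := Measure.isProbabilityMeasure_map hV.aemeasurable
  have h2 : ∫⁻ ω, F (R ω) (V ω) ∂P =
      ∫⁻ p, Function.uncurry F p ∂(P.map fun ω => (R ω, V ω)) :=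
    (lintegral_map hF (hR.prodMk hV)).symm
  rw [h2, h1, lintegral_prod _ hF.aemeasurable, lintegral_map hF.lintegral_prod_right' hR]
  refine lintegral_congr fun ω => ?_
  exact lintegral_map (hF.comp measurable_prodMk_left) hV

instance (N : Network) (k : Tier) : IsProbabilityMeasure (gammaMeasure (N.M k) (N.M k)) :=
  isProbabilityMeasure_gammaMeasure (by exact_mod_cast N.M_pos k) (by exact_mod_cast N.M_pos k)

/-- Mean of a function of condition and fading gain of a link from a transmitter of kind `j` at
distance `r`. -/
noncomputable def Network.tierMean (N : Network) (j : Station) (r : ℝ) (g : Tier → ℝ → ℝ≥0∞) :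
    ℝ≥0∞ :=
  ∑ ℓ, ENNReal.ofReal (N.tierProb j ℓ r) * ∫⁻ h, g ℓ h ∂(gammaMeasure (N.M ℓ) (N.M ℓ))

namespace Realization

variable {N : Network} {Ω : Type*} [MeasurableSpace Ω] {P : Measure Ω} (W : Realization N P)

theorem sourceSigma_le (s : Source) : sourceSigma W.X W.U W.fade s ≤ ‹MeasurableSpace Ω› := by
  cases s with
  | points j => exact iSup_le fun i => ((W.poisson j).measurable i).comap_le
  | mark i => exact (W.mark_measurable i).comap_le
  | fading k i => exact (W.fade_measurable k i).comap_le

theorem measurable_linkDist (x : Transmitter) : Measurable (W.linkDist x) :=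
  (N.measurable_linkLen x.1).comp ((W.poisson x.1).measurable x.2)

theorem linkDist_pos (x : Transmitter) (ω : Ω) : 0 < W.linkDist x ω :=
  (N.H_pos x.1).trans_le (N.H_le_linkLen x.1 (W.X x.1 x.2 ω))

theorem tier_eq (x : Transmitter) (ω : Ω) :
    W.tier x ω = N.tierOf x.1 (W.linkDist x ω) (W.U x.2 ω) := by
  obtain ⟨_ | _, i⟩ := x <;> rfl

theorem tier_station (x : Transmitter) (ω : Ω) : (W.tier x ω).station = x.1 := by
  rw [tier_eq, N.tierOf_station]

/-- The link distances form a Poisson process. -/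
theorem isPoisson_linkDist [IsProbabilityMeasure P] :
    PoissonProcess P (sumIntensity N.radialMeasure) fun x ω => (x.1, W.linkDist x ω) := by
  have hZ : ∀ j, IsPoissonPointProcess P (N.radialMeasure j)
      fun i ω => N.linkLen j (W.X j i ω) := fun j =>
    N.map_linkLen j ▸ (W.poisson j).map (N.measurable_linkLen j)
  refine PoissonProcess.of_iIndep hZ ?_
  refine iIndep_of_iIndep_of_le (W.independent.precomp (g := Source.points)
    fun _ _ h => by cases h; rfl) fun j => iSup_le fun i => ?_
  refine le_trans ?_ (le_iSup (fun i => MeasurableSpace.comap (W.X j i) inferInstance) i)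
  rintro _ ⟨s, hs, rfl⟩
  exact ⟨N.linkLen j ⁻¹' s, N.measurable_linkLen j hs, rfl⟩

/-- The sources of randomness of condition and fading gain of a transmitter, given its position. -/
def markSources (x : Transmitter) : Set Source
  | .points _ => False
  | .mark i => x.1 = .u ∧ i = x.2
  | .fading k i => k.station = x.1 ∧ i = x.2

/-- Fading gains are indexed by condition and number only. A base station and a UAV with the same
number are told apart by the kind of transmitter that the condition determines. -/
theorem disjoint_markSources :
    Pairwise fun x y => Disjoint (markSources x) (markSources y) := by
  intro x y hxy
  refine Set.disjoint_left.2 fun s hx hy => hxy ?_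
  cases s with
  | points j => exact hx.elim
  | mark i => exact Prod.ext (hx.1.trans hy.1.symm) (hx.2.symm.trans hy.2)
  | fading k i => exact Prod.ext (hx.1.symm.trans hy.1) (hx.2.symm.trans hy.2)

/-- Uniform mark and fading gains of a transmitter. -/
def markOf (x : Transmitter) (ω : Ω) : ℝ × (Tier → ℝ) :=
  (if x.1 = .u then W.U x.2 ω else 0, fun ℓ => if ℓ.station = x.1 then W.fade ℓ x.2 ω else 0)

theorem measurable_markOf_iSup (x : Transmitter) :
    Measurable[⨆ s ∈ markSources x, sourceSigma W.X W.U W.fade s] (W.markOf x) := by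
  have h1 : ∀ s ∈ markSources x, sourceSigma W.X W.U W.fade s ≤
      ⨆ s ∈ markSources x, sourceSigma W.X W.U W.fade s := fun s hs =>
    le_iSup₂ (f := fun s (_ : s ∈ markSources x) => sourceSigma W.X W.U W.fade s) s hs
  refine @Measurable.prodMk _ _ _ _ _ (_) _ _ ?_ (@measurable_pi_lambda _ _ _ (_) _ _ fun ℓ => ?_)
  · split_ifs with h
    · exact (comap_measurable (W.U x.2)).mono (h1 (.mark x.2) ⟨h, rfl⟩) le_rfl
    · exact @measurable_const _ _ _ (_) _
  · split_ifs with h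
    · exact (comap_measurable (W.fade ℓ x.2)).mono (h1 (.fading ℓ x.2) ⟨h, rfl⟩) le_rfl
    · exact @measurable_const _ _ _ (_) _

theorem measurable_markOf (x : Transmitter) : Measurable (W.markOf x) :=
  (W.measurable_markOf_iSup x).mono (iSup₂_le fun s _ => W.sourceSigma_le s) le_rfl

theorem tierOf_markOf (x : Transmitter) (r : ℝ) (ω : Ω) :
    N.tierOf x.1 r (W.markOf x ω).1 = N.tierOf x.1 r (W.U x.2 ω) := by
  obtain ⟨_ | _, i⟩ := x <;> rfl

theorem markOf_snd (x : Transmitter) (ω : Ω) {ℓ : Tier} (h : ℓ.station = x.1) :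
    (W.markOf x ω).2 ℓ = W.fade ℓ x.2 ω := if_pos h

/-- The positions are independent of the marks. -/
theorem indepFun_linkDist_markOf :
    IndepFun (fun ω x => W.linkDist x ω) (fun ω x => W.markOf x ω) P := by
  have hle := W.sourceSigma_le
  have hd : Disjoint (Set.range Source.points) (Set.range Source.points)ᶜ := disjoint_compl_right
  refine indep_of_indep_of_le_left (indep_of_indep_of_le_right
    (indep_iSup_of_disjoint hle W.independent hd) ?_) ?_
  · refine Measurable.comap_le (@measurable_pi_lambda _ _ _ (_) _ _ fun x =>
      (W.measurable_markOf_iSup x).mono (biSup_mono fun s hs => ?_) le_rfl)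
    rintro ⟨j, rfl⟩
    exact hs
  · refine Measurable.comap_le (@measurable_pi_lambda _ _ _ (_) _ _ fun x => ?_)
    refine (N.measurable_linkLen x.1).comp ?_
    refine (comap_measurable (W.X x.1 x.2)).mono ?_ le_rfl
    refine le_trans (le_iSup (fun i => MeasurableSpace.comap (W.X x.1 i) inferInstance) x.2) ?_
    exact le_iSup₂ (f := fun s (_ : s ∈ Set.range Source.points) =>
      sourceSigma W.X W.U W.fade s) (Source.points x.1) ⟨_, rfl⟩

/-- The mean of a function of condition and fading gain of a transmitter at a fixed distance. -/
theorem lintegral_markOf [IsProbabilityMeasure P] (x : Transmitter) (r : ℝ)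
    {g : Tier → ℝ → ℝ≥0∞} (hg : ∀ ℓ, Measurable (g ℓ)) :
    ∫⁻ ω, g (N.tierOf x.1 r (W.markOf x ω).1)
      ((W.markOf x ω).2 (N.tierOf x.1 r (W.markOf x ω).1)) ∂P = N.tierMean x.1 r g := by
  classical
  have hpt : ∀ ω, g (N.tierOf x.1 r (W.markOf x ω).1)
      ((W.markOf x ω).2 (N.tierOf x.1 r (W.markOf x ω).1)) =
      ∑ ℓ, {u | N.tierOf x.1 r u = ℓ}.indicator 1 (W.U x.2 ω) * g ℓ (W.fade ℓ x.2 ω) := by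
    intro ω
    rw [tierOf_markOf, markOf_snd _ _ _ (N.tierOf_station _ _ _), Finset.sum_eq_single
      (N.tierOf x.1 r (W.U x.2 ω))]
    · simp
    · intro ℓ _ hℓ
      simp [Set.indicator, Ne.symm hℓ]
    · simp
  have hm : ∀ ℓ, MeasurableSet {u | N.tierOf x.1 r u = ℓ} := fun ℓ =>
    ((N.measurable_tierOf x.1).comp measurable_prodMk_left) (MeasurableSet.of_discrete (s := {ℓ}))
  have hterm : ∀ ℓ ∈ Finset.univ, Measurable fun ω =>
      {u | N.tierOf x.1 r u = ℓ}.indicator (1 : ℝ → ℝ≥0∞) (W.U x.2 ω) *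
        g ℓ (W.fade ℓ x.2 ω) := fun ℓ _ =>
    ((measurable_one.indicator (hm ℓ)).comp (W.mark_measurable x.2)).mul
      ((hg ℓ).comp (W.fade_measurable ℓ x.2))
  simp_rw [hpt]
  rw [lintegral_finsetSum _ hterm]
  refine Finset.sum_congr rfl fun ℓ _ => ?_
  have hind : Indep (MeasurableSpace.comap (W.U x.2) inferInstance)
      (MeasurableSpace.comap (W.fade ℓ x.2) inferInstance) P :=
    W.independent.indep (i := Source.mark x.2) (j := Source.fading ℓ x.2) (by simp)
  have hmul := lintegral_mul_eq_lintegral_mul_lintegral_of_independent_measurableSpace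
    (W.mark_measurable x.2).comap_le (W.fade_measurable ℓ x.2).comap_le hind
    (f := fun ω => {u | N.tierOf x.1 r u = ℓ}.indicator 1 (W.U x.2 ω))
    (g := fun ω => g ℓ (W.fade ℓ x.2 ω))
    ((measurable_one.indicator (hm ℓ)).comp (comap_measurable _))
    ((hg ℓ).comp (comap_measurable _))
  rw [hmul]
  congr 1
  · rw [← N.lintegral_tierOf, ← W.mark_law x.2,
      Measure.map_apply (W.mark_measurable x.2) (hm ℓ),
      ← lintegral_indicator_one (W.mark_measurable x.2 (hm ℓ))]
    rfl
  · rw [← W.fade_law ℓ x.2, lintegral_map (hg ℓ) (W.fade_measurable ℓ x.2)]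

end Realization

/-! ### Integrating out conditions and fading gains -/

theorem Measurable.apply_of_countable {α β γ : Type*} [Countable β] {mα : MeasurableSpace α}
    [MeasurableSpace β] [DiscreteMeasurableSpace β] [MeasurableSpace γ] {g : β → α → γ}
    (hg : ∀ b, Measurable (g b)) {T : α → β} (hT : Measurable T) :
    Measurable fun z => g (T z) z :=
  (measurable_from_prod_countable_right (f := fun p : β × α => g p.1 p.2) hg).comp
    (hT.prodMk measurable_id)

namespace Network

variable (N : Network)

theorem measurable_tierMean (j : Station) {α : Type*} [MeasurableSpace α] {r : α → ℝ}
    (hr : Measurable r) {g : Tier → α → ℝ → ℝ≥0∞}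
    (hg : ∀ ℓ, Measurable fun p : α × ℝ => g ℓ p.1 p.2) :
    Measurable fun y => N.tierMean j (r y) fun ℓ => g ℓ y := by
  unfold tierMean
  refine Finset.measurable_fun_sum _ fun ℓ _ => Measurable.mul ?_ ?_
  · exact ((N.measurable_tierProb j ℓ).comp hr).ennreal_ofReal
  · exact (hg ℓ).lintegral_prod_right'

theorem lintegral_radialMeasure (j : Station) {f : ℝ → ℝ≥0∞} (hf : Measurable f) :
    ∫⁻ r, f r ∂(N.radialMeasure j) = ∫⁻ r, ENNReal.ofReal (N.radialDensity j r) * f r :=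
  lintegral_withDensity_eq_lintegral_mul _ (by fun_prop) hf

theorem sum_ofReal_tierProb (j : Station) (r : ℝ) :
    ∑ ℓ, ENNReal.ofReal (N.tierProb j ℓ r) = 1 := by
  rw [← ENNReal.ofReal_sum_of_nonneg fun ℓ _ => N.tierProb_nonneg j ℓ r, N.sum_tierProb,
    ENNReal.ofReal_one]

theorem tierMean_le_one (j : Station) (r : ℝ) {g : Tier → ℝ → ℝ≥0∞} (hg : ∀ ℓ h, g ℓ h ≤ 1) :
    N.tierMean j r g ≤ 1 := by
  rw [← N.sum_ofReal_tierProb j r]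
  refine Finset.sum_le_sum fun ℓ _ => mul_le_of_le_one_right' ?_
  exact (lintegral_mono (hg ℓ)).trans (by simp)

theorem one_sub_tierMean (j : Station) (r : ℝ) {g : Tier → ℝ → ℝ≥0∞} (hg : ∀ ℓ h, g ℓ h ≤ 1) :
    1 - N.tierMean j r g = ∑ ℓ, ENNReal.ofReal (N.tierProb j ℓ r) *
      (1 - ∫⁻ h, g ℓ h ∂(gammaMeasure (N.M ℓ) (N.M ℓ))) := by
  have hle : ∀ ℓ, ∫⁻ h, g ℓ h ∂(gammaMeasure (N.M ℓ) (N.M ℓ)) ≤ 1 := fun ℓ =>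
    (lintegral_mono (hg ℓ)).trans (by simp)
  refine (ENNReal.eq_sub_of_add_eq
    ((N.tierMean_le_one j r hg).trans_lt ENNReal.one_lt_top).ne ?_).symm
  rw [tierMean, ← Finset.sum_add_distrib]
  refine Eq.trans ?_ (N.sum_ofReal_tierProb j r)
  refine Finset.sum_congr rfl fun ℓ _ => ?_
  rw [← mul_add, tsub_add_cancel_of_le (hle ℓ), mul_one]

end Network

namespace Realization

variable {N : Network} {Ω : Type*} [MeasurableSpace Ω] {P : Measure Ω} (W : Realization N P)

/-- Integrating out the conditions and fading gains, given the distances. -/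
theorem lintegral_marked [IsProbabilityMeasure P] (k : Tier) (x : Transmitter) {a : ℝ → ℝ≥0∞}
    (ha : Measurable a) {w : ℝ → Tier → ℝ → ℝ → ℝ≥0∞}
    (hw : ∀ ℓ, Measurable fun p : ℝ × ℝ × ℝ => w p.1 ℓ p.2.1 p.2.2) :
    ∫⁻ ω, (if W.tier x ω = k then a (W.linkDist x ω) else 0) *
      eexpNeg (∑' x', if x' = x then 0 else
        w (W.linkDist x ω) (W.tier x' ω) (W.linkDist x' ω) (W.fadingGain x' ω)) ∂P =
    ∫⁻ ω, ENNReal.ofReal (N.tierProb x.1 k (W.linkDist x ω)) * a (W.linkDist x ω) *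
      eexpNeg (∑' x', if x' = x then 0 else negLog (N.tierMean x'.1 (W.linkDist x' ω)
        fun ℓ h => eexpNeg (w (W.linkDist x ω) ℓ (W.linkDist x' ω) h))) ∂P := by
  classical
  have hR : Measurable fun ω x => W.linkDist x ω := measurable_pi_lambda _ W.measurable_linkDist
  have hV : Measurable fun ω x => W.markOf x ω := measurable_pi_lambda _ W.measurable_markOf
  let F : (Transmitter → ℝ) → (Transmitter → ℝ × (Tier → ℝ)) → ℝ≥0∞ := fun ρ v =>
    (if N.tierOf x.1 (ρ x) (v x).1 = k then a (ρ x) else 0) *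
      eexpNeg (∑' x', if x' = x then 0 else
        w (ρ x) (N.tierOf x'.1 (ρ x') (v x').1) (ρ x')
          ((v x').2 (N.tierOf x'.1 (ρ x') (v x').1)))
  have hT : ∀ x' : Transmitter, Measurable
      fun p : (Transmitter → ℝ) × (Transmitter → ℝ × (Tier → ℝ)) =>
        N.tierOf x'.1 (p.1 x') (p.2 x').1 := fun x' =>
    (N.measurable_tierOf x'.1).comp
      (f := fun p : (Transmitter → ℝ) × (Transmitter → ℝ × (Tier → ℝ)) => (p.1 x', (p.2 x').1))
      (by fun_prop)
  have hF : Measurable (Function.uncurry F) := by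
    refine Measurable.mul (Measurable.ite (hT x (MeasurableSet.of_discrete (s := {k})))
      (by fun_prop) measurable_const) (measurable_eexpNeg.comp (Measurable.tsum fun x' => ?_))
    refine Measurable.ite (MeasurableSet.const _) measurable_const ?_
    exact Measurable.apply_of_countable (g := fun ℓ
      (p : (Transmitter → ℝ) × (Transmitter → ℝ × (Tier → ℝ))) =>
      w (p.1 x) ℓ (p.1 x') ((p.2 x').2 ℓ)) (fun ℓ => (hw ℓ).comp (f := fun
        (p : (Transmitter → ℝ) × (Transmitter → ℝ × (Tier → ℝ))) =>
        (p.1 x, p.1 x', (p.2 x').2 ℓ)) (by fun_prop)) (hT x')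
  have hpt : ∀ ω, (if W.tier x ω = k then a (W.linkDist x ω) else 0) *
      eexpNeg (∑' x', if x' = x then 0 else
        w (W.linkDist x ω) (W.tier x' ω) (W.linkDist x' ω) (W.fadingGain x' ω)) =
      F (fun x => W.linkDist x ω) (fun x => W.markOf x ω) := by
    intro ω
    simp only [F, tierOf_markOf, fadingGain, tier_eq, markOf_snd _ _ _ (N.tierOf_station _ _ _)]
  -- Positions and marks are independent, so the distances can be frozen at `ω₀` while the marks are
  -- integrated.
  rw [lintegral_congr hpt, W.indepFun_linkDist_markOf.lintegral_comp hR hV hF]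
  refine lintegral_congr fun ω₀ => ?_
  set ρ : Transmitter → ℝ := fun x => W.linkDist x ω₀ with hρ
  -- The event that `x` itself has condition `k` is written as a weight, `0` if it occurs and `∞`
  -- otherwise. The integrand thus becomes one infinite product with an independent factor for each
  -- transmitter, including `x`.
  let g : Transmitter → Tier → ℝ → ℝ≥0∞ := fun x' ℓ h =>
    if x' = x then (if ℓ = k then 0 else ∞) else w (ρ x) ℓ (ρ x') h
  have hg : ∀ x' ℓ, Measurable (g x' ℓ) := fun x' ℓ =>
    Measurable.ite (MeasurableSet.const _) measurable_const
      ((hw ℓ).comp (f := fun h => (ρ x, ρ x', h)) (by fun_prop))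
  let z : Transmitter → ℝ × (Tier → ℝ) → ℝ≥0∞ := fun x' v =>
    g x' (N.tierOf x'.1 (ρ x') v.1) (v.2 (N.tierOf x'.1 (ρ x') v.1))
  have hz : ∀ x', Measurable (z x') := fun x' =>
    Measurable.apply_of_countable (g := fun ℓ (v : ℝ × (Tier → ℝ)) => g x' ℓ (v.2 ℓ))
      (fun ℓ => (hg x' ℓ).comp (by fun_prop))
      ((N.measurable_tierOf x'.1).comp (f := fun v : ℝ × (Tier → ℝ) => (ρ x', v.1))
        (by fun_prop))
  have hFz : ∀ ω, F ρ (fun x => W.markOf x ω) = a (ρ x) *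
      eexpNeg (∑' x', z x' (W.markOf x' ω)) := by
    intro ω
    rw [ENNReal.tsum_eq_add_tsum_ite x, eexpNeg_add, ← mul_assoc]
    refine congrArg₂ (· * ·) ?_ (congrArg eexpNeg ?_)
    · simp only [z, g, if_true]
      split_ifs <;> simp [eexpNeg_zero, eexpNeg_top]
    · refine tsum_congr fun x' => ?_
      by_cases h : x' = x
      · simp [h]
      · simp [h, z, g]
  have hzm : ∀ x', Measurable fun ω => z x' (W.markOf x' ω) := fun x' =>
    (hz x').comp (W.measurable_markOf x')
  have hmean : ∀ x', ∫⁻ ω, eexpNeg (z x' (W.markOf x' ω)) ∂P =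
      N.tierMean x'.1 (ρ x') fun ℓ h => eexpNeg (g x' ℓ h) := fun x' =>
    W.lintegral_markOf x' (ρ x') (g := fun ℓ h => eexpNeg (g x' ℓ h)) fun ℓ =>
      measurable_eexpNeg.comp (hg x' ℓ)
  have hmean_le : ∀ x', N.tierMean x'.1 (ρ x') (fun ℓ h => eexpNeg (g x' ℓ h)) ≤ 1 := fun x' =>
    N.tierMean_le_one _ _ fun _ _ => eexpNeg_le_one _
  have hzt : Measurable fun ω => eexpNeg (∑' x', z x' (W.markOf x' ω)) :=
    measurable_eexpNeg.comp (Measurable.tsum hzm)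
  simp_rw [hFz]
  rw [lintegral_const_mul _ hzt,
    lintegral_eexpNeg_tsum hzm fun s => W.independent.lintegral_prod W.sourceSigma_le
      disjoint_markSources (fun x' => (measurable_eexpNeg.comp (hz x')).comp
        (W.measurable_markOf_iSup x')) s]
  simp_rw [hmean]
  rw [ENNReal.tsum_eq_add_tsum_ite x, eexpNeg_add, eexpNeg_negLog (hmean_le x), ← mul_assoc]
  congr 1
  · rw [mul_comm]
    congr 1
    rw [Network.tierMean, Finset.sum_eq_single k]
    · simp [g, eexpNeg_zero, hρ]
    · intro ℓ _ hℓ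
      simp [g, hℓ, eexpNeg_top]
    · simp
  · congr 1
    refine tsum_congr fun x' => ?_
    by_cases h : x' = x
    · simp [h]
    · simp only [h, if_false, g, hρ]

/-- Sum over all transmitters of a functional of the distances, conditions and fading gains. -/
theorem tsum_lintegral_marked [IsProbabilityMeasure P] (k : Tier) {a : ℝ → ℝ≥0∞}
    (ha : Measurable a) {w : ℝ → Tier → ℝ → ℝ → ℝ≥0∞}
    (hw : ∀ ℓ, Measurable fun p : ℝ × ℝ × ℝ => w p.1 ℓ p.2.1 p.2.2) :
    ∑' x, ∫⁻ ω, (if W.tier x ω = k then a (W.linkDist x ω) else 0) *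
      eexpNeg (∑' x', if x' = x then 0 else
        w (W.linkDist x ω) (W.tier x' ω) (W.linkDist x' ω) (W.fadingGain x' ω)) ∂P =
    ∫⁻ r, ENNReal.ofReal (N.lamBar k r) * (a r * eexpNeg (∑ ℓ, ∫⁻ r',
      ENNReal.ofReal (N.lamBar ℓ r') *
        (1 - ∫⁻ h, eexpNeg (w r ℓ r' h) ∂(gammaMeasure (N.M ℓ) (N.M ℓ))))) := by
  classical
  -- Expressed through `negLog`, the averaged factor of each transmitter is again an exponential
  -- weight, now on distances alone, so the Mecke-Laplace formula applies to the unmarked process.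
  let v : Station × ℝ → Station × ℝ → ℝ≥0∞ := fun y y' =>
    negLog (N.tierMean y'.1 y'.2 fun ℓ h => eexpNeg (w y.2 ℓ y'.2 h))
  have hwe : ∀ ℓ, Measurable fun p : (ℝ × ℝ) × ℝ => eexpNeg (w p.1.1 ℓ p.1.2 p.2) := fun ℓ =>
    measurable_eexpNeg.comp ((hw ℓ).comp (f := fun p : (ℝ × ℝ) × ℝ => (p.1.1, p.1.2, p.2))
      (by fun_prop))
  have hmean : ∀ j, Measurable fun p : ℝ × ℝ =>
      N.tierMean j p.2 fun ℓ h => eexpNeg (w p.1 ℓ p.2 h) := fun j =>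
    N.measurable_tierMean j measurable_snd (g := fun ℓ (p : ℝ × ℝ) h => eexpNeg (w p.1 ℓ p.2 h))
      hwe
  have hv : Measurable (Function.uncurry v) := by
    refine measurable_negLog.comp ?_
    exact Measurable.apply_of_countable (g := fun j (p : (Station × ℝ) × Station × ℝ) =>
      N.tierMean j p.2.2 fun ℓ h => eexpNeg (w p.1.2 ℓ p.2.2 h))
      (fun j => (hmean j).comp (f := fun p : (Station × ℝ) × Station × ℝ => (p.1.2, p.2.2))
        (by fun_prop)) (T := fun p => p.2.1) (by fun_prop)
  let f : Station × ℝ → ℝ≥0∞ := fun y => ENNReal.ofReal (N.tierProb y.1 k y.2) * a y.2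
  have hf : Measurable f :=
    Measurable.mul (Measurable.apply_of_countable (g := fun j (y : Station × ℝ) =>
      ENNReal.ofReal (N.tierProb j k y.2)) (fun j => by fun_prop) measurable_fst)
      (ha.comp measurable_snd)
  have h1 := W.isPoisson_linkDist.tsum_lintegral_eexpNeg hf hv
  have h2 : ∀ x, ∫⁻ ω, (if W.tier x ω = k then a (W.linkDist x ω) else 0) *
      eexpNeg (∑' x', if x' = x then 0 else
        w (W.linkDist x ω) (W.tier x' ω) (W.linkDist x' ω) (W.fadingGain x' ω)) ∂P =
      ∫⁻ ω, f (x.1, W.linkDist x ω) * eexpNeg (∑' x', if x' = x then 0 else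
        v (x.1, W.linkDist x ω) (x'.1, W.linkDist x' ω)) ∂P := fun x =>
    W.lintegral_marked k x ha hw
  have h3 : ∀ y : Station × ℝ, ∫⁻ y', 1 - eexpNeg (v y y') ∂(sumIntensity N.radialMeasure) =
      ∑ ℓ, ∫⁻ r', ENNReal.ofReal (N.lamBar ℓ r') *
        (1 - ∫⁻ h, eexpNeg (w y.2 ℓ r' h) ∂(gammaMeasure (N.M ℓ) (N.M ℓ))) := by
    intro y
    have hle : ∀ j r', N.tierMean j r' (fun ℓ h => eexpNeg (w y.2 ℓ r' h)) ≤ 1 := fun j r' =>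
      N.tierMean_le_one _ _ fun _ _ => eexpNeg_le_one _
    have hI : ∀ ℓ, Measurable fun r' =>
        1 - ∫⁻ h, eexpNeg (w y.2 ℓ r' h) ∂(gammaMeasure (N.M ℓ) (N.M ℓ)) := fun ℓ =>
      Measurable.const_sub ((hwe ℓ).lintegral_prod_right'.comp
        (f := fun r' : ℝ => (y.2, r')) (by fun_prop)) 1
    have hvy : Measurable fun y' => 1 - eexpNeg (v y y') :=
      Measurable.const_sub (measurable_eexpNeg.comp (hv.comp measurable_prodMk_left)) 1
    rw [lintegral_sumIntensity _ hvy]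
    have h4 : ∀ j, ∫⁻ r', 1 - eexpNeg (v y (j, r')) ∂(N.radialMeasure j) =
        ∑ ℓ, ∫⁻ r', ENNReal.ofReal (N.radialDensity j r') *
          (ENNReal.ofReal (N.tierProb j ℓ r') *
            (1 - ∫⁻ h, eexpNeg (w y.2 ℓ r' h) ∂(gammaMeasure (N.M ℓ) (N.M ℓ)))) := by
      intro j
      have hterm : ∀ ℓ ∈ Finset.univ, Measurable fun r' =>
          ENNReal.ofReal (N.radialDensity j r') * (ENNReal.ofReal (N.tierProb j ℓ r') *
            (1 - ∫⁻ h, eexpNeg (w y.2 ℓ r' h) ∂(gammaMeasure (N.M ℓ) (N.M ℓ)))) := fun ℓ _ =>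
        Measurable.mul (by fun_prop) (Measurable.mul (by fun_prop) (hI ℓ))
      have hvj : Measurable fun r' => 1 - eexpNeg (v y (j, r')) :=
        hvy.comp measurable_prodMk_left
      rw [N.lintegral_radialMeasure j hvj, ← lintegral_finsetSum _ hterm]
      refine lintegral_congr fun r' => ?_
      simp only [v, eexpNeg_negLog (hle j r')]
      rw [N.one_sub_tierMean _ _ fun _ _ => eexpNeg_le_one _, Finset.mul_sum]
    simp_rw [h4]
    -- Each condition occurs for only one kind of transmitter; radial density times probability of
    -- the condition is the thinned intensity `lamBar`.
    rw [Finset.sum_comm]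
    refine Finset.sum_congr rfl fun ℓ _ => ?_
    rw [Finset.sum_eq_single ℓ.station]
    · refine lintegral_congr fun r' => ?_
      rw [N.lamBar_eq, ENNReal.ofReal_mul (N.radialDensity_nonneg _ _), mul_assoc]
    · intro j _ hj
      simp [N.tierProb_eq_zero hj]
    · simp
  rw [tsum_congr h2]
  refine Eq.trans ?_ (h1.trans ?_)
  · refine tsum_congr fun x => lintegral_congr fun ω => ?_
    congr 2
    refine tsum_congr fun x' => ?_
    congr
  · simp_rw [h3]
    have hI : ∀ ℓ, Measurable fun p : ℝ × ℝ => ENNReal.ofReal (N.lamBar ℓ p.2) *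
        (1 - ∫⁻ h, eexpNeg (w p.1 ℓ p.2 h) ∂(gammaMeasure (N.M ℓ) (N.M ℓ))) := fun ℓ =>
      Measurable.mul (by fun_prop) (Measurable.const_sub (hwe ℓ).lintegral_prod_right' 1)
    have hE : Measurable fun r => eexpNeg (∑ ℓ, ∫⁻ r', ENNReal.ofReal (N.lamBar ℓ r') *
        (1 - ∫⁻ h, eexpNeg (w r ℓ r' h) ∂(gammaMeasure (N.M ℓ) (N.M ℓ)))) :=
      measurable_eexpNeg.comp (Finset.measurable_fun_sum _ fun ℓ _ =>
        (hI ℓ).lintegral_prod_right')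
    have hfE : Measurable fun y : Station × ℝ => f y * eexpNeg (∑ ℓ, ∫⁻ r',
        ENNReal.ofReal (N.lamBar ℓ r') *
        (1 - ∫⁻ h, eexpNeg (w y.2 ℓ r' h) ∂(gammaMeasure (N.M ℓ) (N.M ℓ)))) :=
      hf.mul (hE.comp measurable_snd)
    rw [lintegral_sumIntensity _ hfE, Finset.sum_eq_single k.station]
    · have hmeas : Measurable fun r => f (k.station, r) * eexpNeg (∑ ℓ, ∫⁻ r',
          ENNReal.ofReal (N.lamBar ℓ r') *
          (1 - ∫⁻ h, eexpNeg (w r ℓ r' h) ∂(gammaMeasure (N.M ℓ) (N.M ℓ)))) :=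
        (hf.comp measurable_prodMk_left).mul hE
      rw [N.lintegral_radialMeasure _ hmeas]
      refine lintegral_congr fun r => ?_
      simp only [f]
      rw [N.lamBar_eq, ENNReal.ofReal_mul (N.radialDensity_nonneg _ _)]
      ring
    · intro j _ hj
      simp [f, N.tierProb_eq_zero hj]
    · simp

end Realization

/-! ### Isotropic antennas -/

namespace Network

variable (N : Network)

/-- Product of power, maximum gain and intercept of a link condition. -/
noncomputable def coef (k : Tier) : ℝ := N.Pow k.station * N.GM k.station * N.κ k

/-- Average received power over a link of condition `k` and length `r` with isotropic antennas. -/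
noncomputable def power (k : Tier) (r : ℝ) : ℝ := N.coef k * r ^ (-N.α k)

theorem coef_pos (k : Tier) : 0 < N.coef k :=
  mul_pos (mul_pos (N.Pow_pos _) (N.GM_pos _)) (N.κ_pos _)

theorem power_pos (k : Tier) {r : ℝ} (hr : 0 < r) : 0 < N.power k r :=
  mul_pos (N.coef_pos k) (Real.rpow_pos_of_pos hr _)

@[fun_prop]
theorem measurable_power (k : Tier) : Measurable (N.power k) := by
  unfold power; fun_prop

theorem power_le_power_iff (k : Tier) {r y : ℝ} (hr : 0 < r) (hy : 0 < y) :
    N.power k r ≤ N.power k y ↔ y ≤ r := by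
  unfold power
  rw [mul_le_mul_iff_right₀ (N.coef_pos k), Real.rpow_le_rpow_iff_of_neg hr hy
    (neg_neg_of_pos (N.α_pos k))]

theorem tendsto_power_atTop (k : Tier) :
    Filter.Tendsto (N.power k) Filter.atTop (nhds 0) := by
  have := (tendsto_rpow_neg_atTop (N.α_pos k)).const_mul (N.coef k)
  rwa [mul_zero] at this

theorem η_eq (k ℓ : Tier) : N.η k ℓ = N.coef ℓ / N.coef k := rfl

theorem η_pos (k ℓ : Tier) : 0 < N.η k ℓ := div_pos (N.coef_pos ℓ) (N.coef_pos k)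

theorem χ_pos (k ℓ : Tier) {y : ℝ} (hy : 0 < y) : 0 < N.χ k ℓ y :=
  mul_pos (Real.rpow_pos_of_pos (N.η_pos k ℓ) _) (Real.rpow_pos_of_pos hy _)

theorem power_χ (k ℓ : Tier) {y : ℝ} (hy : 0 < y) : N.power ℓ (N.χ k ℓ y) = N.power k y := by
  have hη := N.η_pos k ℓ
  have hα := (N.α_pos ℓ).ne'
  have hk := (N.coef_pos k).ne'
  have hℓ := (N.coef_pos ℓ).ne'
  unfold power χ
  rw [Real.mul_rpow (Real.rpow_nonneg hη.le _) (Real.rpow_nonneg hy.le _), ← Real.rpow_mul hη.le,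
    ← Real.rpow_mul hy.le]
  have h1 : 1 / N.α ℓ * -N.α ℓ = -1 := by field_simp
  have h2 : N.α k / N.α ℓ * -N.α ℓ = -N.α k := by field_simp
  rw [h1, h2, Real.rpow_neg_one, η_eq]
  field_simp

theorem power_le_iff (k ℓ : Tier) {r y : ℝ} (hr : 0 < r) (hy : 0 < y) :
    N.power ℓ r ≤ N.power k y ↔ N.χ k ℓ y ≤ r := by
  rw [← N.power_χ k ℓ hy, N.power_le_power_iff ℓ hr (N.χ_pos k ℓ hy)]

theorem power_eq_iff (k ℓ : Tier) {r y : ℝ} (hr : 0 < r) (hy : 0 < y) :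
    N.power ℓ r = N.power k y ↔ r = N.χ k ℓ y := by
  rw [le_antisymm_iff, N.power_le_iff k ℓ hr hy, ← N.power_χ k ℓ hy,
    N.power_le_power_iff ℓ (N.χ_pos k ℓ hy) hr, and_comm, ← le_antisymm_iff]

variable {N}

/-- Isotropy is assumed only for angles in `[0, π]`, so it must be checked that every serving angle
lies there. -/
theorem IsIsotropic.l_eq (hiso : N.IsIsotropic) (s : Scenario) (k : Tier) (r : ℝ) :
    N.l s k r = N.power k r := by
  have h : N.gain k.station (N.servingAngle s k r) = N.GM k.station := by
    refine hiso _ _ ?_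
    unfold servingAngle
    split
    · exact ⟨le_rfl, Real.pi_pos.le⟩
    all_goals exact ⟨Real.arccos_nonneg _, Real.arccos_le_pi _⟩
  rw [l, h, power, coef]

end Network

namespace Realization

variable {N : Network} {Ω : Type*} [MeasurableSpace Ω] {P : Measure Ω} (W : Realization N P)

/-- Average power received from a transmitter with isotropic antennas. -/
noncomputable def rxPower (x : Transmitter) (ω : Ω) : ℝ := N.power (W.tier x ω) (W.linkDist x ω)

theorem rxPower_pos (x : Transmitter) (ω : Ω) : 0 < W.rxPower x ω :=
  N.power_pos _ (W.linkDist_pos x ω)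

theorem avgPower_eq (hiso : N.IsIsotropic) (s : Scenario) (x : Transmitter) (ω : Ω) :
    W.avgPower s x ω = W.rxPower x ω := hiso.l_eq s _ _

/-- The transmitter with the strongest average received power, with isotropic antennas. -/
noncomputable def strongest (ω : Ω) : Transmitter :=
  Classical.epsilon (h := ⟨(Station.b, 0)⟩) fun x => ∀ x', W.rxPower x' ω ≤ W.rxPower x ω

theorem serving_eq (hiso : N.IsIsotropic) (s : Scenario) (ω : Ω) :
    W.serving s ω = W.strongest ω := by
  simp only [serving, strongest, W.avgPower_eq hiso]

theorem interfererAngle_mem (s : Scenario) (x : Transmitter) (ω : Ω) :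
    W.interfererAngle s x ω ∈ Set.Icc 0 Real.pi := by
  unfold interfererAngle
  split
  · exact ⟨EuclideanGeometry.angle_nonneg _ _ _, EuclideanGeometry.angle_le_pi _ _ _⟩
  all_goals exact ⟨Real.arccos_nonneg _, Real.arccos_le_pi _⟩

/-- Noise plus interference with isotropic antennas. -/
noncomputable def noiseInterferenceIso (ω : Ω) : ℝ≥0∞ :=
  ENNReal.ofReal N.N₀ + ∑' x, if x = W.strongest ω then 0 else
    ENNReal.ofReal (W.rxPower x ω * W.fadingGain x ω)

/-- Each transmitter has exactly one condition, so the sum over conditions collapses to one sum over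
transmitters. The orientation of the interferers enters only through the gain, which is constant. -/
theorem noiseInterference_eq (hiso : N.IsIsotropic) (s : Scenario) (ω : Ω) :
    W.noiseInterference s ω = W.noiseInterferenceIso ω := by
  classical
  unfold noiseInterference noiseInterferenceIso interference
  congr 1
  rw [← Summable.tsum_finsetSum fun _ _ => ENNReal.summable]
  refine tsum_congr fun x => ?_
  rw [W.serving_eq hiso]
  by_cases hx : x = W.strongest ω
  · simp [hx]
  · rw [if_neg hx, Finset.sum_eq_single (W.tier x ω)]
    · rw [if_pos ⟨hx, rfl⟩, hiso _ _ (W.interfererAngle_mem s x ω)]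
      congr 1
      unfold rxPower Network.power Network.coef
      rw [W.tier_station]
      ring
    · intro ℓ _ hℓ
      rw [if_neg fun h => hℓ h.2.symm]
    · simp

theorem SINR_eq (hiso : N.IsIsotropic) (s : Scenario) (ω : Ω) :
    W.SINR s ω = ENNReal.ofReal
      (W.rxPower (W.strongest ω) ω * W.fadingGain (W.strongest ω) ω) /
        W.noiseInterferenceIso ω := by
  rw [SINR, W.noiseInterference_eq hiso, W.serving_eq hiso, W.avgPower_eq hiso]

theorem surrogate_eq (hiso : N.IsIsotropic) (s : Scenario) (γ : ℝ) (ω : Ω) :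
    W.surrogate s γ ω = 1 - (1 - expNeg
      (ENNReal.ofReal (γ * N.φ (W.tier (W.strongest ω) ω) / W.rxPower (W.strongest ω) ω) *
        W.noiseInterferenceIso ω)) ^ N.M (W.tier (W.strongest ω) ω) := by
  rw [surrogate, W.noiseInterference_eq hiso, W.serving_eq hiso, W.avgPower_eq hiso]

theorem moment_eq (hiso : N.IsIsotropic) (s s' : Scenario) (b : ℕ) (γ : ℝ) :
    W.moment s b γ = W.moment s' b γ := by
  have h : W.SINR s = W.SINR s' := funext fun ω => by rw [W.SINR_eq hiso, W.SINR_eq hiso]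
  rw [moment, moment, condSuccess, condSuccess, h]

/-! ### The strongest transmitter -/

theorem measurable_tier (x : Transmitter) : Measurable (W.tier x) := by
  have h : W.tier x = fun ω => N.tierOf x.1 (W.linkDist x ω) (W.U x.2 ω) :=
    funext fun ω => W.tier_eq x ω
  rw [h]
  exact (N.measurable_tierOf x.1).comp
    ((W.measurable_linkDist x).prodMk (W.mark_measurable x.2))

theorem measurable_rxPower (x : Transmitter) : Measurable (W.rxPower x) :=
  Measurable.apply_of_countable (g := fun k ω => N.power k (W.linkDist x ω))
    (fun k => (N.measurable_power k).comp (W.measurable_linkDist x)) (W.measurable_tier x)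

theorem measurable_fadingGain (x : Transmitter) : Measurable (W.fadingGain x) :=
  Measurable.apply_of_countable (g := fun k ω => W.fade k x.2 ω)
    (fun k => W.fade_measurable k x.2) (W.measurable_tier x)

/-- Almost surely, no two transmitters have the same average received power. -/
theorem ae_injective_rxPower [IsProbabilityMeasure P] :
    ∀ᵐ ω ∂P, ∀ x x', x' ≠ x → W.rxPower x' ω ≠ W.rxPower x ω := by
  -- The distances are required to be positive because the power laws can be inverted only there.
  -- For a fixed distance, equality of powers leaves at most the finitely many values `χ k ℓ`, a
  -- null set for the intensity.
  let R : Set ((Station × ℝ) × (Station × ℝ)) :=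
    {p | 0 < p.1.2 ∧ 0 < p.2.2 ∧ ∃ k ℓ, N.power ℓ p.2.2 = N.power k p.1.2}
  have hR : MeasurableSet R := by
    have h1 : Measurable fun p : (Station × ℝ) × (Station × ℝ) => p.1.2 := by fun_prop
    have h2 : Measurable fun p : (Station × ℝ) × (Station × ℝ) => p.2.2 := by fun_prop
    have h3 : {p : (Station × ℝ) × (Station × ℝ) | ∃ k ℓ, N.power ℓ p.2.2 = N.power k p.1.2} =
        ⋃ k, ⋃ ℓ, {p | N.power ℓ p.2.2 = N.power k p.1.2} := by ext; simp
    refine (measurableSet_lt measurable_const h1).inter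
      ((measurableSet_lt measurable_const h2).inter ?_)
    change MeasurableSet
      {p : (Station × ℝ) × (Station × ℝ) | ∃ k ℓ, N.power ℓ p.2.2 = N.power k p.1.2}
    rw [h3]
    refine MeasurableSet.iUnion fun k => MeasurableSet.iUnion fun ℓ => ?_
    exact measurableSet_eq_fun ((N.measurable_power ℓ).comp h2) ((N.measurable_power k).comp h1)
  have hR0 : ∀ y, sumIntensity N.radialMeasure {y' | (y, y') ∈ R} = 0 := by
    intro y
    have hRy : MeasurableSet {y' | (y, y') ∈ R} := measurable_prodMk_left hR
    rw [sumIntensity_apply _ hRy]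
    refine Finset.sum_eq_zero fun j _ => withDensity_absolutelyContinuous _ _ ?_
    refine Set.Finite.measure_zero (Set.Finite.subset (Set.finite_iUnion fun k : Tier =>
      Set.finite_iUnion fun ℓ : Tier => Set.finite_singleton (N.χ k ℓ y.2)) ?_) _
    rintro r ⟨h1, h2, k, ℓ, h3⟩
    exact Set.mem_iUnion₂.2 ⟨k, ℓ, (N.power_eq_iff k ℓ h2 h1).1 h3⟩
  filter_upwards [W.isPoisson_linkDist.ae_forall_ne hR hR0] with ω h x x' hx heq
  exact h x x' hx ⟨W.linkDist_pos x ω, W.linkDist_pos x' ω, _, _, heq⟩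

/-- Almost surely, there is a transmitter with the strongest average received power. -/
theorem ae_exists_rxPower_le [IsProbabilityMeasure P] :
    ∀ᵐ ω ∂P, ∃ x, ∀ x', W.rxPower x' ω ≤ W.rxPower x ω := by
  let A : ℕ → Set (Station × ℝ) := fun n => Set.univ ×ˢ Set.Iic (n : ℝ)
  have hA : ∀ n, MeasurableSet (A n) := fun n => MeasurableSet.univ.prod measurableSet_Iic
  have hA' : ∀ n, sumIntensity N.radialMeasure (A n) ≠ ∞ := by
    intro n
    rw [sumIntensity_apply _ (hA n)]
    refine (ENNReal.sum_lt_top.2 fun j _ => ?_).ne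
    have : {z : ℝ | (j, z) ∈ A n} = Set.Iic (n : ℝ) := by ext; simp [A]
    rw [this, N.radialMeasure_Iic]
    exact ENNReal.ofReal_lt_top
  have hfin : ∀ᵐ ω ∂P, ∀ n, {x | (x.1, W.linkDist x ω) ∈ A n}.Finite :=
    ae_all_iff.2 fun n => (W.isPoisson_linkDist.ae_finite (hA n) (hA' n)).mono fun ω h => h.1
  filter_upwards [hfin] with ω h
  -- Powers tend to zero with distance, so beyond some `n` every transmitter is weaker than the
  -- reference transmitter `(b, 0)`. Almost surely only finitely many lie within `n`, and the
  -- maximum among these is global.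
  have hp := W.rxPower_pos (.b, 0) ω
  have hev : ∀ᶠ r in Filter.atTop, ∀ k, N.power k r < W.rxPower (.b, 0) ω :=
    Filter.eventually_all.2 fun k => (N.tendsto_power_atTop k).eventually_lt_const hp
  obtain ⟨n, hn⟩ := Filter.eventually_atTop.1 (tendsto_natCast_atTop_atTop.eventually
    (Filter.eventually_atTop.1 hev |>.elim fun r hr =>
      Filter.eventually_atTop.2 ⟨r, fun y hy => (fun z hz => hr z (le_trans hy hz) :
        ∀ z ≥ y, ∀ k, N.power k z < W.rxPower (.b, 0) ω)⟩))
  have hfar : ∀ x, (n : ℝ) ≤ W.linkDist x ω → W.rxPower x ω < W.rxPower (.b, 0) ω :=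
    fun x hx => hn n le_rfl _ hx _
  have hmem : (Station.b, 0) ∈ {x : Transmitter | (x.1, W.linkDist x ω) ∈ A n} := by
    by_contra hc
    exact lt_irrefl _ (hfar (.b, 0) (le_of_lt (by simpa [A] using hc)))
  obtain ⟨x, -, hx⟩ := Set.exists_max_image _ (fun x => W.rxPower x ω) (h n) ⟨_, hmem⟩
  refine ⟨x, fun x' => ?_⟩
  by_cases hx' : x' ∈ {x : Transmitter | (x.1, W.linkDist x ω) ∈ A n}
  · exact hx x' hx'
  · exact (hfar x' (le_of_lt (by simpa [A] using hx'))).le.trans (hx _ hmem)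

/-- The transmitter `x` has the strongest average received power. -/
def IsStrongest (x : Transmitter) (ω : Ω) : Prop := ∀ x', W.rxPower x' ω ≤ W.rxPower x ω

/-- Almost sure existence and uniqueness of the maximum replace the arbitrary choice in `strongest`
by the measurable condition `IsStrongest`, over which one can sum. -/
theorem ae_strongest_eq_iff [IsProbabilityMeasure P] :
    ∀ᵐ ω ∂P, ∀ x, W.IsStrongest x ω ↔ x = W.strongest ω := by
  filter_upwards [W.ae_injective_rxPower, W.ae_exists_rxPower_le] with ω h1 h2 x
  have h3 : W.IsStrongest (W.strongest ω) ω :=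
    @Classical.epsilon_spec _ (fun x => ∀ x', W.rxPower x' ω ≤ W.rxPower x ω) h2
  refine ⟨fun hx => ?_, fun hx => hx ▸ h3⟩
  by_contra hne
  exact h1 _ _ hne (le_antisymm (h3 x) (hx _))

theorem measurableSet_isStrongest (x : Transmitter) : MeasurableSet {ω | W.IsStrongest x ω} := by
  have : {ω | W.IsStrongest x ω} = ⋂ x', {ω | W.rxPower x' ω ≤ W.rxPower x ω} := by
    ext; simp [IsStrongest]
  rw [this]
  exact .iInter fun x' => measurableSet_le (W.measurable_rxPower x') (W.measurable_rxPower x)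

end Realization

/-! ### The Laplace functional of the interference -/

namespace Network

variable (N : Network)

theorem lamBar_eq_zero (k : Tier) {r : ℝ} (hr : r ≤ 0) : N.lamBar k r = 0 :=
  if_neg (not_le.2 (hr.trans_lt (N.H_pos _)))

theorem integral_lamBar (k : Tier) {x : ℝ} (hx : N.H k.station ≤ x) :
    ∫ r in N.H k.station..x, N.lamBar k r = N.LamBar k x := by
  have h : ∀ r ∈ Set.uIcc (N.H k.station) x, N.H k.station ≤ r := fun r hr => by
    rw [Set.uIcc_of_le hx] at hr; exact hr.1
  rw [LamBar.eq_def, if_pos hx]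
  cases k
  · rw [intervalIntegral.integral_congr (g := fun r => 2 * Real.pi * N.dens .b * r)
      fun r hr => by simp only [lamBar, if_pos (h r hr)], intervalIntegral.integral_const_mul,
      integral_id]
    simp only [Tier.station]
    ring
  · rw [intervalIntegral.integral_congr (g := fun r => 2 * Real.pi * N.dens .u * (N.pL r * r))
      fun r hr => by simp only [lamBar, if_pos (h r hr)]; ring,
      intervalIntegral.integral_const_mul]
    rfl
  · rw [intervalIntegral.integral_congr
      (g := fun r => 2 * Real.pi * N.dens .u * ((1 - N.pL r) * r))
      fun r hr => by simp only [lamBar, if_pos (h r hr)]; ring,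
      intervalIntegral.integral_const_mul]
    rfl

theorem tierProb_le_one (j : Station) (k : Tier) (r : ℝ) : N.tierProb j k r ≤ 1 := by
  rw [← N.sum_tierProb j r]
  exact Finset.single_le_sum (f := fun k => N.tierProb j k r)
    (fun ℓ _ => N.tierProb_nonneg j ℓ r) (Finset.mem_univ k)

theorem lamBar_le (k : Tier) {r : ℝ} (hr : 0 ≤ r) :
    N.lamBar k r ≤ 2 * Real.pi * N.dens k.station * r := by
  have h0 : 0 ≤ 2 * Real.pi * N.dens k.station * r := by
    have := N.dens_pos k.station
    positivity
  rw [lamBar_eq, radialDensity]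
  split_ifs with h
  · exact mul_le_of_le_one_right h0 (N.tierProb_le_one _ _ _)
  · simpa using h0

theorem lintegral_lamBar (k : Tier) (x : ℝ) :
    ∫⁻ r in Set.Iio x, ENNReal.ofReal (N.lamBar k r) = ENNReal.ofReal (N.LamBar k x) := by
  by_cases hx : N.H k.station ≤ x
  · have h1 : ∫⁻ r in Set.Iio x, ENNReal.ofReal (N.lamBar k r) =
        ∫⁻ r in Set.Ioc (N.H k.station) x, ENNReal.ofReal (N.lamBar k r) := by
      rw [setLIntegral_congr Iio_ae_eq_Iic, setLIntegral_congr Ioc_ae_eq_Icc,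
        ← lintegral_indicator measurableSet_Iic, ← lintegral_indicator measurableSet_Icc]
      refine lintegral_congr fun r => ?_
      by_cases h : N.H k.station ≤ r
      · simp [Set.indicator, h]
      · simp [Set.indicator, h, lamBar]
    rw [h1, ← N.integral_lamBar k hx, intervalIntegral.integral_of_le hx,
      ofReal_integral_eq_lintegral_ofReal _ (ae_of_all _ (N.lamBar_nonneg k))]
    refine Measure.integrableOn_of_bounded (M := 2 * Real.pi * N.dens k.station * x) (by simp)
      (N.measurable_lamBar k).aestronglyMeasurable ?_
    refine (ae_restrict_iff' measurableSet_Ioc).2 (ae_of_all _ fun r hr => ?_)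
    have h0 := ((N.H_pos k.station).trans hr.1).le
    rw [Real.norm_of_nonneg (N.lamBar_nonneg k r)]
    refine (N.lamBar_le k h0).trans ?_
    have := N.dens_pos k.station
    exact mul_le_mul_of_nonneg_left hr.2 (by positivity)
  · rw [LamBar.eq_def, if_neg hx, ENNReal.ofReal_zero]
    refine (setLIntegral_congr_fun (g := fun _ => 0) measurableSet_Iio fun r hr => ?_).trans
      (by simp)
    have : ¬ N.H k.station ≤ r := fun h => hx (h.trans (le_of_lt hr))
    simp [lamBar, this]

open Classical in
/-- Scaled received power of an interfering transmitter, infinite for a transmitter that would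
be stronger than a serving transmitter of condition `k` at distance `r`. -/
noncomputable def interferenceWeight (k : Tier) (c r : ℝ) (ℓ : Tier) (r' h : ℝ) : ℝ≥0∞ :=
  if N.power ℓ r' ≤ N.power k r then
    ENNReal.ofReal (c / N.power k r) * ENNReal.ofReal (N.power ℓ r' * h) else ∞

theorem measurable_interferenceWeight (k : Tier) (c : ℝ) (ℓ : Tier) :
    Measurable fun p : ℝ × ℝ × ℝ => N.interferenceWeight k c p.1 ℓ p.2.1 p.2.2 :=
  Measurable.ite (measurableSet_le ((N.measurable_power ℓ).comp (by fun_prop))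
    ((N.measurable_power k).comp measurable_fst)) (by fun_prop) measurable_const

/-- Exponent of the Laplace functional of the interference. -/
noncomputable def interferenceExponent (k : Tier) (c r : ℝ) : ℝ≥0∞ :=
  ∑ ℓ, ∫⁻ r', ENNReal.ofReal (N.lamBar ℓ r') * (1 - ∫⁻ h,
    eexpNeg (N.interferenceWeight k c r ℓ r' h) ∂(gammaMeasure (N.M ℓ) (N.M ℓ)))

theorem measurable_interferenceExponent (k : Tier) (c : ℝ) :
    Measurable (N.interferenceExponent k c) := by
  refine Finset.measurable_fun_sum _ fun ℓ _ => ?_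
  have h1 : Measurable fun p : (ℝ × ℝ) × ℝ =>
      eexpNeg (N.interferenceWeight k c p.1.1 ℓ p.1.2 p.2) :=
    measurable_eexpNeg.comp ((N.measurable_interferenceWeight k c ℓ).comp
      (f := fun p : (ℝ × ℝ) × ℝ => (p.1.1, p.1.2, p.2)) (by fun_prop))
  have h2 : Measurable fun p : ℝ × ℝ => ENNReal.ofReal (N.lamBar ℓ p.2) * (1 - ∫⁻ h,
      eexpNeg (N.interferenceWeight k c p.1 ℓ p.2 h) ∂(gammaMeasure (N.M ℓ) (N.M ℓ))) :=
    Measurable.mul (by fun_prop) (Measurable.const_sub h1.lintegral_prod_right' 1)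
  exact h2.lintegral_prod_right'

theorem lintegral_interferenceWeight (k ℓ : Tier) {c y r : ℝ} (hc : 0 ≤ c) (hy : 0 < y)
    (hr : N.χ k ℓ y ≤ r) :
    1 - ∫⁻ h, eexpNeg (N.interferenceWeight k c y ℓ r h) ∂(gammaMeasure (N.M ℓ) (N.M ℓ)) =
      ENNReal.ofReal (1 - ((1 + c * N.η k ℓ /
        (N.M ℓ * (r ^ N.α ℓ * y ^ (-N.α k)))) ^ N.M ℓ)⁻¹) := by
  have hr0 : 0 < r := (N.χ_pos k ℓ hy).trans_le hr
  have hp := N.power_pos k hy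
  have hpr := N.power_pos ℓ hr0
  have hM : (0 : ℝ) < N.M ℓ := by exact_mod_cast N.M_pos ℓ
  have h1 : ∀ h, N.interferenceWeight k c y ℓ r h =
      ENNReal.ofReal (c * N.power ℓ r / N.power k y * h) := by
    intro h
    rw [interferenceWeight, if_pos ((N.power_le_iff k ℓ hr0 hy).2 hr),
      ← ENNReal.ofReal_mul (by positivity)]
    congr 1
    ring
  simp_rw [h1]
  rw [lintegral_eexpNeg_gammaMeasure (N.M_pos ℓ) (by positivity), ← ENNReal.ofReal_one,
    ← ENNReal.ofReal_sub _ (by positivity)]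
  congr 5
  have hy' := Real.rpow_pos_of_pos hy (-N.α k)
  have hr' := Real.rpow_pos_of_pos hr0 (N.α ℓ)
  have hk := N.coef_pos k
  rw [power, power, η_eq, Real.rpow_neg hr0.le]
  field_simp

/-- Split the integral at `χ k ℓ y`. Below it an interferer would be stronger than the serving link,
its weight is `∞`, and the integrand is the full intensity: the void term. Above it the inner
integral is the Laplace transform of a gamma variable. -/
theorem exponent_eq (k : Tier) (m : ℕ) {γ y : ℝ} (hγ : 0 < γ) (hy : 0 < y) :
    N.exponent k m γ y = ENNReal.ofReal (m * γ * N.φ k / N.power k y) * ENNReal.ofReal N.N₀ +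
      N.interferenceExponent k (m * γ * N.φ k) y := by
  have hφ : 0 ≤ N.φ k := by unfold φ; positivity
  have hp := N.power_pos k hy
  have hc : 0 ≤ m * γ * N.φ k := by positivity
  rw [exponent, interferenceExponent, ← ENNReal.ofReal_mul (by positivity)]
  congr 1
  · congr 1
    rw [power, coef]
    ring
  · refine Finset.sum_congr rfl fun ℓ _ => ?_
    have hset : MeasurableSet (Set.Iio (N.χ k ℓ y)) := measurableSet_Iio
    rw [← lintegral_lamBar]
    refine Eq.trans ?_ (lintegral_add_compl _ hset)
    rw [Set.compl_Iio, ← setLIntegral_congr Ioi_ae_eq_Ici]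
    congr 1
    · refine setLIntegral_congr_fun measurableSet_Iio fun r hr => ?_
      by_cases hr0 : 0 < r
      · have h1 : ¬ N.power ℓ r ≤ N.power k y := by
          rw [N.power_le_iff k ℓ hr0 hy]
          exact not_le.2 hr
        simp [interferenceWeight, h1, eexpNeg_top]
      · simp [N.lamBar_eq_zero ℓ (not_lt.1 hr0)]
    · refine setLIntegral_congr_fun measurableSet_Ioi fun r hr => ?_
      rw [N.lintegral_interferenceWeight k ℓ hc hy (le_of_lt hr), mul_comm,
        ENNReal.ofReal_mul (N.lamBar_nonneg _ _)]

end Network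

namespace Realization

variable {N : Network} {Ω : Type*} [MeasurableSpace Ω] {P : Measure Ω} (W : Realization N P)

/-- Noise plus the power received from all transmitters other than `x`. -/
noncomputable def noiseInterferenceOf (x : Transmitter) (ω : Ω) : ℝ≥0∞ :=
  ENNReal.ofReal N.N₀ + ∑' x', if x' = x then 0 else
    ENNReal.ofReal (W.rxPower x' ω * W.fadingGain x' ω)

theorem measurable_noiseInterferenceOf (x : Transmitter) :
    Measurable (W.noiseInterferenceOf x) := by
  have h : ∀ x', Measurable fun ω => if x' = x then 0 else
      ENNReal.ofReal (W.rxPower x' ω * W.fadingGain x' ω) := fun x' =>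
    Measurable.ite (MeasurableSet.const _) measurable_const
      ((W.measurable_rxPower x').mul (W.measurable_fadingGain x')).ennreal_ofReal
  exact measurable_const.add (Measurable.tsum h)

/-- Almost surely exactly one indicator in the sum is nonzero. This turns a functional of the random
label `strongest` into a sum over fixed labels. -/
theorem ae_apply_strongest [IsProbabilityMeasure P] (f : Transmitter → Ω → ℝ≥0∞) :
    ∀ᵐ ω ∂P, f (W.strongest ω) ω = ∑' x, {ω | W.IsStrongest x ω}.indicator (f x) ω := by
  filter_upwards [W.ae_strongest_eq_iff] with ω h
  rw [tsum_eq_single (W.strongest ω)]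
  · rw [Set.indicator_of_mem ((h _).2 rfl)]
  · intro x hx
    exact Set.indicator_of_notMem (fun hx' => hx ((h x).1 hx')) _

theorem aemeasurable_strongest [IsProbabilityMeasure P] {f : Transmitter → Ω → ℝ≥0∞}
    (hf : ∀ x, Measurable (f x)) : AEMeasurable (fun ω => f (W.strongest ω) ω) P :=
  ⟨_, Measurable.tsum fun x => (hf x).indicator (W.measurableSet_isStrongest x),
    W.ae_apply_strongest f⟩

theorem lintegral_strongest [IsProbabilityMeasure P] {f : Transmitter → Ω → ℝ≥0∞}
    (hf : ∀ x, Measurable (f x)) :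
    ∫⁻ ω, f (W.strongest ω) ω ∂P =
      ∑' x, ∫⁻ ω, {ω | W.IsStrongest x ω}.indicator (f x) ω ∂P := by
  rw [lintegral_congr_ae (W.ae_apply_strongest f), lintegral_tsum fun x =>
    ((hf x).indicator (W.measurableSet_isStrongest x)).aemeasurable]

open Classical in
/-- Laplace transform of noise plus interference over the power of the serving link, on the event
that the serving link has condition `k`. -/
noncomputable def laplaceTerm (k : Tier) (c : ℝ) (x : Transmitter) (ω : Ω) : ℝ≥0∞ :=
  if W.tier x ω = k then
    eexpNeg (ENNReal.ofReal (c / W.rxPower x ω) * W.noiseInterferenceOf x ω) else 0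

theorem measurable_laplaceTerm (k : Tier) (c : ℝ) (x : Transmitter) :
    Measurable (W.laplaceTerm k c x) :=
  Measurable.ite (W.measurable_tier x (MeasurableSet.of_discrete (s := {k})))
    (measurable_eexpNeg.comp (Measurable.mul
      (measurable_const.div (W.measurable_rxPower x)).ennreal_ofReal
      (W.measurable_noiseInterferenceOf x))) measurable_const

/-- After summing over the candidates `x`, the infinite weights in `interferenceWeight` play the
role of the indicator that `x` is strongest, and `tsum_lintegral_marked` applies to the whole
expression. -/
theorem lintegral_laplaceTerm [IsProbabilityMeasure P] (k : Tier) (c : ℝ) :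
    ∫⁻ ω, W.laplaceTerm k c (W.strongest ω) ω ∂P = ∫⁻ y in Set.Ioi 0,
      ENNReal.ofReal (N.lamBar k y) * eexpNeg
        (ENNReal.ofReal (c / N.power k y) * ENNReal.ofReal N.N₀ + N.interferenceExponent k c y) := by
  classical
  have ha : Measurable fun r =>
      eexpNeg (ENNReal.ofReal (c / N.power k r) * ENNReal.ofReal N.N₀) :=
    measurable_eexpNeg.comp (by fun_prop)
  rw [W.lintegral_strongest (W.measurable_laplaceTerm k c)]
  refine Eq.trans ?_ ((W.tsum_lintegral_marked k ha
    (N.measurable_interferenceWeight k c)).trans ?_)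
  · refine tsum_congr fun x => lintegral_congr fun ω => ?_
    by_cases hk : W.tier x ω = k
    · have hpk : N.power k (W.linkDist x ω) = W.rxPower x ω := by rw [rxPower, hk]
      rw [if_pos hk, ← eexpNeg_add]
      by_cases hx : W.IsStrongest x ω
      · rw [Set.indicator_of_mem hx, laplaceTerm, if_pos hk, noiseInterferenceOf, mul_add,
          ← ENNReal.tsum_mul_left, hpk]
        congr 2
        refine tsum_congr fun x' => ?_
        rw [mul_ite, mul_zero]
        refine if_congr Iff.rfl rfl ?_
        have hx' : N.power (W.tier x' ω) (W.linkDist x' ω) ≤ W.rxPower x ω := hx x'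
        rw [Network.interferenceWeight, hpk, if_pos hx']
        simp only [rxPower]
      · rw [Set.indicator_of_notMem hx]
        -- One stronger transmitter makes the sum of the weights infinite, so the term vanishes just
        -- like the indicator.
        obtain ⟨x', hx'⟩ := not_forall.1 hx
        change ¬ N.power (W.tier x' ω) (W.linkDist x' ω) ≤ W.rxPower x ω at hx'
        have hne : x' ≠ x := by rintro rfl; exact hx' le_rfl
        have htop : (∑' x', if x' = x then 0 else N.interferenceWeight k c (W.linkDist x ω)
            (W.tier x' ω) (W.linkDist x' ω) (W.fadingGain x' ω)) = ∞ := by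
          refine ENNReal.tsum_eq_top_of_eq_top ⟨x', ?_⟩
          rw [if_neg hne, Network.interferenceWeight, hpk, if_neg hx']
        rw [htop, add_top, eexpNeg_top]
    · rw [if_neg hk, zero_mul]
      refine Set.indicator_apply_eq_zero.2 fun _ => if_neg hk
  · rw [← lintegral_indicator measurableSet_Ioi]
    refine lintegral_congr fun r => ?_
    by_cases hr : 0 < r
    · rw [Set.indicator_of_mem (show r ∈ Set.Ioi 0 from hr), eexpNeg_add]
      rfl
    · rw [Set.indicator_of_notMem (show r ∉ Set.Ioi 0 from hr),
        N.lamBar_eq_zero k (not_lt.1 hr), ENNReal.ofReal_zero, zero_mul]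

/-- The integrals of the moment formula are Laplace transforms. -/
theorem integral_expNeg_exponent [IsProbabilityMeasure P] (k : Tier) (m : ℕ) {γ : ℝ}
    (hγ : 0 < γ) :
    ∫ y in Set.Ioi (0 : ℝ), N.lamBar k y * expNeg (N.exponent k m γ y) =
      (∫⁻ ω, W.laplaceTerm k (m * γ * N.φ k) (W.strongest ω) ω ∂P).toReal := by
  rw [W.lintegral_laplaceTerm k]
  have h1 : ∀ y ∈ Set.Ioi (0 : ℝ), N.lamBar k y * expNeg (N.exponent k m γ y) =
      N.lamBar k y * expNeg (ENNReal.ofReal (m * γ * N.φ k / N.power k y) * ENNReal.ofReal N.N₀ +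
        N.interferenceExponent k (m * γ * N.φ k) y) := fun y hy => by
    rw [N.exponent_eq k m hγ hy]
  have hE := N.measurable_interferenceExponent k (m * γ * N.φ k)
  rw [setIntegral_congr_fun measurableSet_Ioi h1, integral_eq_lintegral_of_nonneg_ae]
  · congr 1
    refine lintegral_congr fun y => ?_
    rw [ENNReal.ofReal_mul (N.lamBar_nonneg _ _), ofReal_expNeg]
  · exact ae_of_all _ fun y => mul_nonneg (N.lamBar_nonneg _ _) (expNeg_nonneg _)
  · exact ((N.measurable_lamBar k).mul
      (measurable_expNeg.comp (by fun_prop))).aestronglyMeasurable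

end Realization

/-! ### The moment formula -/

theorem one_sub_one_sub_pow_pow (t : ℝ) (M b : ℕ) :
    (1 - (1 - t) ^ M) ^ b = ∑ n ∈ Finset.range (b + 1), ∑ m ∈ Finset.range (M * n + 1),
      (b.choose n : ℝ) * ((M * n).choose m : ℝ) * (-1) ^ (n + m) * t ^ m := by
  have h : ∀ (s : ℝ) (n : ℕ), (1 - s) ^ n =
      ∑ m ∈ Finset.range (n + 1), (n.choose m : ℝ) * (-1) ^ m * s ^ m := fun s n => by
    rw [sub_eq_neg_add, add_pow]
    refine Finset.sum_congr rfl fun m _ => ?_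
    rw [one_pow, neg_pow]
    ring
  rw [h]
  refine Finset.sum_congr rfl fun n _ => ?_
  rw [← pow_mul, h, Finset.mul_sum]
  refine Finset.sum_congr rfl fun m _ => ?_
  rw [pow_add]
  ring

namespace Realization

variable {N : Network} {Ω : Type*} [MeasurableSpace Ω] {P : Measure Ω} (W : Realization N P)

/-- The surrogate if the transmitter `x` serves the typical user. -/
noncomputable def surrogateOf (γ : ℝ) (x : Transmitter) (ω : Ω) : ℝ :=
  1 - (1 - expNeg (ENNReal.ofReal (γ * N.φ (W.tier x ω) / W.rxPower x ω) *
    W.noiseInterferenceOf x ω)) ^ N.M (W.tier x ω)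

theorem surrogate_eq_surrogateOf (hiso : N.IsIsotropic) (s : Scenario) (γ : ℝ) (ω : Ω) :
    W.surrogate s γ ω = W.surrogateOf γ (W.strongest ω) ω :=
  W.surrogate_eq hiso s γ ω

theorem surrogateOf_nonneg (γ : ℝ) (x : Transmitter) (ω : Ω) : 0 ≤ W.surrogateOf γ x ω :=
  sub_nonneg.2 (pow_le_one₀ (sub_nonneg.2 (expNeg_le_one _)) (sub_le_self _ (expNeg_nonneg _)))

theorem surrogateOf_le_one (γ : ℝ) (x : Transmitter) (ω : Ω) : W.surrogateOf γ x ω ≤ 1 :=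
  sub_le_self _ (pow_nonneg (sub_nonneg.2 (expNeg_le_one _)) _)

theorem measurable_surrogateOf (γ : ℝ) (x : Transmitter) : Measurable (W.surrogateOf γ x) := by
  refine Measurable.apply_of_countable (g := fun k ω =>
    1 - (1 - expNeg (ENNReal.ofReal (γ * N.φ k / W.rxPower x ω) *
      W.noiseInterferenceOf x ω)) ^ N.M k) (fun k => ?_) (W.measurable_tier x)
  have h1 := W.measurable_rxPower x
  have h2 := W.measurable_noiseInterferenceOf x
  have h3 := measurable_expNeg
  fun_prop

/-- The indicator inside `laplaceTerm` selects the actual condition of `x`. For that condition the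
identity is the double binomial expansion, with the `m`-th power of the exponential absorbed into
the scale. -/
theorem surrogateOf_pow (b : ℕ) (γ : ℝ) (x : Transmitter) (ω : Ω) :
    W.surrogateOf γ x ω ^ b = ∑ k : Tier, ∑ n ∈ Finset.range (b + 1),
      ∑ m ∈ Finset.range (N.M k * n + 1),
        (b.choose n : ℝ) * ((N.M k * n).choose m : ℝ) * (-1) ^ (n + m) *
          (W.laplaceTerm k (m * γ * N.φ k) x ω).toReal := by
  rw [Finset.sum_eq_single (W.tier x ω)]
  · rw [surrogateOf, one_sub_one_sub_pow_pow]
    refine Finset.sum_congr rfl fun n _ => Finset.sum_congr rfl fun m _ => ?_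
    rw [laplaceTerm, if_pos rfl, toReal_eexpNeg, ← expNeg_nat_mul]
    congr 2
    have hφ : 0 ≤ N.φ (W.tier x ω) := by unfold Network.φ; positivity
    have hp := W.rxPower_pos x ω
    rw [← mul_assoc]
    congr 1
    rw [← ENNReal.ofReal_natCast, ← ENNReal.ofReal_mul (by positivity)]
    congr 1
    ring
  · intro k _ hk
    refine Finset.sum_eq_zero fun n _ => Finset.sum_eq_zero fun m _ => ?_
    rw [laplaceTerm, if_neg (Ne.symm hk), ENNReal.toReal_zero, mul_zero]
  · simp

theorem laplaceTerm_le_one (k : Tier) (c : ℝ) (x : Transmitter) (ω : Ω) :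
    W.laplaceTerm k c x ω ≤ 1 := by
  unfold laplaceTerm
  split_ifs
  · exact eexpNeg_le_one _
  · exact zero_le_one

theorem aemeasurable_surrogate [IsProbabilityMeasure P] (hiso : N.IsIsotropic) (s : Scenario)
    (γ : ℝ) : AEMeasurable (W.surrogate s γ) P := by
  have h : W.surrogate s γ = fun ω => (ENNReal.ofReal (W.surrogateOf γ (W.strongest ω) ω)).toReal :=
    funext fun ω => by
      rw [ENNReal.toReal_ofReal (W.surrogateOf_nonneg _ _ _), W.surrogate_eq_surrogateOf hiso]
  rw [h]
  exact (W.aemeasurable_strongest (f := fun x ω => ENNReal.ofReal (W.surrogateOf γ x ω))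
    fun x => (W.measurable_surrogateOf γ x).ennreal_ofReal).ennreal_toReal

theorem surrogate_nonneg (hiso : N.IsIsotropic) (s : Scenario) (γ : ℝ) (ω : Ω) :
    0 ≤ W.surrogate s γ ω :=
  W.surrogate_eq_surrogateOf hiso s γ ω ▸ W.surrogateOf_nonneg _ _ _

theorem surrogate_le_one (hiso : N.IsIsotropic) (s : Scenario) (γ : ℝ) (ω : Ω) :
    W.surrogate s γ ω ≤ 1 :=
  W.surrogate_eq_surrogateOf hiso s γ ω ▸ W.surrogateOf_le_one _ _ _

theorem integral_surrogate_pow [IsProbabilityMeasure P] (hiso : N.IsIsotropic) (s : Scenario)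
    (b : ℕ) {γ : ℝ} (hγ : 0 < γ) :
    ∫ ω, W.surrogate s γ ω ^ b ∂P = N.momentFormula b γ := by
  have hL : ∀ k c, AEMeasurable (fun ω => W.laplaceTerm k c (W.strongest ω) ω) P := fun k c =>
    W.aemeasurable_strongest (W.measurable_laplaceTerm k c)
  have hint : ∀ k c, Integrable (fun ω => (W.laplaceTerm k c (W.strongest ω) ω).toReal) P :=
    fun k c => Integrable.of_bound (hL k c).ennreal_toReal.aestronglyMeasurable 1
      (ae_of_all _ fun ω => by
        rw [Real.norm_of_nonneg ENNReal.toReal_nonneg]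
        exact ENNReal.toReal_le_of_le_ofReal zero_le_one
          (by simpa using W.laplaceTerm_le_one k c (W.strongest ω) ω))
  simp_rw [W.surrogate_eq_surrogateOf hiso, W.surrogateOf_pow b γ]
  rw [integral_finsetSum _ fun k _ => integrable_finsetSum _ fun n _ =>
    integrable_finsetSum _ fun m _ => (hint _ _).const_mul _, Network.momentFormula]
  refine Finset.sum_congr rfl fun k _ => ?_
  rw [integral_finsetSum _ fun n _ => integrable_finsetSum _ fun m _ => (hint _ _).const_mul _]
  refine Finset.sum_congr rfl fun n _ => ?_
  rw [integral_finsetSum _ fun m _ => (hint _ _).const_mul _]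
  refine Finset.sum_congr rfl fun m _ => ?_
  rw [integral_const_mul, W.integral_expNeg_exponent k m hγ, integral_toReal (hL _ _)]
  exact ae_of_all _ fun ω => (W.laplaceTerm_le_one _ _ _ _).trans_lt ENNReal.one_lt_top

end Realization

/-! ### Success probability given the geometry -/

namespace Realization

variable {N : Network} {Ω : Type*} [MeasurableSpace Ω] {P : Measure Ω} (W : Realization N P)

theorem measurable_linkDist_of_le {Ω : Type*} {m : MeasurableSpace Ω} [MeasurableSpace Ω]
    {P : Measure Ω} (W : Realization N P) (x : Transmitter)
    (h : MeasurableSpace.comap (W.X x.1 x.2) inferInstance ≤ m) : Measurable[m] (W.linkDist x) :=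
  (N.measurable_linkLen x.1).comp ((comap_measurable (W.X x.1 x.2)).mono h le_rfl)

theorem measurable_tier_geometry (x : Transmitter) : Measurable[W.geometry] (W.tier x) :=
  (comap_measurable (W.tier x)).mono (le_sup_of_le_right
    (le_iSup (fun x => MeasurableSpace.comap (W.tier x) inferInstance) x)) le_rfl

theorem measurable_linkDist_geometry (x : Transmitter) : Measurable[W.geometry] (W.linkDist x) :=
  W.measurable_linkDist_of_le x (le_sup_of_le_left
    (le_iSup (fun x : Transmitter => MeasurableSpace.comap (W.X x.1 x.2) inferInstance) x))

theorem measurable_rxPower_geometry (x : Transmitter) : Measurable[W.geometry] (W.rxPower x) :=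
  Measurable.apply_of_countable (g := fun k ω => N.power k (W.linkDist x ω))
    (fun k => (N.measurable_power k).comp (W.measurable_linkDist_geometry x))
    (W.measurable_tier_geometry x)

theorem measurableSet_isStrongest_geometry (x : Transmitter) :
    MeasurableSet[W.geometry] {ω | W.IsStrongest x ω} := by
  have : {ω | W.IsStrongest x ω} = ⋂ x', {ω | W.rxPower x' ω ≤ W.rxPower x ω} := by
    ext; simp [IsStrongest]
  rw [this]
  exact @MeasurableSet.iInter _ _ W.geometry _ _ fun x' =>
    measurableSet_le (W.measurable_rxPower_geometry x')
      (W.measurable_rxPower_geometry x)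

theorem geometry_le_of_le {Ω : Type*} {m : MeasurableSpace Ω} [MeasurableSpace Ω]
    {P : Measure Ω} (W : Realization N P)
    (h1 : ∀ j i, MeasurableSpace.comap (W.X j i) inferInstance ≤ m)
    (h2 : ∀ i, MeasurableSpace.comap (W.U i) inferInstance ≤ m) : W.geometry ≤ m := by
  refine sup_le (iSup_le fun x => h1 _ _) (iSup_le fun x => Measurable.comap_le ?_)
  have h : W.tier x = fun ω => N.tierOf x.1 (W.linkDist x ω) (W.U x.2 ω) :=
    funext fun ω => W.tier_eq x ω
  rw [h]
  exact (N.measurable_tierOf x.1).comp ((W.measurable_linkDist_of_le x (h1 _ _)).prodMk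
    ((comap_measurable (W.U x.2)).mono (h2 _) le_rfl))

theorem geometry_le : W.geometry ≤ ‹MeasurableSpace Ω› :=
  W.geometry_le_of_le (fun j i => ((W.poisson j).measurable i).comap_le)
    fun i => (W.mark_measurable i).comap_le

/-- The sigma-algebra of all sources of randomness except one fading gain. -/
@[reducible] def sigmaExcept (k : Tier) (i : ℕ) : MeasurableSpace Ω :=
  ⨆ s ∈ ({Source.fading k i}ᶜ : Set Source), sourceSigma W.X W.U W.fade s

theorem sourceSigma_le_sigmaExcept {k : Tier} {i : ℕ} {s : Source} (hs : s ≠ .fading k i) :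
    sourceSigma W.X W.U W.fade s ≤ W.sigmaExcept k i :=
  le_iSup₂ (f := fun s (_ : s ∈ ({Source.fading k i}ᶜ : Set Source)) =>
    sourceSigma W.X W.U W.fade s) s hs

theorem geometry_le_sigmaExcept (k : Tier) (i : ℕ) : W.geometry ≤ W.sigmaExcept k i :=
  W.geometry_le_of_le (fun j i' => (le_iSup (fun i =>
      MeasurableSpace.comap (W.X j i) inferInstance) i').trans
      (W.sourceSigma_le_sigmaExcept (s := .points j) (by simp)))
    fun i' => W.sourceSigma_le_sigmaExcept (s := .mark i') (by simp)

theorem fadingGain_eq (x : Transmitter) (ω : Ω) :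
    W.fadingGain x ω = (W.markOf x ω).2 (W.tier x ω) :=
  (W.markOf_snd x ω (W.tier_station x ω)).symm

/-- The gain of `x'` depends on the geometry and on the mark sources of `x'`, which are disjoint
from those of `x`; the excluded gain is one of the latter. -/
theorem measurable_fadingGain_sigmaExcept {k : Tier} {x x' : Transmitter} (hk : k.station = x.1)
    (hx : x' ≠ x) : Measurable[W.sigmaExcept k x.2] (W.fadingGain x') := by
  have h1 : Measurable[W.sigmaExcept k x.2] (W.markOf x') := by
    refine (W.measurable_markOf_iSup x').mono (biSup_mono fun s hs => ?_) le_rfl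
    rintro rfl
    exact Set.disjoint_left.1 (disjoint_markSources hx) hs ⟨hk, rfl⟩
  have h2 : W.fadingGain x' = fun ω => (W.markOf x' ω).2 (W.tier x' ω) :=
    funext fun ω => W.fadingGain_eq x' ω
  rw [h2]
  exact Measurable.apply_of_countable (g := fun ℓ ω => (W.markOf x' ω).2 ℓ)
    (fun ℓ => (measurable_pi_apply ℓ).comp (measurable_snd.comp h1))
    ((W.measurable_tier_geometry x').mono (W.geometry_le_sigmaExcept k x.2) le_rfl)

/-- The event that the signal-to-interference-plus-noise ratio exceeds `γ` if `x` serves the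
typical user. -/
def successOf (γ : ℝ) (x : Transmitter) : Set Ω :=
  {ω | ENNReal.ofReal γ * W.noiseInterferenceOf x ω <
    ENNReal.ofReal (W.rxPower x ω * W.fadingGain x ω)}

theorem measurableSet_successOf (γ : ℝ) (x : Transmitter) : MeasurableSet (W.successOf γ x) :=
  measurableSet_lt (measurable_const.mul (W.measurable_noiseInterferenceOf x))
    ((W.measurable_rxPower x).mul (W.measurable_fadingGain x)).ennreal_ofReal

open Classical in
/-- On links of condition `k`, the fading gain of the serving link can be integrated out. -/
theorem lintegral_successOf_tier [IsProbabilityMeasure P] (γ : ℝ) (x : Transmitter) (k : Tier)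
    {g : Ω → ℝ≥0∞} (hg : Measurable[W.geometry] g) :
    ∫⁻ ω, (if W.tier x ω = k then g ω else 0) * (W.successOf γ x).indicator 1 ω ∂P =
      ∫⁻ ω, (if W.tier x ω = k then g ω else 0) * gammaMeasure (N.M k) (N.M k)
        {h | ENNReal.ofReal γ * W.noiseInterferenceOf x ω <
          ENNReal.ofReal (W.rxPower x ω * h)} ∂P := by
  by_cases hk : k.station = x.1
  swap
  · have h : ∀ ω, W.tier x ω ≠ k := fun ω h => hk (h ▸ W.tier_station x ω)
    simp [h]
  let I : (Transmitter → ℝ) → ℝ≥0∞ := fun q =>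
    ENNReal.ofReal N.N₀ + ∑' x', if x' = x then 0 else ENNReal.ofReal (q x')
  have hI : Measurable I := by
    have h : ∀ x', Measurable fun q : Transmitter → ℝ =>
        if x' = x then 0 else ENNReal.ofReal (q x') := fun x' =>
      Measurable.ite (MeasurableSet.const _) measurable_const (by fun_prop)
    exact measurable_const.add (Measurable.tsum h)
  -- `V` collects everything in the event except the gain of `x` on condition `k`. The own entry of
  -- `x` in the family of received powers is set to zero, which keeps `V` measurable for
  -- `sigmaExcept` and hence independent of that gain.
  let V : Ω → ℝ≥0∞ × ℝ × (Transmitter → ℝ) := fun ω =>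
    (if W.tier x ω = k then g ω else 0, W.rxPower x ω,
      fun x' => if x' = x then 0 else W.rxPower x' ω * W.fadingGain x' ω)
  have hIV : ∀ ω, I (V ω).2.2 = W.noiseInterferenceOf x ω := by
    intro ω
    refine congrArg (ENNReal.ofReal N.N₀ + ·) (tsum_congr fun x' => ?_)
    by_cases h : x' = x <;> simp [h, V]
  let F : ℝ≥0∞ × ℝ × (Transmitter → ℝ) → ℝ → ℝ≥0∞ := fun v h =>
    v.1 * {h | ENNReal.ofReal γ * I v.2.2 < ENNReal.ofReal (v.2.1 * h)}.indicator 1 h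
  have hset : MeasurableSet {p : (ℝ≥0∞ × ℝ × (Transmitter → ℝ)) × ℝ |
      ENNReal.ofReal γ * I p.1.2.2 < ENNReal.ofReal (p.1.2.1 * p.2)} := by
    refine measurableSet_lt (measurable_const.mul (hI.comp ?_)) ?_ <;> fun_prop
  have hF : Measurable (Function.uncurry F) :=
    Measurable.mul (by fun_prop) (measurable_one.indicator hset)
  have hle := W.geometry_le_sigmaExcept k x.2
  have hp : ∀ x', Measurable[W.sigmaExcept k x.2] (W.rxPower x') := fun x' =>
    (W.measurable_rxPower_geometry x').mono hle le_rfl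
  have hV : Measurable[W.sigmaExcept k x.2] V := by
    refine @Measurable.prodMk _ _ _ _ _ (_) _ _ ?_ (@Measurable.prodMk _ _ _ _ _ (_) _ _ (hp x)
      (@measurable_pi_lambda _ _ _ (_) _ _ fun x' => ?_))
    · refine Measurable.mono (ma := W.geometry) ?_ hle le_rfl
      exact @Measurable.ite _ _ (_) _ _ _ _ _ (W.measurable_tier_geometry x
        (MeasurableSet.of_discrete (s := {k}))) hg (@measurable_const _ _ _ (_) _)
    · by_cases h : x' = x
      · simp only [h, if_true]
        exact @measurable_const _ _ _ (_) _
      · simp only [h, if_false]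
        exact (hp x').mul (W.measurable_fadingGain_sigmaExcept hk h)
  have hindep : IndepFun V (W.fade k x.2) P := by
    refine indep_of_indep_of_le_left (indep_of_indep_of_le_right
      (indep_iSup_of_disjoint W.sourceSigma_le W.independent
        (S := ({Source.fading k x.2}ᶜ : Set Source)) (T := {Source.fading k x.2})
        disjoint_compl_left) ?_) hV.comap_le
    exact le_iSup₂ (f := fun s (_ : s ∈ ({Source.fading k x.2} : Set Source)) =>
      sourceSigma W.X W.U W.fade s) (Source.fading k x.2) rfl
  have h1 := hindep.lintegral_comp (hV.mono (iSup₂_le fun s _ => W.sourceSigma_le s) le_rfl)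
    (W.fade_measurable k x.2) hF
  refine Eq.trans (lintegral_congr fun ω => ?_) (h1.trans (lintegral_congr fun ω => ?_))
  · by_cases h : W.tier x ω = k
    · have h2 : W.fadingGain x ω = W.fade k x.2 ω := by rw [fadingGain, h]
      refine congrArg ((if W.tier x ω = k then g ω else 0) * ·) ?_
      simp only [Set.indicator, successOf, Set.mem_ofPred_eq, hIV, h2, V, Pi.one_apply]
    · simp [h, F, V]
  · have hm : MeasurableSet {h | ENNReal.ofReal γ * I (V ω).2.2 <
        ENNReal.ofReal ((V ω).2.1 * h)} :=
      measurableSet_lt measurable_const (by fun_prop)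
    have hm' : Measurable fun h => F (V ω) h :=
      measurable_const.mul (measurable_one.indicator hm)
    rw [← lintegral_map (f := fun h => F (V ω) h) hm' (W.fade_measurable k x.2), W.fade_law]
    simp only [F]
    rw [lintegral_const_mul _ (measurable_one.indicator hm), lintegral_indicator_one hm, hIV]

theorem lintegral_eq_sum_tier (x : Transmitter) {f : Ω → ℝ≥0∞} {g : Ω → ℝ≥0∞}
    (hf : Measurable f) (hg : Measurable g) [DecidableEq Tier] :
    ∫⁻ ω, g ω * f ω ∂P = ∑ k, ∫⁻ ω, (if W.tier x ω = k then g ω else 0) * f ω ∂P := by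
  have h : ∀ k ∈ Finset.univ, Measurable fun ω => (if W.tier x ω = k then g ω else 0) * f ω :=
    fun k _ => (Measurable.ite (W.measurable_tier x (MeasurableSet.of_discrete (s := {k}))) hg
      measurable_const).mul hf
  rw [← lintegral_finsetSum _ h]
  refine lintegral_congr fun ω => ?_
  rw [← Finset.sum_mul, Finset.sum_ite_eq, if_pos (Finset.mem_univ _)]

theorem lintegral_successOf_le [IsProbabilityMeasure P] {γ : ℝ} (hγ : 0 < γ) (x : Transmitter)
    {g : Ω → ℝ≥0∞} (hg : Measurable[W.geometry] g) :
    ∫⁻ ω, g ω * (W.successOf γ x).indicator 1 ω ∂P ≤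
      ∫⁻ ω, g ω * ENNReal.ofReal (W.surrogateOf γ x ω) ∂P := by
  classical
  have hg' := hg.mono W.geometry_le le_rfl
  rw [W.lintegral_eq_sum_tier x (measurable_one.indicator (W.measurableSet_successOf γ x)) hg',
    W.lintegral_eq_sum_tier x (W.measurable_surrogateOf γ x).ennreal_ofReal hg']
  refine Finset.sum_le_sum fun k _ => ?_
  refine (W.lintegral_successOf_tier γ x k hg).trans_le (lintegral_mono fun ω => ?_)
  by_cases h : W.tier x ω = k
  · refine mul_le_mul_right ?_ _
    subst h
    exact gammaMeasure_setOf_lt_le (N.M_pos _) (W.rxPower_pos x ω) hγ _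
  · simp [h]

theorem lintegral_successOf_eq [IsProbabilityMeasure P] (hM : ∀ k, N.M k = 1) {γ : ℝ}
    (hγ : 0 < γ) (x : Transmitter) {g : Ω → ℝ≥0∞} (hg : Measurable[W.geometry] g) :
    ∫⁻ ω, g ω * (W.successOf γ x).indicator 1 ω ∂P =
      ∫⁻ ω, g ω * ENNReal.ofReal (W.surrogateOf γ x ω) ∂P := by
  classical
  have hg' := hg.mono W.geometry_le le_rfl
  rw [W.lintegral_eq_sum_tier x (measurable_one.indicator (W.measurableSet_successOf γ x)) hg',
    W.lintegral_eq_sum_tier x (W.measurable_surrogateOf γ x).ennreal_ofReal hg']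
  refine Finset.sum_congr rfl fun k _ => ?_
  refine (W.lintegral_successOf_tier γ x k hg).trans (lintegral_congr fun ω => ?_)
  by_cases h : W.tier x ω = k
  · congr 1
    rw [hM k, gammaMeasure_one_setOf_lt (W.rxPower_pos x ω) hγ, surrogateOf, hM, Network.φ, hM]
    simp
  · simp [h]

/-- Since `γ` is positive and finite, clearing the denominator is legitimate even if noise plus
interference is `0` or `∞`. -/
theorem ofReal_lt_SINR_iff (hiso : N.IsIsotropic) (s : Scenario) {γ : ℝ} (hγ : 0 < γ) (ω : Ω) :
    ENNReal.ofReal γ < W.SINR s ω ↔ ω ∈ W.successOf γ (W.strongest ω) := by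
  rw [W.SINR_eq hiso, ENNReal.lt_div_iff_mul_lt (Or.inr ENNReal.ofReal_ne_top)
    (Or.inr (ENNReal.ofReal_pos.2 hγ).ne')]
  rfl

theorem setLIntegral_success [IsProbabilityMeasure P] {A : Set Ω}
    (hA : MeasurableSet A) {f : Transmitter → Ω → ℝ≥0∞} (hf : ∀ x, Measurable (f x)) :
    ∫⁻ ω in A, f (W.strongest ω) ω ∂P =
      ∑' x, ∫⁻ ω, (A ∩ {ω | W.IsStrongest x ω}).indicator 1 ω * f x ω ∂P := by
  rw [← lintegral_indicator hA]
  refine (W.lintegral_strongest (f := fun x => A.indicator (f x))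
    fun x => (hf x).indicator hA).trans (tsum_congr fun x => lintegral_congr fun ω => ?_)
  by_cases h1 : ω ∈ A <;> by_cases h2 : W.IsStrongest x ω <;> simp [h1, h2]

theorem setLIntegral_success_le [IsProbabilityMeasure P] {γ : ℝ} (hγ : 0 < γ) {A : Set Ω}
    (hA : MeasurableSet[W.geometry] A) :
    ∫⁻ ω in A, (W.successOf γ (W.strongest ω)).indicator 1 ω ∂P ≤
      ∫⁻ ω in A, ENNReal.ofReal (W.surrogateOf γ (W.strongest ω) ω) ∂P := by
  rw [W.setLIntegral_success (W.geometry_le _ hA) fun x =>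
      measurable_one.indicator (W.measurableSet_successOf γ x),
    W.setLIntegral_success (W.geometry_le _ hA) fun x =>
      (W.measurable_surrogateOf γ x).ennreal_ofReal]
  exact ENNReal.tsum_le_tsum fun x => W.lintegral_successOf_le hγ x
    (Measurable.indicator (@measurable_const _ _ _ W.geometry 1)
      (@MeasurableSet.inter _ W.geometry _ _ hA (W.measurableSet_isStrongest_geometry x)))

theorem setLIntegral_success_eq [IsProbabilityMeasure P] (hM : ∀ k, N.M k = 1) {γ : ℝ}
    (hγ : 0 < γ) {A : Set Ω} (hA : MeasurableSet[W.geometry] A) :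
    ∫⁻ ω in A, (W.successOf γ (W.strongest ω)).indicator 1 ω ∂P =
      ∫⁻ ω in A, ENNReal.ofReal (W.surrogateOf γ (W.strongest ω) ω) ∂P := by
  rw [W.setLIntegral_success (W.geometry_le _ hA) fun x =>
      measurable_one.indicator (W.measurableSet_successOf γ x),
    W.setLIntegral_success (W.geometry_le _ hA) fun x =>
      (W.measurable_surrogateOf γ x).ennreal_ofReal]
  exact tsum_congr fun x => W.lintegral_successOf_eq hM hγ x
    (Measurable.indicator (@measurable_const _ _ _ W.geometry 1)
      (@MeasurableSet.inter _ W.geometry _ _ hA (W.measurableSet_isStrongest_geometry x)))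

end Realization

/-! ### Comparison of moments -/

/-- Conditional expectations are ordered if the integrals over all events of the
sigma-algebra are. -/
theorem condExp_le_condExp_of_forall_setIntegral_le {Ω : Type*} {m mΩ : MeasurableSpace Ω}
    {P : Measure Ω} [IsFiniteMeasure P] (hm : m ≤ mΩ) {f g : Ω → ℝ} (hf : Integrable f P)
    (hg : Integrable g P)
    (h : ∀ A, MeasurableSet[m] A → ∫ ω in A, f ω ∂P ≤ ∫ ω in A, g ω ∂P) :
    P[f | m] ≤ᵐ[P] P[g | m] := by
  refine ae_le_of_ae_le_trim (hm := hm) ?_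
  refine ae_le_of_forall_setIntegral_le
    (integrable_condExp.trim hm stronglyMeasurable_condExp)
    (integrable_condExp.trim hm stronglyMeasurable_condExp) fun A hA _ => ?_
  rw [← setIntegral_trim hm stronglyMeasurable_condExp hA,
    ← setIntegral_trim hm stronglyMeasurable_condExp hA, setIntegral_condExp hm hf hA,
    setIntegral_condExp hm hg hA]
  exact h A hA

theorem condExp_mem_Icc {Ω : Type*} {m mΩ : MeasurableSpace Ω} {P : Measure Ω}
    [IsFiniteMeasure P] (hm : m ≤ mΩ) {f : Ω → ℝ} (hf : Integrable f P)
    (h : ∀ ω, f ω ∈ Set.Icc (0 : ℝ) 1) : ∀ᵐ ω ∂P, (P[f | m]) ω ∈ Set.Icc (0 : ℝ) 1 :=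
  (convex_Icc 0 1).condExp_mem hm hf isClosed_Icc (ae_of_all _ h)

theorem integrable_pow_of_mem_Icc {Ω : Type*} {mΩ : MeasurableSpace Ω} {P : Measure Ω}
    [IsFiniteMeasure P] {f : Ω → ℝ} (hf : AEStronglyMeasurable f P)
    (h : ∀ᵐ ω ∂P, f ω ∈ Set.Icc (0 : ℝ) 1) (b : ℕ) : Integrable (fun ω => f ω ^ b) P := by
  refine Integrable.of_bound (hf.pow b) 1 (h.mono fun ω hω => ?_)
  rw [Real.norm_of_nonneg (pow_nonneg hω.1 b)]
  exact pow_le_one₀ hω.1 hω.2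

/-- Conditioning decreases moments. -/
theorem integral_condExp_pow_le {Ω : Type*} {m mΩ : MeasurableSpace Ω} {P : Measure Ω}
    [IsFiniteMeasure P] (hm : m ≤ mΩ) {f : Ω → ℝ} (hf : Integrable f P)
    (h : ∀ ω, f ω ∈ Set.Icc (0 : ℝ) 1) (b : ℕ) :
    ∫ ω, (P[f | m]) ω ^ b ∂P ≤ ∫ ω, f ω ^ b ∂P := by
  have hint := integrable_pow_of_mem_Icc hf.aestronglyMeasurable (ae_of_all _ h) b
  have hJ := (convexOn_pow b).map_condExp_le (μ := P) hm
    (continuous_pow b).continuousOn.lowerSemicontinuousOn (ae_of_all _ fun ω => (h ω).1)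
    isClosed_Ici hf hint
  rw [← integral_condExp (f := fun ω => f ω ^ b) hm]
  exact integral_mono_ae (integrable_pow_of_mem_Icc
    integrable_condExp.aestronglyMeasurable (condExp_mem_Icc hm hf h) b) integrable_condExp hJ

namespace Realization

variable {N : Network} {Ω : Type*} [MeasurableSpace Ω] {P : Measure Ω} (W : Realization N P)

theorem indicator_success (hiso : N.IsIsotropic) (s : Scenario) {γ : ℝ} (hγ : 0 < γ) (ω : Ω) :
    {ω | ENNReal.ofReal γ < W.SINR s ω}.indicator (fun _ => (1 : ℝ)) ω =
      ((W.successOf γ (W.strongest ω)).indicator (1 : Ω → ℝ≥0∞) ω).toReal := by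
  have h := W.ofReal_lt_SINR_iff hiso s hγ ω
  by_cases h1 : ω ∈ W.successOf γ (W.strongest ω)
  · rw [Set.indicator_of_mem (show ω ∈ {ω | ENNReal.ofReal γ < W.SINR s ω} from h.2 h1),
      Set.indicator_of_mem h1]
    simp
  · rw [Set.indicator_of_notMem (show ω ∉ {ω | ENNReal.ofReal γ < W.SINR s ω} from
      fun h2 => h1 (h.1 h2)), Set.indicator_of_notMem h1]
    simp

theorem integrable_success [IsProbabilityMeasure P] (hiso : N.IsIsotropic) (s : Scenario) {γ : ℝ}
    (hγ : 0 < γ) :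
    Integrable ({ω | ENNReal.ofReal γ < W.SINR s ω}.indicator fun _ => (1 : ℝ)) P := by
  refine Integrable.of_bound (AEMeasurable.aestronglyMeasurable ?_) 1 (ae_of_all _ fun ω => ?_)
  · rw [show {ω | ENNReal.ofReal γ < W.SINR s ω}.indicator (fun _ => (1 : ℝ)) = _ from
      funext (W.indicator_success hiso s hγ)]
    exact (W.aemeasurable_strongest (f := fun x => (W.successOf γ x).indicator 1) fun x =>
      measurable_one.indicator (W.measurableSet_successOf γ x)).ennreal_toReal
  · by_cases h : ω ∈ {ω | ENNReal.ofReal γ < W.SINR s ω} <;> simp [Set.indicator, h]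

theorem surrogate_mem_Icc (hiso : N.IsIsotropic) (s : Scenario) (γ : ℝ) (ω : Ω) :
    W.surrogate s γ ω ∈ Set.Icc (0 : ℝ) 1 :=
  ⟨W.surrogate_nonneg hiso s γ ω, W.surrogate_le_one hiso s γ ω⟩

theorem integrable_surrogate [IsProbabilityMeasure P] (hiso : N.IsIsotropic) (s : Scenario)
    (γ : ℝ) : Integrable (W.surrogate s γ) P := by
  simpa using integrable_pow_of_mem_Icc (W.aemeasurable_surrogate hiso s γ).aestronglyMeasurable
    (ae_of_all _ (W.surrogate_mem_Icc hiso s γ)) 1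

theorem setIntegral_success [IsProbabilityMeasure P] (hiso : N.IsIsotropic) (s : Scenario) {γ : ℝ}
    (hγ : 0 < γ) (A : Set Ω) :
    ∫ ω in A, {ω | ENNReal.ofReal γ < W.SINR s ω}.indicator (fun _ => (1 : ℝ)) ω ∂P =
      (∫⁻ ω in A, (W.successOf γ (W.strongest ω)).indicator 1 ω ∂P).toReal := by
  rw [integral_eq_lintegral_of_nonneg_ae
    (ae_of_all _ fun ω => Set.indicator_nonneg (fun _ _ => zero_le_one) ω)
    (W.integrable_success hiso s hγ).aestronglyMeasurable.restrict]
  congr 1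
  refine lintegral_congr fun ω => ?_
  rw [W.indicator_success hiso s hγ, ENNReal.ofReal_toReal]
  by_cases h : ω ∈ W.successOf γ (W.strongest ω) <;> simp [h]

theorem setIntegral_surrogate [IsProbabilityMeasure P] (hiso : N.IsIsotropic) (s : Scenario)
    (γ : ℝ) (A : Set Ω) :
    ∫ ω in A, W.surrogate s γ ω ∂P =
      (∫⁻ ω in A, ENNReal.ofReal (W.surrogateOf γ (W.strongest ω) ω) ∂P).toReal := by
  rw [integral_eq_lintegral_of_nonneg_ae (ae_of_all _ (W.surrogate_nonneg hiso s γ))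
    (W.integrable_surrogate hiso s γ).aestronglyMeasurable.restrict]
  simp_rw [W.surrogate_eq_surrogateOf hiso]

/-- Conditional expectations are compared through integrals over events of the geometry. Each such
integral decomposes according to the serving transmitter, and this decomposition stays within the
geometry, so the bound for a fixed transmitter applies. -/
theorem condSuccess_le [IsProbabilityMeasure P] (hiso : N.IsIsotropic) (s : Scenario) {γ : ℝ}
    (hγ : 0 < γ) : W.condSuccess s γ ≤ᵐ[P] P[W.surrogate s γ | W.geometry] := by
  refine condExp_le_condExp_of_forall_setIntegral_le W.geometry_le
    (W.integrable_success hiso s hγ) (W.integrable_surrogate hiso s γ) fun A hA => ?_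
  rw [W.setIntegral_success hiso s hγ, W.setIntegral_surrogate hiso s γ]
  refine ENNReal.toReal_mono ?_ (W.setLIntegral_success_le hγ hA)
  have hle : ∀ ω, ENNReal.ofReal (W.surrogateOf γ (W.strongest ω) ω) ≤ 1 := fun ω =>
    ENNReal.ofReal_le_one.2 (W.surrogateOf_le_one γ (W.strongest ω) ω)
  refine ((lintegral_mono hle).trans_lt ?_).ne
  rw [lintegral_one]
  exact measure_lt_top _ _

theorem condSuccess_eq [IsProbabilityMeasure P] (hiso : N.IsIsotropic) (hM : ∀ k, N.M k = 1)
    (s : Scenario) {γ : ℝ} (hγ : 0 < γ) :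
    W.condSuccess s γ =ᵐ[P] P[W.surrogate s γ | W.geometry] := by
  refine (W.condSuccess_le hiso s hγ).antisymm
    (condExp_le_condExp_of_forall_setIntegral_le W.geometry_le
      (W.integrable_surrogate hiso s γ) (W.integrable_success hiso s hγ) fun A hA => ?_)
  rw [W.setIntegral_success hiso s hγ, W.setIntegral_surrogate hiso s γ,
    W.setLIntegral_success_eq hM hγ hA]

theorem moment_le_surrogateMoment [IsProbabilityMeasure P] (hiso : N.IsIsotropic) (s : Scenario)
    (b : ℕ) {γ : ℝ} (hγ : 0 < γ) : W.moment s b γ ≤ W.surrogateMoment s b γ := by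
  have h1 : ∀ᵐ ω ∂P, W.condSuccess s γ ω ∈ Set.Icc (0 : ℝ) 1 :=
    condExp_mem_Icc W.geometry_le (W.integrable_success hiso s hγ) fun ω =>
      ⟨Set.indicator_nonneg (fun _ _ => zero_le_one) ω,
        Set.indicator_le_self' (fun _ _ => zero_le_one) ω⟩
  have h2 := condExp_mem_Icc W.geometry_le (W.integrable_surrogate hiso s γ)
    (W.surrogate_mem_Icc hiso s γ)
  refine integral_mono_ae
    (integrable_pow_of_mem_Icc integrable_condExp.aestronglyMeasurable h1 b)
    (integrable_pow_of_mem_Icc integrable_condExp.aestronglyMeasurable h2 b) ?_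
  filter_upwards [h1, W.condSuccess_le hiso s hγ] with ω h3 h4
  exact pow_le_pow_left₀ h3.1 h4 b

theorem moment_eq_surrogateMoment [IsProbabilityMeasure P] (hiso : N.IsIsotropic)
    (hM : ∀ k, N.M k = 1) (s : Scenario) (b : ℕ) {γ : ℝ} (hγ : 0 < γ) :
    W.moment s b γ = W.surrogateMoment s b γ :=
  integral_congr_ae ((W.condSuccess_eq hiso hM s hγ).mono fun _ h => congrArg (· ^ b) h)

theorem surrogateMoment_le_momentFormula [IsProbabilityMeasure P] (hiso : N.IsIsotropic)
    (s : Scenario) (b : ℕ) {γ : ℝ} (hγ : 0 < γ) :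
    W.surrogateMoment s b γ ≤ N.momentFormula b γ := by
  rw [← W.integral_surrogate_pow hiso s b hγ]
  exact integral_condExp_pow_le W.geometry_le (W.integrable_surrogate hiso s γ)
    (W.surrogate_mem_Icc hiso s γ) b

theorem surrogateMoment_eq_momentFormula [IsProbabilityMeasure P] (hiso : N.IsIsotropic)
    (s : Scenario) {b : ℕ} (hb : b ≤ 1) {γ : ℝ} (hγ : 0 < γ) :
    W.surrogateMoment s b γ = N.momentFormula b γ := by
  rw [← W.integral_surrogate_pow hiso s b hγ, surrogateMoment]
  interval_cases b
  · simp
  · simp only [pow_one]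
    exact integral_condExp W.geometry_le

end Realization

theorem corollary6 (N : Network) (hiso : N.IsIsotropic)
    {Ω : Type*} [MeasurableSpace Ω] (P : Measure Ω) [IsProbabilityMeasure P]
    (W : Realization N P) (b : ℕ) (γ : ℝ) (hγ : 0 < γ) :
    -- the received powers follow power laws, and `χ k ℓ` is the inverse of `l ℓ` after `l k`
    (∀ (s : Scenario) (k : Tier) (r : ℝ), 0 < r →
      N.l s k r = N.Pow k.station * N.GM k.station * N.κ k * r ^ (-N.α k)) ∧
    (∀ (s : Scenario) (k ℓ : Tier) (y : ℝ), 0 < y →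
      0 < N.χ k ℓ y ∧ ∀ r : ℝ, 0 < r → (N.l s ℓ r = N.l s k y ↔ r = N.χ k ℓ y)) ∧
    (∀ s : Scenario,
      -- the formula is an upper bound, through two successive bounds
      W.moment s b γ ≤ W.surrogateMoment s b γ ∧
      W.surrogateMoment s b γ ≤ N.momentFormula b γ ∧
      -- it is the exact value after both approximations
      N.momentFormula b γ = ∫ ω, W.surrogate s γ ω ^ b ∂P ∧
      -- the two cases in which one of the approximations is exact
      ((∀ k, N.M k = 1) → W.moment s b γ = W.surrogateMoment s b γ) ∧
      (b ≤ 1 → W.surrogateMoment s b γ = N.momentFormula b γ)) ∧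
    -- both scenarios coincide
    W.moment .SA b γ = W.moment .VA b γ := by
  refine ⟨fun s k r _ => hiso.l_eq s k r, fun s k ℓ y hy => ⟨N.χ_pos k ℓ hy, fun r hr => ?_⟩,
    fun s => ⟨W.moment_le_surrogateMoment hiso s b hγ,
      W.surrogateMoment_le_momentFormula hiso s b hγ, (W.integral_surrogate_pow hiso s b hγ).symm,
      fun hM => W.moment_eq_surrogateMoment hiso hM s b hγ,
      fun hb => W.surrogateMoment_eq_momentFormula hiso s hb hγ⟩, W.moment_eq hiso _ _ b γ⟩
  rw [hiso.l_eq, hiso.l_eq, N.power_eq_iff k ℓ hr hy]
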